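/- Let $d\ge 2$, $L>0$, $g>0$, $\rho_+>\rho_->0$, and let $A=(\rho_+-\rho_-)/(\rho_++\rho_-)$ be the Atwood number. Write $x=(y,z)\in\mathbb R^{d-1}\times\mathbb R$, let $\mathbf e_z$ be the vertical unit vector, and put $$⨍ f\,dx=\frac1{L^{d-1}}\int_{[0,L]^{d-1}\times\mathbb R} f(x)\,dx ,\qquad \rho_0(z)=\rho_+\ (z\ge 0),\quad \rho_0(z)=\rho_-\ (z<0).$$ Let $(\rho,\mathbf u)$, with pressure $p$, be a classical solution on $[0,L]^{d-1}\times\mathbb R$, $t>0$, $L$-periodic in each component of $y$, of $$\rho_t+\mathbf u\cdot\nabla\rho-\Delta\rho=0,\qquad \rho(\mathbf u_t+(\mathbf u\cdot\nabla)\mathbf u)-(\nabla\rho\cdot\nabla)\mathbf u+\nabla p+\rho g\,\mathbf e_z=0,\qquad \nabla\cdot\mathbf u=0 .$$ That is: for $t>0$, $\rho$ is $C^1$ in $(t,x)$ with second spatial derivatives continuous in $(t,x)$, $\mathbf u$ is $C^1$ in $(t,x)$, $p(t,\cdot)$ is $C^1$, and the equations hold pointwise; the initial data are attained in $L^1_{\mathrm{loc}}$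 (for $\rho$) and $L^2_{\mathrm{loc}}$ (for $\mathbf u$) as $t\downarrow 0$. The fluid is at rest at infinity: for every $T>0$, on $0<t\le T$, $\rho$ is bounded, $\mathbf u\to 0$ as $|z|\to\infty$ uniformly in $(t,y)$, and $\nabla_y p$ is bounded for $|z|$ large. Define $$E_p(t)=\frac{1}{\rho_+-\rho_-}⨍(\rho_0-\rho)\,gz\,dx,\qquad H(t)=\frac{1}{(\rho_+-\rho_-)^2}⨍(\rho_+-\rho)(\rho-\rho_-)\,dx,\qquad P(t)=\frac1{\rho_+-\rho_-}⨍|\nabla\rho|\,dx ,$$ where $P(0)$ is understood as a total variation if $\rho(\cdot,0)$ is not differentiable. Assume that $\rho_-\le\rho(\cdot,0)\le\rho_+$, that $E_p(0)$, $H(0)$ and $P(0)$ are finite, and that the initial kinetic energy $\frac12\frac1{\rho_+-\rho_-}⨍\rho|\mathbf u|^2dx\big|_{t=0}$ is finite. Then $E_p(t)$ and $H(t)$ are finite for all $t\ge 0$, and $$\limsup_{t\to+\infty}\frac{E_p(t)}{g(Agt^2)^2}\le\frac1{24(1-A^2)},\qquad \limsup_{t\to+\infty}\frac{H(t)}{Agt^2}\le\frac1{12\sqrt{1-A^2}},\qquad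 \limsup_{t\to+\infty}\frac1{(Agt^2)^2}\int_0^tP^2(\tau)\,d\tau\le\frac{\pi}{36(1-A^2)} .$$ -/

import Mathlib

open Filter Topology MeasureTheory
open scoped ENNReal Laplacian

noncomputable section

namespace RayleighTaylor

/-- The space `ℝ^d`, `d = n + 1`, of points `x = (y, z)`: the first `n` coordinates are the
transverse variable `y`, the last one is the vertical variable `z`. -/
abbrev Space (n : ℕ) : Type := EuclideanSpace ℝ (Fin (n + 1))

/-- The vertical coordinate `z` of `x = (y, z)`. -/
def vert {n : ℕ} (x : Space n) : ℝ := x (Fin.last n)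

/-- The unit vector `e_z`. -/
def ez (n : ℕ) : Space n := EuclideanSpace.single (Fin.last n) 1

/-- The strip `[0, L]^{d-1} × ℝ`. -/
def strip (n : ℕ) (L : ℝ) : Set (Space n) :=
  {x | ∀ i : Fin n, x i.castSucc ∈ Set.Icc 0 L}

/-- `L`-periodicity in each of the transverse variables. -/
def TransversePeriodic {n : ℕ} {α : Type*} (L : ℝ) (f : Space n → α) : Prop :=
  ∀ (i : Fin n) (x : Space n), f (x + EuclideanSpace.single i.castSucc L) = f x

/-- Lebesgue measure on the strip, divided by `L^{d-1}`: integration against it is the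
normalized integral. -/
def normVol (n : ℕ) (L : ℝ) : Measure (Space n) :=
  ENNReal.ofReal ((L ^ n)⁻¹) • (volume.restrict (strip n L))

/-- Divergence of a vector field. -/
def divergence {n : ℕ} (v : Space n → Space n) (x : Space n) : ℝ :=
  ∑ i, fderiv ℝ v x (EuclideanSpace.single i 1) i

/-- The stratified density profile: `ρ₊` for `z ≥ 0` and `ρ₋` for `z < 0`. -/
def stratified {n : ℕ} (rp rm : ℝ) (x : Space n) : ℝ := if 0 ≤ vert x then rp else rm

/-- The Atwood number. -/
def atwood (rp rm : ℝ) : ℝ := (rp - rm) / (rp + rm)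

/-- The integrand of the (negative) potential energy. -/
def potDensity {n : ℕ} (g rp rm : ℝ) (r : Space n → ℝ) (x : Space n) : ℝ :=
  (stratified rp rm x - r x) * g * vert x

/-- The (negative) potential energy `E_p` of a density `r`. -/
def potentialEnergy {n : ℕ} (L g rp rm : ℝ) (r : Space n → ℝ) : ℝ :=
  1 / (rp - rm) * ∫ x, potDensity g rp rm r x ∂(normVol n L)

/-- The integrand of the mixing entropy. -/
def mixDensity {n : ℕ} (rp rm : ℝ) (r : Space n → ℝ) (x : Space n) : ℝ :=
  (rp - r x) * (r x - rm)

/-- The mixing entropy `H` of a density `r`. -/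
def mixingEntropy {n : ℕ} (L rp rm : ℝ) (r : Space n → ℝ) : ℝ :=
  1 / (rp - rm) ^ 2 * ∫ x, mixDensity rp rm r x ∂(normVol n L)

/-- The mean perimeter `P` of a continuously differentiable density `r`, in `[0, ∞]`. -/
def perimeter {n : ℕ} (L rp rm : ℝ) (r : Space n → ℝ) : ℝ≥0∞ :=
  ENNReal.ofReal (1 / (rp - rm)) * ∫⁻ x, ‖gradient r x‖ₑ ∂(normVol n L)

/-- The mean perimeter of a density `r` that need not be differentiable: the normalized total
variation of `r` in the strip with periodic transverse boundary conditions, by duality with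
test fields. It agrees with `perimeter` for continuously differentiable periodic `r`. It is used
for the initial density only, which may be discontinuous. -/
def perimeterBV {n : ℕ} (L rp rm : ℝ) (r : Space n → ℝ) : ℝ≥0∞ :=
  ENNReal.ofReal (1 / (rp - rm)) *
    ⨆ φ ∈ {φ : Space n → Space n | ContDiff ℝ 1 φ ∧ TransversePeriodic L φ ∧
        (∃ R : ℝ, ∀ x, R ≤ |vert x| → φ x = 0) ∧ ∀ x, ‖φ x‖ ≤ 1},
      ENNReal.ofReal (∫ x, r x * divergence φ x ∂(normVol n L))

/-- `(ρ, u)`, with pressure `p`, is a global classical solution of the miscible inviscid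
Rayleigh–Taylor system in `[0, L]^{d-1} × ℝ`, periodic in the transverse variables and at rest at
infinity. For positive times all derivatives occurring in the equations exist and are continuous
and the equations hold pointwise; the initial data `(ρ 0, u 0)` are attained in
`L¹_loc × L²_loc`, so they may be discontinuous. -/
structure IsClassicalSolution (n : ℕ) (L g : ℝ)
    (ρ : ℝ → Space n → ℝ) (u : ℝ → Space n → Space n) (p : ℝ → Space n → ℝ) : Prop where
  -- periodicity
  periodic_density : ∀ t, 0 ≤ t → TransversePeriodic L (ρ t)
  periodic_velocity : ∀ t, 0 ≤ t → TransversePeriodic L (u t)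
  periodic_pressure : ∀ t, 0 < t → TransversePeriodic L (p t)
  -- regularity for positive times
  contDiff_density : ContDiffOn ℝ 1 (fun q : ℝ × Space n => ρ q.1 q.2) (Set.Ioi 0 ×ˢ Set.univ)
  contDiff_density_space : ∀ t, 0 < t → ContDiff ℝ 2 (ρ t)
  continuous_hessian : ContinuousOn
    (fun q : ℝ × Space n => iteratedFDeriv ℝ 2 (ρ q.1) q.2) (Set.Ioi 0 ×ˢ Set.univ)
  contDiff_velocity : ContDiffOn ℝ 1 (fun q : ℝ × Space n => u q.1 q.2) (Set.Ioi 0 ×ˢ Set.univ)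
  contDiff_pressure : ∀ t, 0 < t → ContDiff ℝ 1 (p t)
  -- the equations
  transport : ∀ t, 0 < t → ∀ x,
    deriv (fun s => ρ s x) t + inner ℝ (u t x) (gradient (ρ t) x) - (Δ (ρ t)) x = 0
  momentum : ∀ t, 0 < t → ∀ x,
    ρ t x • (deriv (fun s => u s x) t + fderiv ℝ (u t) x (u t x))
      - fderiv ℝ (u t) x (gradient (ρ t) x) + gradient (p t) x + (ρ t x * g) • ez n = 0
  incompressible : ∀ t, 0 < t → ∀ x, divergence (u t) x = 0
  -- the initial data are measurable and attained
  measurable_density : AEStronglyMeasurable (ρ 0) volume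
  measurable_velocity : AEStronglyMeasurable (u 0) volume
  initial_density : ∀ R : ℝ, Tendsto
    (fun t => ∫⁻ x in {x | |vert x| ≤ R}, ‖ρ t x - ρ 0 x‖ₑ ∂(normVol n L)) (𝓝[>] 0) (𝓝 0)
  initial_velocity : ∀ R : ℝ, Tendsto
    (fun t => ∫⁻ x in {x | |vert x| ≤ R}, ‖u t x - u 0 x‖ₑ ^ 2 ∂(normVol n L)) (𝓝[>] 0) (𝓝 0)
  -- behaviour at infinity, locally uniform in time: the density is bounded, the velocity tends
  -- to zero, and the horizontal pressure gradient stays bounded for large `|z|`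
  bounded_density : ∀ T : ℝ, ∃ C : ℝ, ∀ t ∈ Set.Ioc 0 T, ∀ x, |ρ t x| ≤ C
  velocity_vanishes : ∀ T : ℝ, ∀ ε > 0, ∃ R : ℝ, ∀ t ∈ Set.Ioc 0 T, ∀ x,
    R ≤ |vert x| → ‖u t x‖ ≤ ε
  horizontal_pressure : ∀ T : ℝ, ∃ C R : ℝ, ∀ t ∈ Set.Ioc 0 T, ∀ x,
    R ≤ |vert x| → ∀ i : Fin n, |gradient (p t) x i.castSucc| ≤ C

end RayleighTaylor

end

open Filter Topology MeasureTheory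
open scoped ENNReal Laplacian

noncomputable section

namespace RayleighTaylor

/-! ### Slabs of the periodic strip, integrability, and the divergence theorem -/

variable {n : ℕ} {L : ℝ}

/-! The width `L` of the strip is fixed, and at large times this excludes the self-similar regime:
in fact `E_p = O(t^2)`, `H = O(t)` and `∫_0^t P^2 = O(t^3)`. Measured against `t^4`, `t^2` and
`t^4`, these make all three upper limits at most zero, so the particular positive constants on the
right-hand sides play no role.

The gain comes from Poincaré's inequality across one period. An incompressible field that vanishes
at infinity has a vertical component of mean zero on every horizontal slice, so in the flux `∫ ρ
u_z` the density may be replaced by its deviation from the slice average. Hence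
`abs_integral_flux_le`: for every `l > 0` the flux is bounded by a multiple of `l ∫ |u|^2 + (n L^2 /
l) ∫ |∇ρ|^2`. The time integral of `∫ |∇ρ|^2` is in turn bounded by the mixing volume `D = sup ∫ |ρ₀
- ρ|` over the time interval, because `(ρ₊ - ρ)(ρ - ρ₋)` has constant negative second derivative
(`exists_integral_dissipation_le`).

In the balance of kinetic energy the term `(∇ρ·∇)u` and the diffusion of `ρ` combine into a
divergence, and only the gravity flux survives. Taking `l` of order `1/T` bounds the kinetic energy
on `(0, T]` by a multiple of `1 + T(1 + D)` (`exists_kinetic_bound`), and then the potential energy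
by a quantity of the same form (`exists_liftVolume_bound`). By the maximum principle `ρ₀ - ρ` has
the sign of `z`, so the potential energy is the first moment of `|ρ₀ - ρ|`. Therefore `D` is at most
a multiple of `R` plus `1/R` times the potential energy, for every `R > 0`; choosing `R` of order
`T` closes the estimate, with `D = O(T)` and then potential energy `O(T^2)` (`exists_growth_bound`).
The entropy `H` is at most a multiple of `D`.

For the perimeter, let `θ` be the volume fraction and `k` a weight of order `1/θ + 1/(1-θ)`.
Cauchy–Schwarz gives `(∫ |∇ρ|)^2 ≤ ∫ k |∇ρ|^2 · ∫ 1/k`. The second factor is `O(D)`; the first is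
the dissipation of an entropy resembling `-θ log θ - (1-θ) log(1-θ)`, whose integral is controlled
by the mixing volume and the potential energy, hence `O(T^2)`. A finite dyadic sum of exponentials
(`expEntropy`) replaces the logarithms and keeps everything smooth.

Every balance is written with a vertical cutoff at height `N`. The edge terms become small as `N`
grows because the velocity vanishes at infinity. That `D` is finite at all, which the closing
argument needs, is proved separately in `exists_mixVolume_bound`. -/

/-- The part of the strip in which `|z| ≤ R`. -/
def slab (n : ℕ) (L R : ℝ) : Set (Space n) := strip n L ∩ {x | |vert x| ≤ R}

/-- The lower corner of `slab n L R`. -/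
def slabLower (n : ℕ) (R : ℝ) : Fin (n + 1) → ℝ := Fin.lastCases (-R) (fun _ => 0)

/-- The upper corner of `slab n L R`. -/
def slabUpper (n : ℕ) (L R : ℝ) : Fin (n + 1) → ℝ := Fin.lastCases R (fun _ => L)

lemma slab_eq_preimage (n : ℕ) (L R : ℝ) :
    slab n L R = WithLp.ofLp ⁻¹' Set.Icc (slabLower n R) (slabUpper n L R) := by
  ext x
  simp only [slab, strip, vert, Set.mem_inter_iff, Set.mem_ofPred_eq, Set.mem_preimage,
    Set.mem_Icc, Pi.le_def, Fin.forall_fin_succ', slabLower, slabUpper, Fin.lastCases_last,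
    Fin.lastCases_castSucc, abs_le]
  constructor
  · rintro ⟨h1, h2, h3⟩
    exact ⟨⟨fun i => (h1 i).1, h2⟩, fun i => (h1 i).2, h3⟩
  · rintro ⟨⟨h1, h2⟩, h3, h4⟩
    exact ⟨fun i => ⟨h1 i, h3 i⟩, h2, h4⟩

lemma isCompact_slab (n : ℕ) (L R : ℝ) : IsCompact (slab n L R) := by
  rw [slab_eq_preimage]
  exact (PiLp.homeomorph 2 (fun _ : Fin (n + 1) => ℝ)).isCompact_preimage.2 isCompact_Icc

@[fun_prop]
lemma continuous_vert : Continuous (vert : Space n → ℝ) := by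
  unfold vert; fun_prop

@[fun_prop]
lemma contDiff_vert {k : WithTop ℕ∞} : ContDiff ℝ k (vert : Space n → ℝ) := by
  unfold vert; fun_prop

lemma isClosed_strip (n : ℕ) (L : ℝ) : IsClosed (strip n L) := by
  simp only [strip, Set.ofPred_forall]
  refine isClosed_iInter fun i => isClosed_Icc.preimage (by fun_prop)

lemma measurableSet_strip (n : ℕ) (L : ℝ) : MeasurableSet (strip n L) :=
  (isClosed_strip n L).measurableSet

lemma volume_slab (hL : 0 ≤ L) (R : ℝ) :
    volume (slab n L R) = ENNReal.ofReal (L ^ n) * ENNReal.ofReal (2 * R) := by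
  rw [slab_eq_preimage, (PiLp.volume_preserving_ofLp (Fin (n + 1))).measure_preimage
    measurableSet_Icc.nullMeasurableSet, Real.volume_Icc_pi, Fin.prod_univ_castSucc]
  simp only [slabLower, slabUpper, Fin.lastCases_last, Fin.lastCases_castSucc, sub_zero,
    Finset.prod_const, Finset.card_univ, Fintype.card_fin]
  rw [ENNReal.ofReal_pow hL]
  congr 2; ring

lemma normVol_slab (hL : 0 < L) (R : ℝ) :
    normVol n L {x | |vert x| ≤ R} = ENNReal.ofReal (2 * R) := by
  have hm : MeasurableSet {x : Space n | |vert x| ≤ R} :=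
    measurableSet_le (by fun_prop) (by fun_prop)
  have h1 : 0 < L ^ n := pow_pos hL n
  rw [normVol, Measure.smul_apply, Measure.restrict_apply hm, Set.inter_comm,
    show strip n L ∩ {x | |vert x| ≤ R} = slab n L R from rfl, volume_slab hL.le, smul_eq_mul,
    ← mul_assoc, ← ENNReal.ofReal_mul (inv_nonneg.2 h1.le), inv_mul_cancel₀ h1.ne',
    ENNReal.ofReal_one, one_mul]

lemma ae_mem_strip (n : ℕ) (L : ℝ) : ∀ᵐ x ∂(normVol n L), x ∈ strip n L :=
  Measure.ae_smul_measure (ae_restrict_mem (measurableSet_strip n L)) _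

/-- A measurable function which is bounded in the strip and vanishes for `|z| > R` is integrable,
with the obvious bound. -/
lemma integrable_of_slab (hL : 0 < L) {f : Space n → ℝ} {B R : ℝ}
    (hf : AEStronglyMeasurable f (normVol n L)) (hB : ∀ x ∈ strip n L, |f x| ≤ B)
    (hR : ∀ x, R < |vert x| → f x = 0) : Integrable f (normVol n L) := by
  have hm : MeasurableSet {x : Space n | |vert x| ≤ R} :=
    measurableSet_le (by fun_prop) (by fun_prop)
  have : IntegrableOn f {x | |vert x| ≤ R} (normVol n L) :=
    Measure.integrableOn_of_bounded (by rw [normVol_slab hL]; exact ENNReal.ofReal_ne_top) hf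
      (M := B) (ae_restrict_of_ae ((ae_mem_strip n L).mono fun x hx => hB x hx))
  refine (integrableOn_iff_integrable_of_support_subset fun x hx => ?_).1 this
  by_contra h
  exact hx (hR x (not_le.1 h))

lemma abs_integral_le_of_slab (hL : 0 < L) {f : Space n → ℝ} {B R : ℝ} (hR0 : 0 ≤ R)
    (hB : ∀ x ∈ strip n L, |f x| ≤ B)
    (hR : ∀ x, R < |vert x| → f x = 0) : |∫ x, f x ∂(normVol n L)| ≤ B * (2 * R) := by
  have h1 : ∫ x, f x ∂(normVol n L) = ∫ x in {x | |vert x| ≤ R}, f x ∂(normVol n L) := by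
    refine (setIntegral_eq_integral_of_forall_compl_eq_zero fun x hx => hR x (not_le.1 hx)).symm
  rw [h1]
  have := norm_setIntegral_le_of_norm_le_const_ae' (μ := normVol n L) (f := f) (C := B)
    (s := {x | |vert x| ≤ R})
    (by rw [normVol_slab hL]; exact ENNReal.ofReal_lt_top)
    ((ae_mem_strip n L).mono fun x hx _ => hB x hx)
  rwa [Measure.real, normVol_slab hL, ENNReal.toReal_ofReal (by positivity)] at this

lemma exists_bound_of_continuous (L : ℝ) {f : Space n → ℝ} {R : ℝ} (hf : Continuous f)
    (hR : ∀ x, R < |vert x| → f x = 0) : ∃ B, 0 ≤ B ∧ ∀ x ∈ strip n L, |f x| ≤ B := by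
  obtain ⟨B, hB⟩ := (isCompact_slab n L R).exists_bound_of_continuousOn hf.continuousOn
  refine ⟨max B 0, le_max_right _ _, fun x hx => ?_⟩
  by_cases h : R < |vert x|
  · rw [hR x h, abs_zero]; exact le_max_right _ _
  · exact (hB x ⟨hx, not_lt.1 h⟩).trans (le_max_left _ _)

lemma integrable_of_continuous (hL : 0 < L) {f : Space n → ℝ} {R : ℝ} (hf : Continuous f)
    (hR : ∀ x, R < |vert x| → f x = 0) : Integrable f (normVol n L) := by
  obtain ⟨B, -, hB⟩ := exists_bound_of_continuous L hf hR
  exact integrable_of_slab hL hf.aestronglyMeasurable hB hR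

lemma continuous_divergence {F : Space n → Space n} (hF : ContDiff ℝ 1 F) :
    Continuous (divergence F) := by
  unfold divergence
  have : Continuous (fderiv ℝ F) := hF.continuous_fderiv one_ne_zero
  fun_prop

lemma divergence_eq_zero_of_slab {F : Space n → Space n} {R : ℝ}
    (hR : ∀ x, R ≤ |vert x| → F x = 0) (x : Space n) (hx : R < |vert x|) : divergence F x = 0 := by
  have h1 : F =ᶠ[𝓝 x] fun _ => 0 := by
    have : ∀ᶠ y in 𝓝 x, R < |vert y| :=
      (continuous_abs.comp continuous_vert).continuousAt.eventually (lt_mem_nhds hx)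
    exact this.mono fun y hy => hR y (le_of_lt hy)
  simp [divergence, h1.fderiv_eq]

/-- The divergence theorem for periodic fields of bounded vertical support. -/
theorem integral_divergence_eq_zero (hL : 0 < L) {F : Space n → Space n} (hF : ContDiff ℝ 1 F)
    (hper : TransversePeriodic L F) {R : ℝ} (hR0 : 0 ≤ R) (hR : ∀ x, R ≤ |vert x| → F x = 0) :
    ∫ x, divergence F x ∂(normVol n L) = 0 := by
  have hsupp := divergence_eq_zero_of_slab hR
  rw [normVol, integral_smul_measure]
  have h1 : ∫ x in strip n L, divergence F x = ∫ x in slab n L R, divergence F x := by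
    refine setIntegral_eq_of_subset_of_forall_sdiff_eq_zero (measurableSet_strip n L)
      Set.inter_subset_left fun x hx => hsupp x ?_
    by_contra h
    exact hx.2 ⟨hx.1, not_lt.1 h⟩
  have hle : slabLower n R ≤ slabUpper n L R := by
    rw [Pi.le_def, Fin.forall_fin_succ']
    simp [slabLower, slabUpper, hL.le, hR0]
  let e : (Fin (n + 1) → ℝ) ≃L[ℝ] Space n := (EuclideanSpace.equiv (Fin (n + 1)) ℝ).symm
  have he : ∀ y, e y = WithLp.toLp 2 y := fun y => rfl
  have hes : ∀ i, e (Pi.single i 1) = EuclideanSpace.single i 1 := fun i => rfl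
  have hd : ∀ y, HasFDerivAt (fun y => (e.symm (F (e y)) : Fin (n + 1) → ℝ))
      ((e.symm : Space n →L[ℝ] _).comp ((fderiv ℝ F (e y)).comp (e : _ →L[ℝ] Space n))) y := by
    intro y
    have h2 := (hF.differentiable one_ne_zero (e y)).hasFDerivAt.comp y e.hasFDerivAt
    exact (e.symm.hasFDerivAt (x := F (e y))).comp y h2
  -- The divergence theorem on a box of `Fin (n + 1) → ℝ`, applied to `F` read through the linear
  -- equivalence `e`. It leaves a sum of differences over pairs of opposite faces.
  have h2 := integral_divergence_of_hasFDerivAt_off_countable (slabLower n R) (slabUpper n L R) hle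
    (fun y => e.symm (F (e y))) _ ∅ Set.countable_empty
    (by have := hF.continuous; fun_prop) (fun y _ => hd y)
    (by
      refine ContinuousOn.integrableOn_compact isCompact_Icc (Continuous.continuousOn ?_)
      have := (hF.continuous_fderiv one_ne_zero)
      refine continuous_finsetSum _ fun i _ => ?_
      have h3 : Continuous fun y => fderiv ℝ F (e y) (e (Pi.single i 1)) i := by fun_prop
      exact h3)
  have h3 : ∫ x in slab n L R, divergence F x =
      ∫ y in Set.Icc (slabLower n R) (slabUpper n L R), divergence F (e y) := by
    rw [slab_eq_preimage]
    exact (PiLp.volume_preserving_ofLp (Fin (n + 1))).setIntegral_preimage_emb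
      (PiLp.homeomorph 2 (fun _ : Fin (n + 1) => ℝ)).measurableEmbedding
      (fun y => divergence F (e y)) _
  rw [h1, h3]
  refine smul_eq_zero_of_right _ (h2.trans ?_)
  refine Finset.sum_eq_zero fun i _ => ?_
  induction i using Fin.lastCases with
  | last =>
    -- On the top and bottom faces `|z| = R`, where `F` vanishes.
    have hz : ∀ (c : ℝ) (_ : |c| = R) (x : Fin n → ℝ),
        F (e ((Fin.last n).insertNth c x)) = 0 := by
      intro c hc x
      apply hR
      simp [he, vert, hc]
    have hu : |slabUpper n L R (Fin.last n)| = R := by simp [slabUpper, abs_of_nonneg hR0]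
    have hl : |slabLower n R (Fin.last n)| = R := by simp [slabLower, abs_of_nonneg hR0]
    simp only [hz _ hu, hz _ hl, map_zero, sub_self]
  | cast i =>
    -- Opposite lateral faces differ by one period, so their contributions cancel.
    rw [sub_eq_zero]
    refine integral_congr_ae (Eventually.of_forall fun x => ?_)
    have hp := hper i (e (i.castSucc.insertNth (slabLower n R i.castSucc) x))
    have hx : e (i.castSucc.insertNth (slabLower n R i.castSucc) x) +
        EuclideanSpace.single i.castSucc L =
        e (i.castSucc.insertNth (slabUpper n L R i.castSucc) x) := by
      ext j
      rcases eq_or_ne j i.castSucc with rfl | hj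
      · simp [he, slabLower, slabUpper]
      · obtain ⟨k, rfl⟩ := Fin.exists_succAbove_eq hj
        simp [he, slabLower, slabUpper, Fin.succAbove_ne]
    rw [hx] at hp
    simp only [hp]

/-! ### Invariance of integrals under transverse translations -/

/-- The slab of width `L` starting at `t` in the `i`-th transverse direction. -/
def transverseSlab (i : Fin n) (L t : ℝ) : Set (Space n) := {x | x i.castSucc ∈ Set.Ioc t (t + L)}

/-- A half-open interval of length `L` contains exactly one representative modulo `L`. The starting
point `t` is left free so that two slabs can be compared. -/
lemma isAddFundamentalDomain_transverseSlab (hL : 0 < L) (i : Fin n) (t : ℝ) :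
    IsAddFundamentalDomain
      (AddSubgroup.zmultiples (EuclideanSpace.single i.castSucc L : Space n))
      (transverseSlab i L t) (volume : Measure (Space n)) := by
  have hm : MeasurableSet (transverseSlab (n := n) i L t) :=
    measurableSet_Ioc.preimage (by fun_prop)
  refine IsAddFundamentalDomain.mk' hm.nullMeasurableSet fun x => ?_
  have hinj : Function.Injective fun k : ℤ => k • (EuclideanSpace.single i.castSucc L : Space n) := by
    intro a b hab
    have := congrArg (fun y : Space n => y i.castSucc) hab
    simpa [hL.ne'] using this
  have : Function.Bijective (Set.codRestrict
      (fun k : ℤ => k • (EuclideanSpace.single i.castSucc L : Space n))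
      (AddSubgroup.zmultiples (EuclideanSpace.single i.castSucc L : Space n)) fun k => ⟨k, rfl⟩) :=
    (Equiv.ofInjective _ hinj).bijective
  refine this.existsUnique_iff.2 ?_
  have h := existsUnique_add_zsmul_mem_Ioc hL (x i.castSucc) t
  convert h using 2 with k
  have h2 : ((Set.codRestrict
      (fun k : ℤ => k • (EuclideanSpace.single i.castSucc L : Space n))
      (AddSubgroup.zmultiples (EuclideanSpace.single i.castSucc L : Space n)) (fun k => ⟨k, rfl⟩) k)
        : Space n) = k • (EuclideanSpace.single i.castSucc L : Space n) := rfl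
  rw [AddSubgroup.vadd_def, vadd_eq_add, add_comm, h2]
  simp [transverseSlab]

/-- The constraint of the strip on the transverse coordinates other than the `i`-th. -/
def otherStrip (i : Fin n) (L : ℝ) : Set (Space n) :=
  {x | ∀ j : Fin n, j ≠ i → x j.castSucc ∈ Set.Icc 0 L}

lemma measurableSet_otherStrip (i : Fin n) (L : ℝ) : MeasurableSet (otherStrip i L) := by
  simp only [otherStrip, Set.ofPred_forall]
  exact MeasurableSet.iInter fun j => MeasurableSet.iInter fun _ =>
    measurableSet_Icc.preimage (by fun_prop)

/-- The two sets differ only inside the hyperplane where the `i`-th coordinate vanishes, which is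
null. -/
lemma strip_ae_eq (i : Fin n) (L : ℝ) :
    strip n L =ᵐ[volume] (otherStrip i L ∩ transverseSlab i L 0 : Set (Space n)) := by
  have h0 : ∀ᵐ x : Space n, x i.castSucc ≠ 0 := by
    let l : Space n →ₗ[ℝ] ℝ := (EuclideanSpace.proj (𝕜 := ℝ) i.castSucc).toLinearMap
    have hl : LinearMap.ker l ≠ ⊤ := by
      intro h
      have : l (EuclideanSpace.single i.castSucc 1) = 0 := by
        rw [← LinearMap.mem_ker, h]; trivial
      simp [l] at this
    have := Measure.addHaar_submodule (volume : Measure (Space n)) _ hl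
    rw [ae_iff]
    convert this using 2
    ext x
    simp [l]
  refine h0.mono fun x hx => propext ?_
  change x ∈ strip n L ↔ x ∈ otherStrip i L ∩ transverseSlab i L 0
  constructor
  · intro h
    exact ⟨fun j _ => h j, lt_of_le_of_ne (h i).1 (Ne.symm hx), by simpa using (h i).2⟩
  · rintro ⟨h1, h2⟩ j
    by_cases hj : j = i
    · subst hj; exact ⟨h2.1.le, by simpa using h2.2⟩
    · exact h1 j hj

lemma preimage_otherStrip (i : Fin n) (L s : ℝ) :
    (fun x : Space n => x + EuclideanSpace.single i.castSucc s) ⁻¹' otherStrip i L =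
      otherStrip i L := by
  ext x
  simp only [otherStrip, Set.mem_preimage, Set.mem_ofPred_eq]
  refine forall₂_congr fun j hj => ?_
  simp [hj]

lemma preimage_transverseSlab (i : Fin n) (L s : ℝ) :
    (fun x : Space n => x + EuclideanSpace.single i.castSucc s) ⁻¹' transverseSlab i L s =
      transverseSlab i L 0 := by
  ext x
  simp [transverseSlab]
  intro _
  constructor <;> intro h <;> linarith

lemma TransversePeriodic.zsmul {α : Type*} {f : Space n → α} (hf : TransversePeriodic L f)
    (i : Fin n) (k : ℤ) (x : Space n) :
    f (x + k • (EuclideanSpace.single i.castSucc L : Space n)) = f x := by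
  have : Function.Periodic f (EuclideanSpace.single i.castSucc L : Space n) := hf i
  exact this.zsmul k x

lemma periodic_indicator_otherStrip {α : Type*} [Zero α] {f : Space n → α}
    (hf : TransversePeriodic L f) (i : Fin n)
    (γ : AddSubgroup.zmultiples (EuclideanSpace.single i.castSucc L : Space n)) (x : Space n) :
    (otherStrip i L).indicator f (γ +ᵥ x) = (otherStrip i L).indicator f x := by
  obtain ⟨_, k, rfl⟩ := γ
  have h1 : (γ : Space n) → γ +ᵥ x = x + γ := fun γ => add_comm _ _
  have h2 : k • (EuclideanSpace.single i.castSucc L : Space n) =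
      EuclideanSpace.single i.castSucc (k * L) := by
    ext j; simp
  have h3 : x + k • (EuclideanSpace.single i.castSucc L : Space n) ∈ otherStrip i L ↔
      x ∈ otherStrip i L := by
    rw [h2]
    exact iff_of_eq (congrArg (x ∈ ·) (preimage_otherStrip i L (k * L)))
  simp only [AddSubgroup.vadd_def, vadd_eq_add]
  rw [add_comm _ x]
  by_cases h4 : x ∈ otherStrip i L <;> simp [Set.indicator, h3, hf.zsmul i k x, h4]

/-- Translation by `s` carries the slab starting at `0` to the one starting at `s`, and a periodic
integrand has the same integral over any two fundamental domains. The constraint on the other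
coordinates is absorbed into the integrand as an indicator, which is itself periodic in direction
`i`. -/
lemma setIntegral_strip_add_single (hL : 0 < L) {f : Space n → ℝ} (hf : TransversePeriodic L f)
    (i : Fin n) (s : ℝ) :
    ∫ x in strip n L, f (x + EuclideanSpace.single i.castSucc s) = ∫ x in strip n L, f x := by
  have key : ∀ h : Space n → ℝ, ∫ x in strip n L, h x =
      ∫ x in transverseSlab i L 0, (otherStrip i L).indicator h x := by
    intro h
    rw [setIntegral_congr_set (strip_ae_eq i L), Set.inter_comm,
      setIntegral_indicator (measurableSet_otherStrip i L)]
  rw [key, key f, (isAddFundamentalDomain_transverseSlab hL i 0).setIntegral_eq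
    (isAddFundamentalDomain_transverseSlab hL i s) (periodic_indicator_otherStrip hf i),
    ← (measurePreserving_add_right volume
      (EuclideanSpace.single i.castSucc s : Space n)).setIntegral_preimage_emb
      (measurableEmbedding_addRight _) _ (transverseSlab i L s), preimage_transverseSlab]
  refine integral_congr_ae (Eventually.of_forall fun x => ?_)
  conv_lhs => rw [← preimage_otherStrip i L s]
  rfl

lemma setLIntegral_strip_add_single (hL : 0 < L) {f : Space n → ℝ≥0∞}
    (hf : TransversePeriodic L f) (i : Fin n) (s : ℝ) :
    ∫⁻ x in strip n L, f (x + EuclideanSpace.single i.castSucc s) = ∫⁻ x in strip n L, f x := by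
  have key : ∀ h : Space n → ℝ≥0∞, ∫⁻ x in strip n L, h x =
      ∫⁻ x in transverseSlab i L 0, (otherStrip i L).indicator h x := by
    intro h
    rw [setLIntegral_congr (strip_ae_eq i L), Set.inter_comm,
      setLIntegral_indicator (measurableSet_otherStrip i L), Set.inter_comm]
  rw [key, key f, (isAddFundamentalDomain_transverseSlab hL i 0).setLIntegral_eq
    (isAddFundamentalDomain_transverseSlab hL i s) _ (periodic_indicator_otherStrip hf i),
    ← (measurePreserving_add_right volume
      (EuclideanSpace.single i.castSucc s : Space n)).setLIntegral_comp_preimage_emb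
      (measurableEmbedding_addRight _) _ (transverseSlab i L s), preimage_transverseSlab]
  refine lintegral_congr fun x => ?_
  conv_lhs => rw [← preimage_otherStrip i L s]
  rfl

lemma TransversePeriodic.comp_add {α : Type*} {f : Space n → α} (hf : TransversePeriodic L f)
    (v : Space n) : TransversePeriodic L fun x => f (x + v) := by
  intro i x
  change f (x + _ + v) = f (x + v)
  rw [add_right_comm]
  exact hf i _

/-- An additive property of transverse vectors holds if it holds in the coordinate directions. -/
lemma transverse_induction {p : Space n → Prop} (h0 : p 0) (hadd : ∀ v w, p v → p w → p (v + w))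
    (hs : ∀ (i : Fin n) s, p (EuclideanSpace.single i.castSucc s)) {v : Space n}
    (hv : vert v = 0) : p v := by
  have : v = ∑ i : Fin n, EuclideanSpace.single i.castSucc (v i.castSucc) := by
    ext j
    induction j using Fin.lastCases with
    | last => simpa [vert, Pi.single_apply, Fin.castSucc_ne_last, eq_comm] using hv
    | cast j => simp [Pi.single_apply, Fin.castSucc_inj]
  rw [this]
  exact Finset.sum_induction _ p hadd h0 fun i _ => hs i _

/-- Integrals of periodic functions over the strip are invariant under transverse translations. -/
theorem integral_add_transverse (hL : 0 < L) {f : Space n → ℝ} (hf : TransversePeriodic L f)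
    {v : Space n} (hv : vert v = 0) :
    ∫ x, f (x + v) ∂(normVol n L) = ∫ x, f x ∂(normVol n L) := by
  simp only [normVol, integral_smul_measure]
  congr 1
  -- The property quantifies over all periodic functions, because the additive step uses it for a
  -- translate of `f`.
  refine transverse_induction (p := fun v => ∀ f : Space n → ℝ, TransversePeriodic L f →
    ∫ x in strip n L, f (x + v) = ∫ x in strip n L, f x) (by simp) ?_ ?_ hv f hf
  · intro v w h1 h2 f hf
    rw [← h1 f hf, ← h2 _ (hf.comp_add v)]
    simp only [add_right_comm _ w v, add_assoc]
  · exact fun i s f hf => setIntegral_strip_add_single hL hf i s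

theorem lintegral_add_transverse (hL : 0 < L) {f : Space n → ℝ≥0∞} (hf : TransversePeriodic L f)
    {v : Space n} (hv : vert v = 0) :
    ∫⁻ x, f (x + v) ∂(normVol n L) = ∫⁻ x, f x ∂(normVol n L) := by
  simp only [normVol, lintegral_smul_measure]
  congr 1
  refine transverse_induction (p := fun v => ∀ f : Space n → ℝ≥0∞, TransversePeriodic L f →
    ∫⁻ x in strip n L, f (x + v) = ∫⁻ x in strip n L, f x) (by simp) ?_ ?_ hv f hf
  · intro v w h1 h2 f hf
    rw [← h1 f hf, ← h2 _ (hf.comp_add v)]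
    simp only [add_right_comm _ w v, add_assoc]
  · exact fun i s f hf => setLIntegral_strip_add_single hL hf i s

/-! ### Slice averages and Poincaré's inequality -/

instance : SFinite (normVol n L) := by unfold normVol; infer_instance

instance : IsFiniteMeasureOnCompacts (normVol n L) := by
  refine ⟨fun K hK => ?_⟩
  rw [normVol, Measure.smul_apply, smul_eq_mul]
  exact ENNReal.mul_lt_top ENNReal.ofReal_lt_top hK.measure_lt_top

/-- The transverse part of a point. -/
def transverse (x : Space n) : Space n := x - vert x • ez n

@[simp] lemma vert_add (x y : Space n) : vert (x + y) = vert x + vert y := rfl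
@[simp] lemma vert_sub (x y : Space n) : vert (x - y) = vert x - vert y := rfl
@[simp] lemma vert_smul (c : ℝ) (x : Space n) : vert (c • x) = c * vert x := rfl
@[simp] lemma vert_ez : vert (ez n) = 1 := by simp [vert, ez]
@[simp] lemma vert_transverse (x : Space n) : vert (transverse x) = 0 := by simp [transverse]
@[simp] lemma vert_single_castSucc (i : Fin n) (s : ℝ) :
    vert (EuclideanSpace.single i.castSucc s : Space n) = 0 := by
  simp [vert, Fin.castSucc_ne_last, eq_comm]

@[fun_prop]
lemma continuous_transverse : Continuous (transverse : Space n → Space n) := by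
  unfold transverse; fun_prop

lemma transverse_add (x y : Space n) : transverse (x + y) = transverse x + transverse y := by
  simp only [transverse, vert_add, add_smul]; abel

lemma transverse_of_vert_eq_zero {x : Space n} (hx : vert x = 0) : transverse x = x := by
  simp [transverse, hx]

lemma transverse_add_vert (x : Space n) : transverse x + vert x • ez n = x := by
  simp [transverse]

lemma transverse_last (x : Space n) : transverse x (Fin.last n) = 0 := vert_transverse x

lemma transverse_castSucc (x : Space n) (i : Fin n) :
    transverse x i.castSucc = x i.castSucc := by
  simp [transverse, ez, Fin.castSucc_ne_last]

/-- This is the origin of the Poincaré constant `n L²`. -/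
lemma norm_sq_transverse_le {x : Space n} (hx : x ∈ strip n L) :
    ‖transverse x‖ ^ 2 ≤ n * L ^ 2 := by
  rw [EuclideanSpace.norm_sq_eq, Fin.sum_univ_castSucc, transverse_last]
  simp only [transverse_castSucc, norm_zero, Real.norm_eq_abs, sq_abs]
  calc ∑ i : Fin n, x i.castSucc ^ 2 + 0 ^ 2 ≤ ∑ _i : Fin n, L ^ 2 + 0 := by
        refine add_le_add (Finset.sum_le_sum fun i _ => ?_) (by simp)
        exact pow_le_pow_left₀ (hx i).1 (hx i).2 2
    _ = n * L ^ 2 := by simp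

/-- The variance is nonnegative. -/
lemma sq_integral_le_integral_sq {α : Type*} [MeasurableSpace α] {P : Measure α}
    [IsProbabilityMeasure P] {h : α → ℝ} (h1 : Integrable h P)
    (h2 : Integrable (fun x => h x ^ 2) P) : (∫ x, h x ∂P) ^ 2 ≤ ∫ x, h x ^ 2 ∂P := by
  set c := ∫ x, h x ∂P with hc
  have h3 : 0 ≤ ∫ x, (h x - c) ^ 2 ∂P := integral_nonneg fun x => sq_nonneg _
  have h4 : ∫ x, (h x - c) ^ 2 ∂P = ∫ x, h x ^ 2 ∂P - 2 * c * c + c ^ 2 := by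
    have : ∀ x, (h x - c) ^ 2 = h x ^ 2 - 2 * c * h x + c ^ 2 := fun x => by ring
    simp_rw [this]
    have i1 : Integrable (fun x => 2 * c * h x) P := h1.const_mul _
    have i2 : Integrable (fun x => h x ^ 2 - 2 * c * h x) P := h2.sub i1
    rw [integral_add i2 (integrable_const _), integral_sub h2 i1, integral_const_mul, ← hc]
    simp
  nlinarith

lemma inner_gradient (f : Space n → ℝ) (x v : Space n) :
    inner ℝ (gradient f x) v = fderiv ℝ f x v := by
  simp [gradient, InnerProductSpace.toDual_symm_apply]

lemma inner_gradient' (f : Space n → ℝ) (x v : Space n) :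
    inner ℝ v (gradient f x) = fderiv ℝ f x v := by
  rw [real_inner_comm, inner_gradient]

lemma continuous_gradient {f : Space n → ℝ} (hf : ContDiff ℝ 1 f) : Continuous (gradient f) := by
  unfold gradient
  exact (InnerProductSpace.toDual ℝ (Space n)).symm.continuous.comp
    (hf.continuous_fderiv one_ne_zero)

lemma TransversePeriodic.gradient {f : Space n → ℝ} (hf : TransversePeriodic L f) :
    TransversePeriodic L (gradient f) := by
  intro i x
  have : fderiv ℝ f (x + EuclideanSpace.single i.castSucc L) = fderiv ℝ f x := by
    rw [← fderiv_comp_add_right]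
    congr 1
    exact funext (hf i)
  simp [_root_.gradient, this]

/-- The increment of a function is controlled by its gradient along the segment. -/
lemma sq_sub_le_integral_sq_gradient {f : Space n → ℝ} (hf : ContDiff ℝ 1 f) (x v : Space n) :
    (f x - f (x + v)) ^ 2 ≤
      ‖v‖ ^ 2 * ∫ s in Set.Icc (0 : ℝ) 1, ‖gradient f (x + s • v)‖ ^ 2 := by
  have hg := continuous_gradient hf
  have hc : Continuous fun s : ℝ => inner ℝ v (gradient f (x + s • v)) := by fun_prop
  have hd : ∀ s : ℝ, HasDerivAt (fun s : ℝ => f (x + s • v))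
      (inner ℝ v (gradient f (x + s • v))) s := by
    intro s
    rw [inner_gradient']
    have h1 : HasDerivAt (fun s : ℝ => x + s • v) v s := by
      simpa using ((hasDerivAt_id s).smul_const v).const_add x
    exact ((hf.differentiable one_ne_zero _).hasFDerivAt).comp_hasDerivAt s h1
  have h1 : f (x + v) - f x = ∫ s in Set.Icc (0 : ℝ) 1, inner ℝ v (gradient f (x + s • v)) := by
    rw [integral_Icc_eq_integral_Ioc, ← intervalIntegral.integral_of_le zero_le_one,
      intervalIntegral.integral_eq_sub_of_hasDerivAt (fun s _ => hd s)
        (hc.intervalIntegrable _ _)]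
    simp
  have hP : IsProbabilityMeasure (volume.restrict (Set.Icc (0 : ℝ) 1)) := ⟨by simp⟩
  rw [← neg_sub, neg_sq, h1]
  -- Jensen on the unit interval, followed by Cauchy–Schwarz for the inner product under the
  -- integral.
  refine (sq_integral_le_integral_sq (hc.integrableOn_Icc) ((hc.pow 2).integrableOn_Icc)).trans ?_
  rw [← integral_const_mul]
  refine integral_mono ((hc.pow 2).integrableOn_Icc)
    (Continuous.integrableOn_Icc (by fun_prop)) fun s => ?_
  rw [← mul_pow]
  exact sq_le_sq.2 (by
    simpa [abs_mul, abs_of_nonneg] using abs_real_inner_le_norm v (gradient f (x + s • v)))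

/-- After the segment estimate and Tonelli, each translation by `s • v` is transverse: it preserves
both the integral and the weight, which depends on `z` alone. -/
lemma lintegral_sq_increment_le (hL : 0 < L) {f : Space n → ℝ} (hf : ContDiff ℝ 1 f)
    (hper : TransversePeriodic L f) {w : ℝ → ℝ≥0∞} (hw : Measurable w) {v : Space n}
    (hv : vert v = 0) :
    ∫⁻ x, ENNReal.ofReal ((f x - f (x + v)) ^ 2) * w (vert x) ∂(normVol n L) ≤
      ENNReal.ofReal (‖v‖ ^ 2) *
        ∫⁻ x, ENNReal.ofReal (‖gradient f x‖ ^ 2) * w (vert x) ∂(normVol n L) := by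
  have hg := continuous_gradient hf
  have hgp : TransversePeriodic L (gradient f) := hper.gradient
  have hwm : Measurable fun x : Space n => w (vert x) := hw.comp continuous_vert.measurable
  calc ∫⁻ x, ENNReal.ofReal ((f x - f (x + v)) ^ 2) * w (vert x) ∂(normVol n L)
      ≤ ∫⁻ x, ENNReal.ofReal (‖v‖ ^ 2) * (∫⁻ s in Set.Icc (0 : ℝ) 1,
          ENNReal.ofReal (‖gradient f (x + s • v)‖ ^ 2) * w (vert x)) ∂(normVol n L) := by
        refine lintegral_mono fun x => ?_
        rw [lintegral_mul_const _ (by fun_prop), ← mul_assoc]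
        refine mul_le_mul_left ?_ _
        rw [← ofReal_integral_eq_lintegral_ofReal
          (Continuous.integrableOn_Icc (by fun_prop))
          (Eventually.of_forall fun s => sq_nonneg _), ← ENNReal.ofReal_mul (sq_nonneg _)]
        exact ENNReal.ofReal_le_ofReal (sq_sub_le_integral_sq_gradient hf x v)
    _ = ENNReal.ofReal (‖v‖ ^ 2) * ∫⁻ s in Set.Icc (0 : ℝ) 1, ∫⁻ x,
          ENNReal.ofReal (‖gradient f (x + s • v)‖ ^ 2) * w (vert x) ∂(normVol n L) := by
        have hm : Measurable (fun q : Space n × ℝ =>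
            ENNReal.ofReal (‖gradient f (q.1 + q.2 • v)‖ ^ 2) * w (vert q.1)) := by
          refine Measurable.mul ?_ (hwm.comp measurable_fst)
          have : Continuous fun q : Space n × ℝ => ‖gradient f (q.1 + q.2 • v)‖ ^ 2 := by fun_prop
          exact this.measurable.ennreal_ofReal
        rw [lintegral_const_mul _ (Measurable.lintegral_prod_right' hm),
          lintegral_lintegral_swap hm.aemeasurable]
    _ = ENNReal.ofReal (‖v‖ ^ 2) * ∫⁻ s in Set.Icc (0 : ℝ) 1, ∫⁻ x,
          ENNReal.ofReal (‖gradient f x‖ ^ 2) * w (vert x) ∂(normVol n L) := by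
        congr 1
        refine lintegral_congr fun s => ?_
        have hsv : vert (s • v) = 0 := by simp [hv]
        rw [← lintegral_add_transverse hL (v := s • v) (f := fun x =>
          ENNReal.ofReal (‖gradient f x‖ ^ 2) * w (vert x)) _ hsv]
        · simp [hv]
        · intro i x
          simp [hgp i x]
    _ = _ := by simp

/-- The unit cell, on which slice averages are computed. -/
def unitCell (n : ℕ) (L : ℝ) : Measure (Space n) := (normVol n L).restrict (slab n L 2⁻¹)

lemma slab_ae_eq (n : ℕ) (L R : ℝ) :
    slab n L R =ᵐ[normVol n L] ({x | |vert x| ≤ R} : Set (Space n)) := by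
  filter_upwards [ae_mem_strip n L] with x hx
  refine propext ?_
  change x ∈ strip n L ∧ |vert x| ≤ R ↔ |vert x| ≤ R
  exact ⟨fun h => h.2, fun h => ⟨hx, h⟩⟩

/-- The half-height `1/2` was chosen to make the normalized volume `2 · (1/2) = 1`. -/
lemma isProbabilityMeasure_unitCell (hL : 0 < L) : IsProbabilityMeasure (unitCell n L) := by
  refine ⟨?_⟩
  rw [unitCell, Measure.restrict_apply_univ, measure_congr (slab_ae_eq n L _), normVol_slab hL]
  norm_num

/-- The average of `f` over a horizontal slice. -/
def sliceAverage (L : ℝ) (f : Space n → ℝ) (z : ℝ) : ℝ :=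
  ∫ y, f (transverse y + z • ez n) ∂(unitCell n L)

lemma continuous_sliceAverage {f : Space n → ℝ} (hf : Continuous f) :
    Continuous (sliceAverage L f) := by
  have h : Continuous (Function.uncurry fun (z : ℝ) (y : Space n) =>
      f (transverse y + z • ez n)) := by
    unfold Function.uncurry; fun_prop
  exact continuous_parametric_integral_of_continuous (μ := normVol n L) h (isCompact_slab n L _)

/-- Based at `x` itself, the average exhibits `f x - sliceAverage L f (vert x)` as a mean of
transverse increments of `f`. The change of base point is a transverse translation. -/
lemma sliceAverage_vert (hL : 0 < L) {f : Space n → ℝ} (hper : TransversePeriodic L f)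
    (x : Space n) : sliceAverage L f (vert x) = ∫ y, f (x + transverse y) ∂(unitCell n L) := by
  have hm : MeasurableSet {x : Space n | |vert x| ≤ 2⁻¹} :=
    measurableSet_le (by fun_prop) (by fun_prop)
  simp only [sliceAverage, unitCell]
  rw [setIntegral_congr_set (slab_ae_eq n L _), setIntegral_congr_set (slab_ae_eq n L _),
    ← integral_indicator hm, ← integral_indicator hm,
    ← integral_add_transverse hL (v := transverse x) _ (vert_transverse x)]
  · refine integral_congr_ae (Eventually.of_forall fun y => ?_)
    have : transverse (y + transverse x) + vert x • ez n = x + transverse y := by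
      rw [transverse_add, transverse_of_vert_eq_zero (vert_transverse x)]
      nth_rewrite 3 [← transverse_add_vert x]
      abel
    simp [Set.indicator, this]
  · intro i y
    have h1 : transverse (y + EuclideanSpace.single i.castSucc L) =
        transverse y + EuclideanSpace.single i.castSucc L := by
      rw [transverse_add, transverse_of_vert_eq_zero (vert_single_castSucc i L)]
    simp [Set.indicator, h1, add_right_comm _ (EuclideanSpace.single i.castSucc L),
      hper i (transverse y + _)]

lemma integrable_unitCell {f : Space n → ℝ} (hf : Continuous f) : Integrable f (unitCell n L) :=
  hf.continuousOn.integrableOn_compact (isCompact_slab n L _)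

/-- Poincaré's inequality on horizontal slices. -/
theorem integral_sq_sub_sliceAverage_le (hL : 0 < L) {f : Space n → ℝ} (hf : ContDiff ℝ 1 f)
    (hper : TransversePeriodic L f) {w : ℝ → ℝ} (hw : Continuous w) (hw0 : ∀ z, 0 ≤ w z) {R : ℝ}
    (hR : ∀ z, R < |z| → w z = 0) :
    ∫ x, (f x - sliceAverage L f (vert x)) ^ 2 * w (vert x) ∂(normVol n L) ≤
      n * L ^ 2 * ∫ x, ‖gradient f x‖ ^ 2 * w (vert x) ∂(normVol n L) := by
  have hP := isProbabilityMeasure_unitCell (n := n) hL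
  have : SFinite (unitCell n L) := by unfold unitCell; infer_instance
  have hg := continuous_gradient hf
  have hfc := hf.continuous
  have hA := continuous_sliceAverage (L := L) hfc
  have i1 : Integrable (fun x => (f x - sliceAverage L f (vert x)) ^ 2 * w (vert x))
      (normVol n L) := integrable_of_continuous hL (R := R) (by fun_prop)
        fun x hx => by simp [hR _ hx]
  have i2 : Integrable (fun x => ‖gradient f x‖ ^ 2 * w (vert x)) (normVol n L) :=
    integrable_of_continuous hL (R := R) (by fun_prop) fun x hx => by simp [hR _ hx]
  have hpos : 0 ≤ ∫ x, ‖gradient f x‖ ^ 2 * w (vert x) ∂(normVol n L) :=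
    integral_nonneg fun x => mul_nonneg (sq_nonneg _) (hw0 _)
  rw [← ENNReal.ofReal_le_ofReal_iff (by positivity), ENNReal.ofReal_mul (by positivity),
    ofReal_integral_eq_lintegral_ofReal i1
      (Eventually.of_forall fun x => mul_nonneg (sq_nonneg _) (hw0 _)),
    ofReal_integral_eq_lintegral_ofReal i2
      (Eventually.of_forall fun x => mul_nonneg (sq_nonneg _) (hw0 _))]
  simp_rw [ENNReal.ofReal_mul (sq_nonneg _)]
  have hwm : Measurable fun z => ENNReal.ofReal (w z) := hw.measurable.ennreal_ofReal
  have hm : Measurable (fun q : Space n × Space n =>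
      ENNReal.ofReal ((f q.1 - f (q.1 + transverse q.2)) ^ 2) * ENNReal.ofReal (w (vert q.1))) := by
    refine Measurable.mul (M := ℝ≥0∞) ?_ ?_
    · have : Continuous fun q : Space n × Space n => (f q.1 - f (q.1 + transverse q.2)) ^ 2 := by
        fun_prop
      exact this.measurable.ennreal_ofReal
    · have : Continuous fun q : Space n × Space n => w (vert q.1) := by fun_prop
      exact this.measurable.ennreal_ofReal
  -- The deviation from the slice average is a mean of increments, so Jensen applies; after
  -- exchanging the integrals, every fixed transverse increment is estimated by the gradient.
  calc _ ≤ ∫⁻ x, ∫⁻ y, ENNReal.ofReal ((f x - f (x + transverse y)) ^ 2) *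
          ENNReal.ofReal (w (vert x)) ∂(unitCell n L) ∂(normVol n L) := by
        refine lintegral_mono fun x => ?_
        have c1 : Continuous fun y => f x - f (x + transverse y) := by fun_prop
        have c2 : Continuous fun y => (f x - f (x + transverse y)) ^ 2 := c1.pow 2
        rw [lintegral_mul_const _ c2.measurable.ennreal_ofReal]
        refine mul_le_mul_left ?_ _
        rw [← ofReal_integral_eq_lintegral_ofReal (integrable_unitCell c2)
          (Eventually.of_forall fun s => sq_nonneg _)]
        refine ENNReal.ofReal_le_ofReal ?_
        have h1 : f x - sliceAverage L f (vert x) =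
            ∫ y, (f x - f (x + transverse y)) ∂(unitCell n L) := by
          rw [sliceAverage_vert hL hper, integral_sub (integrable_const _)
            (integrable_unitCell (by fun_prop))]
          simp
        rw [h1]
        exact sq_integral_le_integral_sq (integrable_unitCell c1) (integrable_unitCell c2)
    _ = ∫⁻ y, ∫⁻ x, ENNReal.ofReal ((f x - f (x + transverse y)) ^ 2) *
          ENNReal.ofReal (w (vert x)) ∂(normVol n L) ∂(unitCell n L) :=
        lintegral_lintegral_swap hm.aemeasurable
    _ ≤ ∫⁻ _y, ENNReal.ofReal (n * L ^ 2) * ∫⁻ x, ENNReal.ofReal (‖gradient f x‖ ^ 2) *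
          ENNReal.ofReal (w (vert x)) ∂(normVol n L) ∂(unitCell n L) := by
        refine lintegral_mono_ae ?_
        have hmem : ∀ᵐ y ∂(unitCell n L), y ∈ slab n L 2⁻¹ :=
          ae_restrict_mem (isCompact_slab n L _).measurableSet
        refine hmem.mono fun y hy => ?_
        refine (lintegral_sq_increment_le hL hf hper hwm (vert_transverse y)).trans ?_
        exact mul_le_mul_left (ENNReal.ofReal_le_ofReal (norm_sq_transverse_le hy.1)) _
    _ = _ := by simp

/-! ### Vector calculus and spatial identities against a vertical weight -/

lemma contDiff_deriv {f : ℝ → ℝ} (hf : ContDiff ℝ 2 f) : ContDiff ℝ 1 (deriv f) :=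
  ContDiff.deriv' (by rwa [one_add_one_eq_two])

lemma fderiv_apply_eq_sum {F : Type*} [NormedAddCommGroup F] [NormedSpace ℝ F]
    (l : Space n →L[ℝ] F) (v : Space n) : l v = ∑ i, v i • l (EuclideanSpace.single i 1) := by
  conv_lhs => rw [show v = ∑ i, v i • (EuclideanSpace.single i 1 : Space n) from by
    ext j; simp [Pi.single_apply]]
  simp

lemma divergence_smul {a : Space n → ℝ} {V : Space n → Space n} {x : Space n}
    (ha : DifferentiableAt ℝ a x) (hV : DifferentiableAt ℝ V x) :
    divergence (fun y => a y • V y) x = a x * divergence V x + fderiv ℝ a x (V x) := by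
  rw [fderiv_apply_eq_sum (fderiv ℝ a x) (V x)]
  simp only [divergence]
  rw [Finset.mul_sum, ← Finset.sum_add_distrib]
  refine Finset.sum_congr rfl fun i _ => ?_
  rw [fderiv_fun_smul ha hV]
  simp [mul_comm]

lemma divergence_const (c x : Space n) : divergence (fun _ => c) x = 0 := by
  simp [divergence]

lemma gradient_apply (f : Space n → ℝ) (x : Space n) (i : Fin (n + 1)) :
    gradient f x i = fderiv ℝ f x (EuclideanSpace.single i 1) := by
  rw [← inner_gradient, EuclideanSpace.inner_single_right]
  simp

lemma contDiff_gradient {f : Space n → ℝ} (hf : ContDiff ℝ 2 f) : ContDiff ℝ 1 (gradient f) := by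
  unfold gradient
  exact (InnerProductSpace.toDual ℝ (Space n)).symm.contDiff.comp
    (hf.fderiv_right (m := 1) (by norm_num))

lemma divergence_gradient {f : Space n → ℝ} (hf : ContDiff ℝ 2 f) (x : Space n) :
    divergence (gradient f) x = (Δ f) x := by
  rw [InnerProductSpace.laplacian_eq_iteratedFDeriv_orthonormalBasis f
    (EuclideanSpace.basisFun (Fin (n + 1)) ℝ)]
  refine Finset.sum_congr rfl fun i _ => ?_
  rw [iteratedFDeriv_two_apply]
  have h1 : DifferentiableAt ℝ (gradient f) x :=
    (contDiff_gradient hf).differentiable one_ne_zero x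
  have h2 : DifferentiableAt ℝ (fderiv ℝ f) x :=
    (hf.fderiv_right (m := 1) (by norm_num)).differentiable one_ne_zero x
  have h3 : (fun y => gradient f y i) = fun y => fderiv ℝ f y (EuclideanSpace.single i 1) :=
    funext fun y => gradient_apply f y i
  have h4 : fderiv ℝ (fun y => gradient f y i) x = fderiv ℝ
    (fun y => fderiv ℝ f y (EuclideanSpace.single i 1)) x := by rw [h3]
  have h5 : HasFDerivAt (fun y => gradient f y i)
      ((EuclideanSpace.proj (𝕜 := ℝ) i).comp (fderiv ℝ (gradient f) x)) x :=
    (EuclideanSpace.proj (𝕜 := ℝ) i).hasFDerivAt.comp x h1.hasFDerivAt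
  have h6 := h2.hasFDerivAt.clm_apply
    (hasFDerivAt_const (EuclideanSpace.single i (1 : ℝ) : Space n) x)
  rw [h5.fderiv, h6.fderiv] at h4
  have := congrArg (fun l : Space n →L[ℝ] ℝ => l (EuclideanSpace.single i 1)) h4
  simpa using this

lemma continuous_laplacian {f : Space n → ℝ} (hf : ContDiff ℝ 2 f) : Continuous (Δ f) := by
  rw [← funext (divergence_gradient hf)]
  exact continuous_divergence (contDiff_gradient hf)

/-- The vertical coordinate as a linear form. -/
def vertL (n : ℕ) : Space n →L[ℝ] ℝ := EuclideanSpace.proj (Fin.last n)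

lemma hasFDerivAt_vert (x : Space n) : HasFDerivAt (vert : Space n → ℝ) (vertL n) x :=
  (vertL n).hasFDerivAt

lemma fderiv_comp_vert {w : ℝ → ℝ} {x : Space n} (hw : DifferentiableAt ℝ w (vert x))
    (v : Space n) : fderiv ℝ (fun y => w (vert y)) x v = deriv w (vert x) * vert v := by
  have := hw.hasDerivAt.comp_hasFDerivAt x (hasFDerivAt_vert x)
  rw [HasFDerivAt.fderiv (f := fun y => w (vert y)) this]
  simp [vertL, vert]

/-- Weak form of the divergence against a vertical weight. -/
theorem integral_divergence_mul_weight (hL : 0 < L) {a : Space n → ℝ} (ha : ContDiff ℝ 1 a)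
    (hap : TransversePeriodic L a) {V : Space n → Space n} (hV : ContDiff ℝ 1 V)
    (hVp : TransversePeriodic L V) {w : ℝ → ℝ} (hw : ContDiff ℝ 1 w) {R : ℝ}
    (hR : ∀ z, R ≤ |z| → w z = 0) :
    ∫ x, (a x * divergence V x + fderiv ℝ a x (V x)) * w (vert x) ∂(normVol n L) =
      -∫ x, a x * vert (V x) * deriv w (vert x) ∂(normVol n L) := by
  have hwd : ∀ z, |R| + 1 ≤ |z| → deriv w z = 0 := by
    intro z hz
    have h1 : w =ᶠ[𝓝 z] fun _ => 0 := by
      have : ∀ᶠ y in 𝓝 z, R < |y| :=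
        continuous_abs.continuousAt.eventually (lt_mem_nhds (by linarith [le_abs_self R]))
      exact this.mono fun y hy => hR y hy.le
    simp [h1.deriv_eq]
  -- The divergence theorem is applied to `w(z) a V`.
  have hF : ContDiff ℝ 1 fun x => (w (vert x) * a x) • V x := by fun_prop
  have h0 := integral_divergence_eq_zero hL hF (R := |R|)
    (fun i x => by simp [hap i x, hVp i x]) (abs_nonneg _)
    (fun x hx => by simp [hR _ ((le_abs_self R).trans hx)])
  have hd : ∀ x, divergence (fun x => (w (vert x) * a x) • V x) x =
      (a x * divergence V x + fderiv ℝ a x (V x)) * w (vert x) +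
        a x * vert (V x) * deriv w (vert x) := by
    intro x
    have d1 : DifferentiableAt ℝ a x := ha.differentiable one_ne_zero x
    have d2 : DifferentiableAt ℝ (fun x => w (vert x)) x :=
      (hw.comp contDiff_vert).differentiable one_ne_zero x
    rw [divergence_smul (a := fun x => w (vert x) * a x) (d2.mul d1)
      (hV.differentiable one_ne_zero x), fderiv_fun_mul d2 d1]
    simp only [add_apply, smul_apply, smul_eq_mul,
      fderiv_comp_vert (hw.differentiable one_ne_zero _)]
    ring
  simp_rw [hd] at h0
  have hc1 := continuous_divergence hV
  have hc2 := ha.continuous_fderiv one_ne_zero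
  have hc3 := hV.continuous
  have hc4 := ha.continuous
  have hc5 := hw.continuous
  have hc6 := hw.continuous_deriv_one
  rw [integral_add] at h0
  · linarith
  · exact integrable_of_continuous hL (R := R) (by fun_prop) fun x hx => by simp [hR _ hx.le]
  · exact integrable_of_continuous hL (R := |R| + 1) (by fun_prop)
      fun x hx => by simp [hwd _ hx.le]

lemma deriv_eq_zero_of_support {w : ℝ → ℝ} {R : ℝ} (hR : ∀ z, R ≤ |z| → w z = 0) (z : ℝ)
    (hz : R + 1 ≤ |z|) : deriv w z = 0 := by
  have h1 : w =ᶠ[𝓝 z] fun _ => 0 := by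
    have : ∀ᶠ y in 𝓝 z, R < |y| :=
      continuous_abs.continuousAt.eventually (lt_mem_nhds (by linarith))
    exact this.mono fun y hy => hR y hy.le
  simp [h1.deriv_eq]

/-- The spatial identity behind the balance of `∫ φ(ρ) w`. -/
theorem integral_density_balance (hL : 0 < L) {r : Space n → ℝ} (hr : ContDiff ℝ 2 r)
    (hrp : TransversePeriodic L r) {U : Space n → Space n} (hU : ContDiff ℝ 1 U)
    (hUp : TransversePeriodic L U) (hdiv : ∀ x, divergence U x = 0) {φ w : ℝ → ℝ}
    (hφ : ContDiff ℝ 2 φ) (hw : ContDiff ℝ 2 w) {R : ℝ} (hR : ∀ z, R ≤ |z| → w z = 0) :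
    ∫ x, deriv φ (r x) * ((Δ r) x - inner ℝ (U x) (gradient r x)) * w (vert x) ∂(normVol n L) =
      ∫ x, φ (r x) * (vert (U x) * deriv w (vert x) + deriv (deriv w) (vert x)) ∂(normVol n L)
      - ∫ x, deriv (deriv φ) (r x) * ‖gradient r x‖ ^ 2 * w (vert x) ∂(normVol n L) := by
  have hφ1 : ContDiff ℝ 1 (deriv φ) := contDiff_deriv hφ
  have hw1 : ContDiff ℝ 1 (deriv w) := contDiff_deriv hw
  have hφ' : ContDiff ℝ 1 φ := hφ.of_le (by norm_num)
  have hw' : ContDiff ℝ 1 w := hw.of_le (by norm_num)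
  have hr' : ContDiff ℝ 1 r := hr.of_le (by norm_num)
  have hg := contDiff_gradient hr
  have hgp : TransversePeriodic L (gradient r) := hrp.gradient
  have hlap := continuous_laplacian hr
  have c1 := hg.continuous
  have c2 := hU.continuous
  have c3 := hr.continuous
  have c4 := hφ.continuous
  have c5 := hφ1.continuous
  have c6 := hφ1.continuous_deriv_one
  have c7 := hw.continuous
  have c8 := hw1.continuous
  have c9 := hw1.continuous_deriv_one
  have hR1 := deriv_eq_zero_of_support hR
  have hR2 := deriv_eq_zero_of_support hR1
  -- Three fields are integrated: `φ'(r) ∇r` and `φ(r) U` against `w`, and `φ(r) e_z` against `w'`.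
  -- The last one turns the boundary term `φ'(r) ∂_z r · w'` of the first into `φ(r) w''`, so no
  -- gradient is left in the flux.
  have e1 := integral_divergence_mul_weight hL (hφ1.comp hr') (fun i x => by simp [hrp i x]) hg
    hgp hw' hR
  have e2 := integral_divergence_mul_weight hL (hφ'.comp hr') (fun i x => by simp [hrp i x]) hU
    hUp hw' hR
  have e3 := integral_divergence_mul_weight hL (hφ'.comp hr') (fun i x => by simp [hrp i x])
    (contDiff_const (c := ez n)) (fun i x => rfl) hw1 hR1
  have d1 : ∀ x v, fderiv ℝ (deriv φ ∘ r) x v = deriv (deriv φ) (r x) * fderiv ℝ r x v := by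
    intro x v
    rw [((hφ1.differentiable one_ne_zero (r x)).hasDerivAt.comp_hasFDerivAt x
      (hr'.differentiable one_ne_zero x).hasFDerivAt).fderiv]
    simp
  have d2 : ∀ x v, fderiv ℝ (φ ∘ r) x v = deriv φ (r x) * fderiv ℝ r x v := by
    intro x v
    rw [((hφ'.differentiable one_ne_zero (r x)).hasDerivAt.comp_hasFDerivAt x
      (hr'.differentiable one_ne_zero x).hasFDerivAt).fderiv]
    simp
  have d3 : ∀ x, fderiv ℝ r x (gradient r x) = ‖gradient r x‖ ^ 2 := by
    intro x; rw [← inner_gradient, real_inner_self_eq_norm_sq]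
  have d4 : ∀ x, fderiv ℝ r x (ez n) = vert (gradient r x) := by
    intro x; rw [vert, gradient_apply]; rfl
  simp only [Function.comp_apply, d1, d2, d3, d4, hdiv, divergence_gradient hr, divergence_const,
    mul_zero, zero_add, vert_ez, mul_one] at e1 e2 e3
  have i1 : Integrable (fun x => deriv φ (r x) * (Δ r) x * w (vert x)) (normVol n L) :=
    integrable_of_continuous hL (R := R) (by fun_prop) fun x hx => by simp [hR _ hx.le]
  have i2 : Integrable (fun x => deriv (deriv φ) (r x) * ‖gradient r x‖ ^ 2 * w (vert x))
      (normVol n L) :=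
    integrable_of_continuous hL (R := R) (by fun_prop) fun x hx => by simp [hR _ hx.le]
  have i3 : Integrable (fun x => deriv φ (r x) * inner ℝ (U x) (gradient r x) * w (vert x))
      (normVol n L) :=
    integrable_of_continuous hL (R := R) (by fun_prop) fun x hx => by simp [hR _ hx.le]
  have i4 : Integrable (fun x => φ (r x) * vert (U x) * deriv w (vert x)) (normVol n L) :=
    integrable_of_continuous hL (R := R + 1) (by fun_prop) fun x hx => by simp [hR1 _ hx.le]
  have i5 : Integrable (fun x => φ (r x) * deriv (deriv w) (vert x)) (normVol n L) :=
    integrable_of_continuous hL (R := R + 1 + 1) (by fun_prop) fun x hx => by simp [hR2 _ hx.le]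
  have s1 : ∫ x, deriv φ (r x) * ((Δ r) x - inner ℝ (U x) (gradient r x)) * w (vert x)
      ∂(normVol n L) = ∫ x, deriv φ (r x) * (Δ r) x * w (vert x) ∂(normVol n L) -
        ∫ x, deriv φ (r x) * inner ℝ (U x) (gradient r x) * w (vert x) ∂(normVol n L) := by
    rw [← integral_sub i1 i3]; congr 1; ext x; ring
  have s2 : ∫ x, φ (r x) * (vert (U x) * deriv w (vert x) + deriv (deriv w) (vert x))
      ∂(normVol n L) = ∫ x, φ (r x) * vert (U x) * deriv w (vert x) ∂(normVol n L) +
        ∫ x, φ (r x) * deriv (deriv w) (vert x) ∂(normVol n L) := by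
    rw [← integral_add i4 i5]; congr 1; ext x; ring
  have s3 : ∫ x, (deriv φ (r x) * (Δ r) x + deriv (deriv φ) (r x) * ‖gradient r x‖ ^ 2) *
      w (vert x) ∂(normVol n L) = ∫ x, deriv φ (r x) * (Δ r) x * w (vert x) ∂(normVol n L) +
        ∫ x, deriv (deriv φ) (r x) * ‖gradient r x‖ ^ 2 * w (vert x) ∂(normVol n L) := by
    rw [← integral_add i1 i2]; congr 1; ext x; ring
  simp only [← inner_gradient'] at e2
  rw [s3] at e1
  linarith

/-- The spatial identity behind the balance of kinetic energy: `b` stands for `|U|² / 2` and `q`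
for the pressure. -/
theorem integral_kinetic_balance (hL : 0 < L) {r : Space n → ℝ} (hr : ContDiff ℝ 2 r)
    (hrp : TransversePeriodic L r) {U : Space n → Space n} (hU : ContDiff ℝ 1 U)
    (hUp : TransversePeriodic L U) (hdiv : ∀ x, divergence U x = 0) {b q : Space n → ℝ}
    (hb : ContDiff ℝ 1 b) (hbp : TransversePeriodic L b) (hq : ContDiff ℝ 1 q)
    (hqp : TransversePeriodic L q) {w : ℝ → ℝ} (hw : ContDiff ℝ 1 w) {R : ℝ}
    (hR : ∀ z, R ≤ |z| → w z = 0) :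
    ∫ x, (fderiv ℝ b x (gradient r x) + b x * ((Δ r) x - inner ℝ (U x) (gradient r x))
        - r x * fderiv ℝ b x (U x) - fderiv ℝ q x (U x)) * w (vert x) ∂(normVol n L) =
      -∫ x, b x * vert (gradient r x) * deriv w (vert x) ∂(normVol n L)
      + ∫ x, r x * b x * vert (U x) * deriv w (vert x) ∂(normVol n L)
      + ∫ x, q x * vert (U x) * deriv w (vert x) ∂(normVol n L) := by
  have hr' : ContDiff ℝ 1 r := hr.of_le (by norm_num)
  have hg := contDiff_gradient hr
  have hgp : TransversePeriodic L (gradient r) := hrp.gradient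
  have hlap := continuous_laplacian hr
  have c1 := hg.continuous
  have c2 := hU.continuous
  have c3 := hr.continuous
  have c4 := hb.continuous
  have c5 := hb.continuous_fderiv one_ne_zero
  have c6 := hq.continuous
  have c6' := hq.continuous_fderiv one_ne_zero
  have c7 := hw.continuous
  have c8 := hw.continuous_deriv_one
  -- The integrand is the divergence of `b ∇r - r b U - q U`, because `U` is divergence free; each
  -- piece is integrated separately.
  have e1 := integral_divergence_mul_weight hL hb hbp hg hgp hw hR
  have e2 := integral_divergence_mul_weight hL (hr'.mul hb) (fun i x => by simp [hrp i x, hbp i x])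
    hU hUp hw hR
  have e3 := integral_divergence_mul_weight hL hq hqp hU hUp hw hR
  have d1 : ∀ x, fderiv ℝ (fun x => r x * b x) x (U x) =
      r x * fderiv ℝ b x (U x) + b x * inner ℝ (U x) (gradient r x) := by
    intro x
    rw [fderiv_fun_mul (hr'.differentiable one_ne_zero x) (hb.differentiable one_ne_zero x),
      inner_gradient']
    simp
  simp only [d1, hdiv, divergence_gradient hr, mul_zero, zero_add] at e1 e2 e3
  have i1 : Integrable (fun x => (b x * (Δ r) x + fderiv ℝ b x (gradient r x)) * w (vert x))
      (normVol n L) :=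
    integrable_of_continuous hL (R := R) (by fun_prop) fun x hx => by simp [hR _ hx.le]
  have i2 : Integrable (fun x => (r x * fderiv ℝ b x (U x) + b x * inner ℝ (U x) (gradient r x)) *
      w (vert x)) (normVol n L) :=
    integrable_of_continuous hL (R := R) (by fun_prop) fun x hx => by simp [hR _ hx.le]
  have i3 : Integrable (fun x => fderiv ℝ q x (U x) * w (vert x)) (normVol n L) :=
    integrable_of_continuous hL (R := R) (by fun_prop) fun x hx => by simp [hR _ hx.le]
  have s1 : ∫ x, (fderiv ℝ b x (gradient r x) + b x * ((Δ r) x - inner ℝ (U x) (gradient r x))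
        - r x * fderiv ℝ b x (U x) - fderiv ℝ q x (U x)) * w (vert x) ∂(normVol n L) =
      ∫ x, (b x * (Δ r) x + fderiv ℝ b x (gradient r x)) * w (vert x) ∂(normVol n L) -
      ∫ x, (r x * fderiv ℝ b x (U x) + b x * inner ℝ (U x) (gradient r x)) *
        w (vert x) ∂(normVol n L) - ∫ x, fderiv ℝ q x (U x) * w (vert x) ∂(normVol n L) := by
    rw [← integral_sub i1 i2, ← integral_sub ?_ i3]
    · congr 1; ext x; ring
    · exact i1.sub i2
  rw [s1]
  linarith

/-! ### Vertical cutoffs -/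

/-- A fixed even profile, equal to `1` on `[-1, 1]` and supported in `[-2, 2]`. -/
def bumpProfile (z : ℝ) : ℝ := Real.smoothTransition (2 - z ^ 2)

/-- A cutoff, equal to `1` for `|z| ≤ N` and to `0` for `|z| ≥ 2N`. -/
def cutoff (N z : ℝ) : ℝ := bumpProfile (N⁻¹ * z)

lemma contDiff_bumpProfile {k : ℕ∞} : ContDiff ℝ k bumpProfile :=
  Real.smoothTransition.contDiff.comp (by fun_prop)

@[fun_prop]
lemma contDiff_cutoff {k : ℕ∞} (N : ℝ) : ContDiff ℝ k (cutoff N) :=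
  contDiff_bumpProfile.comp (by fun_prop)

@[fun_prop]
lemma continuous_cutoff (N : ℝ) : Continuous (cutoff N) := (contDiff_cutoff (k := 0) N).continuous

lemma cutoff_nonneg (N z : ℝ) : 0 ≤ cutoff N z := Real.smoothTransition.nonneg _
lemma cutoff_le_one (N z : ℝ) : cutoff N z ≤ 1 := Real.smoothTransition.le_one _

lemma cutoff_eq_one {N z : ℝ} (hN : 0 < N) (hz : |z| ≤ N) : cutoff N z = 1 := by
  refine Real.smoothTransition.one_of_one_le ?_
  have : (N⁻¹ * z) ^ 2 ≤ 1 := by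
    rw [sq_le_one_iff_abs_le_one, abs_mul, abs_of_pos (inv_pos.2 hN), inv_mul_le_one₀ hN]
    exact hz
  linarith

/-- The bound `3/2` lies above `√2` and below `2`. The margin makes all derivatives vanish on the
closed region `|z| ≥ 2`, endpoints included. -/
lemma bumpProfile_eq_zero {z : ℝ} (hz : 3 / 2 ≤ |z|) : bumpProfile z = 0 := by
  refine Real.smoothTransition.zero_of_nonpos ?_
  nlinarith [sq_abs z]

lemma bumpProfile_support {z : ℝ} (hz : 2 ≤ |z|) : bumpProfile z = 0 :=
  bumpProfile_eq_zero (by linarith)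

lemma le_abs_inv_mul {N z : ℝ} (hN : 0 < N) (hz : 2 * N ≤ |z|) : 2 ≤ |N⁻¹ * z| := by
  rw [abs_mul, abs_of_pos (inv_pos.2 hN), ← div_eq_inv_mul, le_div_iff₀ hN]
  exact hz

lemma cutoff_eq_zero {N z : ℝ} (hN : 0 < N) (hz : 2 * N ≤ |z|) : cutoff N z = 0 :=
  bumpProfile_support (le_abs_inv_mul hN hz)

lemma deriv_cutoff (N z : ℝ) : deriv (cutoff N) z = N⁻¹ * deriv bumpProfile (N⁻¹ * z) := by
  exact deriv_comp_mul_left N⁻¹ bumpProfile z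

lemma deriv_deriv_cutoff (N z : ℝ) :
    deriv (deriv (cutoff N)) z = N⁻¹ ^ 2 * deriv (deriv bumpProfile) (N⁻¹ * z) := by
  rw [funext (deriv_cutoff N), deriv_const_mul_field]
  have := deriv_comp_mul_left N⁻¹ (deriv bumpProfile) z
  rw [this]
  simp only [smul_eq_mul]; ring

lemma deriv_cutoff_of_lt {N z : ℝ} (hz : |z| < N) : deriv (cutoff N) z = 0 := by
  have hN : 0 < N := (abs_nonneg z).trans_lt hz
  have : cutoff N =ᶠ[𝓝 z] fun _ => 1 :=
    (continuous_abs.continuousAt.eventually (gt_mem_nhds hz)).mono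
      fun y hy => cutoff_eq_one hN (le_of_lt hy)
  simp [this.deriv_eq]

lemma deriv_bumpProfile_support {z : ℝ} (hz : 3 / 2 < |z|) : deriv bumpProfile z = 0 := by
  have : bumpProfile =ᶠ[𝓝 z] fun _ => 0 :=
    (continuous_abs.continuousAt.eventually (lt_mem_nhds hz)).mono
      fun y hy => bumpProfile_eq_zero (le_of_lt hy)
  simp [this.deriv_eq]

lemma deriv_deriv_bumpProfile_support {z : ℝ} (hz : 3 / 2 < |z|) :
    deriv (deriv bumpProfile) z = 0 := by
  have : deriv bumpProfile =ᶠ[𝓝 z] fun _ => 0 :=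
    (continuous_abs.continuousAt.eventually (lt_mem_nhds hz)).mono
      fun y hy => deriv_bumpProfile_support hy
  simp [this.deriv_eq]

lemma deriv_cutoff_eq_zero {N z : ℝ} (hN : 0 < N) (hz : 2 * N ≤ |z|) :
    deriv (cutoff N) z = 0 := by
  rw [deriv_cutoff, deriv_bumpProfile_support, mul_zero]
  linarith [le_abs_inv_mul hN hz]

lemma deriv_deriv_cutoff_eq_zero {N z : ℝ} (hN : 0 < N) (hz : 2 * N ≤ |z|) :
    deriv (deriv (cutoff N)) z = 0 := by
  rw [deriv_deriv_cutoff, deriv_deriv_bumpProfile_support, mul_zero]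
  linarith [le_abs_inv_mul hN hz]

/-- By scaling, each derivative of `cutoff N` costs a factor `1/N`, and the derivatives of the fixed
profile are bounded since they are compactly supported. -/
lemma exists_deriv_cutoff_bound : ∃ K : ℝ, 1 ≤ K ∧ ∀ N : ℝ, 0 < N → ∀ z,
    |deriv (cutoff N) z| ≤ K / N ∧ |deriv (deriv (cutoff N)) z| ≤ K / N ^ 2 := by
  have h2 : ContDiff ℝ 2 bumpProfile := contDiff_bumpProfile (k := 2)
  have h1 : ContDiff ℝ 1 (deriv bumpProfile) := contDiff_deriv h2
  obtain ⟨K1, hK1⟩ := isCompact_Icc (a := (-2 : ℝ)) (b := 2) |>.exists_bound_of_continuousOn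
    h1.continuous.continuousOn
  obtain ⟨K2, hK2⟩ := isCompact_Icc (a := (-2 : ℝ)) (b := 2) |>.exists_bound_of_continuousOn
    h1.continuous_deriv_one.continuousOn
  have b1 : ∀ z, |deriv bumpProfile z| ≤ max 1 (max K1 K2) := by
    intro z
    by_cases hz : |z| ≤ 2
    · exact (hK1 z (abs_le.1 hz)).trans ((le_max_left _ _).trans (le_max_right _ _))
    · rw [deriv_bumpProfile_support (by linarith), abs_zero]
      exact zero_le_one.trans (le_max_left _ _)
  have b2 : ∀ z, |deriv (deriv bumpProfile) z| ≤ max 1 (max K1 K2) := by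
    intro z
    by_cases hz : |z| ≤ 2
    · exact (hK2 z (abs_le.1 hz)).trans ((le_max_right _ _).trans (le_max_right _ _))
    · rw [deriv_deriv_bumpProfile_support (by linarith), abs_zero]
      exact zero_le_one.trans (le_max_left _ _)
  refine ⟨max 1 (max K1 K2), le_max_left _ _, fun N hN z => ⟨?_, ?_⟩⟩
  · rw [deriv_cutoff, abs_mul, abs_of_pos (inv_pos.2 hN), div_eq_inv_mul]
    exact mul_le_mul_of_nonneg_left (b1 _) (inv_pos.2 hN).le
  · rw [deriv_deriv_cutoff, abs_mul, abs_of_pos (pow_pos (inv_pos.2 hN) 2), div_eq_inv_mul, inv_pow]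
    exact mul_le_mul_of_nonneg_left (b2 _) (by positivity)

/-! ### Time dependence -/

/-- The open upper half of space-time. -/
abbrev posTime (n : ℕ) : Set (ℝ × Space n) := Set.Ioi 0 ×ˢ Set.univ

lemma isOpen_posTime : IsOpen (posTime n) := isOpen_Ioi.prod isOpen_univ

lemma mem_posTime {t : ℝ} (ht : 0 < t) (x : Space n) : (t, x) ∈ posTime n := ⟨ht, trivial⟩

section SpaceTime
variable {E : Type*} [NormedAddCommGroup E] [NormedSpace ℝ E] {f : ℝ → Space n → E}

lemma hasDerivAt_time (hf : ContDiffOn ℝ 1 (fun q : ℝ × Space n => f q.1 q.2) (posTime n))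
    {t : ℝ} (ht : 0 < t) (x : Space n) :
    HasDerivAt (fun s => f s x) (fderiv ℝ (fun q : ℝ × Space n => f q.1 q.2) (t, x) (1, 0)) t := by
  have h1 := (hf.differentiableOn one_ne_zero).differentiableAt
    (isOpen_posTime.mem_nhds (mem_posTime ht x))
  have h2 : HasDerivAt (fun s : ℝ => (s, x)) ((1 : ℝ), (0 : Space n)) t :=
    (hasDerivAt_id t).prodMk (hasDerivAt_const t x)
  exact h1.hasFDerivAt.comp_hasDerivAt t h2

lemma hasFDerivAt_space (hf : ContDiffOn ℝ 1 (fun q : ℝ × Space n => f q.1 q.2) (posTime n))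
    {t : ℝ} (ht : 0 < t) (x : Space n) :
    HasFDerivAt (f t) ((fderiv ℝ (fun q : ℝ × Space n => f q.1 q.2) (t, x)).comp
      (ContinuousLinearMap.inr ℝ ℝ (Space n))) x := by
  have h1 := (hf.differentiableOn one_ne_zero).differentiableAt
    (isOpen_posTime.mem_nhds (mem_posTime ht x))
  exact h1.hasFDerivAt.comp x (hasFDerivAt_prodMk_right t x)

lemma contDiff_space (hf : ContDiffOn ℝ 1 (fun q : ℝ × Space n => f q.1 q.2) (posTime n))
    {t : ℝ} (ht : 0 < t) : ContDiff ℝ 1 (f t) := by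
  rw [← contDiffOn_univ]
  exact hf.comp (f := fun x : Space n => (t, x)) (contDiff_prodMk_right t).contDiffOn
    fun x _ => mem_posTime ht x

lemma continuousOn_deriv_time
    (hf : ContDiffOn ℝ 1 (fun q : ℝ × Space n => f q.1 q.2) (posTime n)) :
    ContinuousOn (fun q : ℝ × Space n => deriv (fun s => f s q.2) q.1) (posTime n) := by
  have := hf.continuousOn_fderiv_of_isOpen isOpen_posTime le_rfl
  refine (this.clm_apply (continuousOn_const (c := ((1 : ℝ), (0 : Space n))))).congr fun q hq => ?_
  exact (hasDerivAt_time hf hq.1 q.2).deriv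

lemma continuousOn_fderiv_space
    (hf : ContDiffOn ℝ 1 (fun q : ℝ × Space n => f q.1 q.2) (posTime n)) :
    ContinuousOn (fun q : ℝ × Space n => fderiv ℝ (f q.1) q.2) (posTime n) := by
  have := hf.continuousOn_fderiv_of_isOpen isOpen_posTime le_rfl
  refine (this.clm_comp (continuousOn_const (c := ContinuousLinearMap.inr ℝ ℝ (Space n)))).congr
    fun q hq => ?_
  exact (hasFDerivAt_space hf hq.1 q.2).fderiv

end SpaceTime

lemma integral_eq_setIntegral_slab {f : Space n → ℝ} {R : ℝ}
    (hR : ∀ x, R < |vert x| → f x = 0) :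
    ∫ x, f x ∂(normVol n L) = ∫ x in slab n L R, f x ∂(normVol n L) := by
  refine (setIntegral_eq_integral_of_ae_compl_eq_zero ?_).symm
  filter_upwards [ae_mem_strip n L] with x hx hx'
  exact hR x (not_le.1 fun h => hx' ⟨hx, h⟩)

lemma continuousOn_integral_time {f : ℝ → Space n → ℝ} {R : ℝ}
    (hf : ContinuousOn (fun q : ℝ × Space n => f q.1 q.2) (posTime n))
    (hR : ∀ t, 0 < t → ∀ x, R < |vert x| → f t x = 0) :
    ContinuousOn (fun t => ∫ x, f t x ∂(normVol n L)) (Set.Ioi 0) := by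
  have h1 : ContinuousOn (fun t => ∫ x in slab n L R, f t x ∂(normVol n L)) (Set.Ioi 0) := by
    rw [continuousOn_iff_continuous_domRestrict]
    have h2 : Continuous (Function.uncurry fun (t : Set.Ioi (0 : ℝ)) (x : Space n) => f t x) := by
      refine hf.comp_continuous
        (f := fun q : Set.Ioi (0 : ℝ) × Space n => ((q.1 : ℝ), q.2)) (by fun_prop) ?_
      exact fun q => mem_posTime q.1.2 _
    have : LocallyCompactSpace (Set.Ioi (0 : ℝ)) := isOpen_Ioi.locallyCompactSpace
    exact continuous_parametric_integral_of_continuous (μ := normVol n L) h2 (isCompact_slab n L _)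
  exact h1.congr fun t ht => integral_eq_setIntegral_slab (hR t ht)

/-- The fundamental theorem of calculus holds at each `x`, and Fubini applies on the compact set
`[s, t] ×` slab. The restriction `0 < s` keeps away from the initial time, where no regularity is
available. -/
lemma integral_sub_integral_eq_intervalIntegral (hL : 0 < L) {f f' : ℝ → Space n → ℝ} {R : ℝ}
    (hd : ∀ t, 0 < t → ∀ x, HasDerivAt (fun s => f s x) (f' t x) t)
    (hf : ∀ t, 0 < t → Continuous (f t))
    (hf' : ContinuousOn (fun q : ℝ × Space n => f' q.1 q.2) (posTime n))
    (hR : ∀ t, 0 < t → ∀ x, R < |vert x| → f t x = 0)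
    (hR' : ∀ t, 0 < t → ∀ x, R < |vert x| → f' t x = 0) {s t : ℝ} (hs : 0 < s) (hst : s ≤ t) :
    ∫ x, f t x ∂(normVol n L) - ∫ x, f s x ∂(normVol n L) =
      ∫ τ in s..t, ∫ x, f' τ x ∂(normVol n L) := by
  have hpos : ∀ τ ∈ Set.uIcc s t, 0 < τ := fun τ hτ => by
    rw [Set.uIcc_of_le hst] at hτ; exact hs.trans_le hτ.1
  have ht := hs.trans_le hst
  rw [← integral_sub (integrable_of_continuous hL (hf t ht) (hR t ht))
    (integrable_of_continuous hL (hf s hs) (hR s hs)),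
    integral_eq_setIntegral_slab (R := R) (fun x hx => by simp [hR t ht x hx, hR s hs x hx]),
    intervalIntegral.integral_congr fun τ hτ => integral_eq_setIntegral_slab (hR' τ (hpos τ hτ)),
    intervalIntegral_integral_swap]
  · refine integral_congr_ae (Eventually.of_forall fun x => ?_)
    refine (intervalIntegral.integral_eq_sub_of_hasDerivAt (f := fun s => f s x)
      (fun τ hτ => hd τ (hpos τ hτ) x) ?_).symm
    refine ContinuousOn.intervalIntegrable ?_
    exact hf'.comp (f := fun τ : ℝ => (τ, x)) (by fun_prop) fun τ hτ => mem_posTime (hpos τ hτ) x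
  · rw [Measure.prod_restrict]
    have h1 : IntegrableOn (Function.uncurry f') (Set.uIcc s t ×ˢ slab n L R)
        (volume.prod (normVol n L)) := by
      refine ContinuousOn.integrableOn_compact (isCompact_uIcc.prod (isCompact_slab n L R)) ?_
      exact hf'.mono fun q hq => mem_posTime (hpos _ hq.1) _
    exact h1.mono_set (Set.prod_mono Set.uIoc_subset_uIcc le_rfl)

/-! ### Consequences of the equation of the density -/

namespace IsClassicalSolution
variable {g : ℝ} {ρ : ℝ → Space n → ℝ} {u : ℝ → Space n → Space n} {p : ℝ → Space n → ℝ}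

lemma continuousOn_density (h : IsClassicalSolution n L g ρ u p) :
    ContinuousOn (fun q : ℝ × Space n => ρ q.1 q.2) (posTime n) := h.contDiff_density.continuousOn

lemma continuousOn_velocity (h : IsClassicalSolution n L g ρ u p) :
    ContinuousOn (fun q : ℝ × Space n => u q.1 q.2) (posTime n) := h.contDiff_velocity.continuousOn

lemma continuousOn_gradient (h : IsClassicalSolution n L g ρ u p) :
    ContinuousOn (fun q : ℝ × Space n => gradient (ρ q.1) q.2) (posTime n) :=
  (InnerProductSpace.toDual ℝ (Space n)).symm.continuous.comp_continuousOn
    (continuousOn_fderiv_space h.contDiff_density)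

lemma contDiff_velocity_space (h : IsClassicalSolution n L g ρ u p) {t : ℝ} (ht : 0 < t) :
    ContDiff ℝ 1 (u t) := contDiff_space h.contDiff_velocity ht

/-- The balance of `∫ φ(ρ) w`. -/
theorem integral_density_sub (h : IsClassicalSolution n L g ρ u p) (hL : 0 < L) {φ w : ℝ → ℝ}
    (hφ : ContDiff ℝ 2 φ) (hw : ContDiff ℝ 2 w) {R : ℝ} (hR : ∀ z, R ≤ |z| → w z = 0) {s t : ℝ}
    (hs : 0 < s) (hst : s ≤ t) :
    ∫ x, φ (ρ t x) * w (vert x) ∂(normVol n L) - ∫ x, φ (ρ s x) * w (vert x) ∂(normVol n L) =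
      ∫ τ in s..t, (∫ x, φ (ρ τ x) * (vert (u τ x) * deriv w (vert x) + deriv (deriv w) (vert x))
        ∂(normVol n L)
      - ∫ x, deriv (deriv φ) (ρ τ x) * ‖gradient (ρ τ) x‖ ^ 2 * w (vert x) ∂(normVol n L)) := by
  have hφ1 : ContDiff ℝ 1 (deriv φ) := contDiff_deriv hφ
  have cφ := hφ.continuous
  have cφ1 := hφ1.continuous
  have cw := hw.continuous
  rw [integral_sub_integral_eq_intervalIntegral (R := R) hL
    (f := fun t x => φ (ρ t x) * w (vert x))
    (f' := fun t x => deriv φ (ρ t x) * deriv (fun s => ρ s x) t * w (vert x)) _ _ _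
    (fun t _ x hx => by simp [hR _ hx.le]) (fun t _ x hx => by simp [hR _ hx.le]) hs hst]
  · refine intervalIntegral.integral_congr fun τ hτ => ?_
    rw [Set.uIcc_of_le hst] at hτ
    have hτ0 : 0 < τ := hs.trans_le hτ.1
    rw [← integral_density_balance hL (h.contDiff_density_space τ hτ0)
      (h.periodic_density τ hτ0.le) (h.contDiff_velocity_space hτ0) (h.periodic_velocity τ hτ0.le)
      (h.incompressible τ hτ0) hφ hw hR]
    refine integral_congr_ae (Eventually.of_forall fun x => ?_)
    have := h.transport τ hτ0 x
    dsimp only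
    rw [show deriv (fun s => ρ s x) τ = (Δ (ρ τ)) x - inner ℝ (u τ x) (gradient (ρ τ) x) by
      linarith]
  · intro t ht x
    have h1 := hasDerivAt_time h.contDiff_density ht x
    have h2 := ((hφ.differentiable two_ne_zero (ρ t x)).hasDerivAt.comp t h1).mul_const (w (vert x))
    rw [h1.deriv]
    exact h2
  · intro t ht
    have := (h.contDiff_density_space t ht).continuous
    fun_prop
  · have c1 := h.continuousOn_density
    have c2 := continuousOn_deriv_time h.contDiff_density
    fun_prop

lemma continuousOn_dissipation (h : IsClassicalSolution n L g ρ u p) {ψ w : ℝ → ℝ}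
    (hψ : Continuous ψ) (hw : Continuous w) {R : ℝ} (hR : ∀ z, R ≤ |z| → w z = 0) :
    ContinuousOn (fun τ => ∫ x, ψ (ρ τ x) * ‖gradient (ρ τ) x‖ ^ 2 * w (vert x) ∂(normVol n L))
      (Set.Ioi 0) := by
  refine continuousOn_integral_time (R := R) ?_ fun t _ x hx => by simp [hR _ hx.le]
  have c1 := h.continuousOn_density
  have c2 := h.continuousOn_gradient
  fun_prop

lemma continuousOn_flux (h : IsClassicalSolution n L g ρ u p) {φ w : ℝ → ℝ}
    (hφ : Continuous φ) (hw : ContDiff ℝ 2 w) {R : ℝ} (hR : ∀ z, R ≤ |z| → w z = 0) :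
    ContinuousOn (fun τ => ∫ x, φ (ρ τ x) *
      (vert (u τ x) * deriv w (vert x) + deriv (deriv w) (vert x)) ∂(normVol n L))
      (Set.Ioi 0) := by
  have hR1 := deriv_eq_zero_of_support hR
  have hR2 := deriv_eq_zero_of_support hR1
  have cw1 := (contDiff_deriv hw).continuous
  have cw2 := (contDiff_deriv hw).continuous_deriv_one
  refine continuousOn_integral_time (R := R + 1 + 1) ?_ fun t _ x hx => by
    simp [hR1 _ (show R + 1 ≤ |vert x| by linarith), hR2 _ hx.le]
  have c1 := h.continuousOn_density
  have c2 := h.continuousOn_velocity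
  have c3 : ContinuousOn (fun q : ℝ × Space n => vert (u q.1 q.2)) (posTime n) :=
    continuous_vert.comp_continuousOn c2
  fun_prop

lemma absolutelyContinuous_normVol : normVol n L ≪ (volume : Measure (Space n)) :=
  (Measure.smul_absolutelyContinuous).trans Measure.restrict_le_self.absolutelyContinuous

lemma aestronglyMeasurable_initial (h : IsClassicalSolution n L g ρ u p) :
    AEStronglyMeasurable (ρ 0) (normVol n L) :=
  h.measurable_density.mono_ac absolutelyContinuous_normVol

/-- The initial value of `∫ φ(ρ) w` is attained. -/
theorem tendsto_integral_density (h : IsClassicalSolution n L g ρ u p) (hL : 0 < L) {φ w : ℝ → ℝ}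
    (hφ : ContDiff ℝ 1 φ) (hw : Continuous w) {R : ℝ} (hR : ∀ z, R ≤ |z| → w z = 0) {C₀ : ℝ}
    (h0 : ∀ x, |ρ 0 x| ≤ C₀) :
    Tendsto (fun s => ∫ x, φ (ρ s x) * w (vert x) ∂(normVol n L)) (𝓝[>] 0)
      (𝓝 (∫ x, φ (ρ 0 x) * w (vert x) ∂(normVol n L))) := by
  obtain ⟨C₁, hC₁⟩ := h.bounded_density 1
  set C := max C₀ C₁
  obtain ⟨K, hK⟩ := isCompact_Icc (a := -C) (b := C) |>.exists_bound_of_continuousOn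
    hφ.continuous_deriv_one.continuousOn
  obtain ⟨Φ, hΦ⟩ := isCompact_Icc (a := -C) (b := C) |>.exists_bound_of_continuousOn
    hφ.continuous.continuousOn
  obtain ⟨W, hW0, hW⟩ := exists_bound_of_continuous (n := n) (R := R) L (f := fun x => w (vert x))
    (by fun_prop) fun x hx => hR _ hx.le
  -- On an interval containing all values of the densities for times in `[0, 1]`, `φ` is Lipschitz,
  -- so convergence of `ρ s` in `L¹` of the slab passes to `φ(ρ s)`.
  have hlip : ∀ a ∈ Set.Icc (-C) C, ∀ b ∈ Set.Icc (-C) C, |φ a - φ b| ≤ K * |a - b| := by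
    intro a ha b hb
    exact (convex_Icc (-C) C).norm_image_sub_le_of_norm_deriv_le
      (fun y _ => hφ.differentiable one_ne_zero y) hK hb ha
  have hmem0 : ∀ x, ρ 0 x ∈ Set.Icc (-C) C := fun x =>
    abs_le.1 ((h0 x).trans (le_max_left _ _))
  have hmem : ∀ s ∈ Set.Ioc (0 : ℝ) 1, ∀ x, ρ s x ∈ Set.Icc (-C) C := fun s hs x =>
    abs_le.1 ((hC₁ s hs x).trans (le_max_right _ _))
  have hK0 : 0 ≤ K := by
    have := (norm_nonneg _).trans (hK _ (hmem0 0)); exact this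
  have hmeas0 := h.aestronglyMeasurable_initial
  have hint0 : Integrable (fun x => φ (ρ 0 x) * w (vert x)) (normVol n L) := by
    refine integrable_of_slab hL (B := Φ * W) (R := R) ?_ (fun x hx => ?_)
      fun x hx => by simp [hR _ hx.le]
    · exact (hφ.continuous.comp_aestronglyMeasurable hmeas0).mul
        (Continuous.aestronglyMeasurable (by fun_prop))
    · rw [abs_mul]
      exact mul_le_mul (hΦ _ (hmem0 x)) (hW x hx) (abs_nonneg _)
        ((norm_nonneg _).trans (hΦ _ (hmem0 x)))
  have hm : MeasurableSet {x : Space n | |vert x| ≤ R} :=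
    measurableSet_le (by fun_prop) (by fun_prop)
  have hlim := h.initial_density R
  have hlim2 : Tendsto (fun t => K * W * (∫⁻ x in {x | |vert x| ≤ R}, ‖ρ t x - ρ 0 x‖ₑ
      ∂(normVol n L)).toReal) (𝓝[>] 0) (𝓝 0) := by
    have := (ENNReal.tendsto_toReal ENNReal.zero_ne_top).comp hlim
    simpa using this.const_mul (K * W)
  rw [tendsto_iff_norm_sub_tendsto_zero]
  refine squeeze_zero' (Eventually.of_forall fun _ => norm_nonneg _) ?_ hlim2
  have hev : ∀ᶠ s in 𝓝[>] (0 : ℝ), s ∈ Set.Ioc (0 : ℝ) 1 := Ioc_mem_nhdsGT zero_lt_one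
  filter_upwards [hev] with s hs
  have hsc := (h.contDiff_density_space s hs.1).continuous
  have hφc := hφ.continuous
  have hints : Integrable (fun x => φ (ρ s x) * w (vert x)) (normVol n L) :=
    integrable_of_continuous hL (R := R) (by fun_prop) fun x hx => by simp [hR _ hx.le]
  have hd : IntegrableOn (fun x => ρ s x - ρ 0 x) {x | |vert x| ≤ R} (normVol n L) := by
    refine Measure.integrableOn_of_bounded (M := C + C)
      (by rw [normVol_slab hL]; exact ENNReal.ofReal_ne_top)
      (hsc.aestronglyMeasurable.sub hmeas0) (Eventually.of_forall fun x => ?_)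
    exact (norm_sub_le _ _).trans (add_le_add (abs_le.2 (hmem s hs x)) (abs_le.2 (hmem0 x)))
  rw [← integral_sub hints hint0, ← integral_norm_eq_lintegral_enorm hd.aestronglyMeasurable,
    ← integral_const_mul,
    ← setIntegral_eq_integral_of_forall_compl_eq_zero (s := {x | |vert x| ≤ R})]
  · refine (norm_integral_le_integral_norm _).trans ?_
    refine integral_mono_ae (hints.sub hint0).norm.integrableOn (hd.norm.const_mul _) ?_
    filter_upwards [ae_restrict_of_ae (ae_mem_strip n L)] with x hx
    rw [← sub_mul, norm_mul]
    calc ‖φ (ρ s x) - φ (ρ 0 x)‖ * ‖w (vert x)‖ ≤ (K * |ρ s x - ρ 0 x|) * W :=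
          mul_le_mul (hlip _ (hmem s hs x) _ (hmem0 x)) (hW x hx) (norm_nonneg _) (by positivity)
      _ = K * W * ‖ρ s x - ρ 0 x‖ := by rw [Real.norm_eq_abs]; ring
  · intro x hx
    simp [hR _ (not_le.1 hx).le]

/-- An upper bound on the rate of change of `∫ φ(ρ) w` bounds its growth. -/
theorem integral_density_le (h : IsClassicalSolution n L g ρ u p) (hL : 0 < L) {φ w : ℝ → ℝ}
    (hφ : ContDiff ℝ 2 φ) (hw : ContDiff ℝ 2 w) {R : ℝ} (hR : ∀ z, R ≤ |z| → w z = 0) {C₀ : ℝ}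
    (h0 : ∀ x, |ρ 0 x| ≤ C₀) {t : ℝ} (ht : 0 < t) {B : ℝ}
    (hB : ∀ τ ∈ Set.Ioc 0 t,
      ∫ x, φ (ρ τ x) * (vert (u τ x) * deriv w (vert x) + deriv (deriv w) (vert x)) ∂(normVol n L)
      - ∫ x, deriv (deriv φ) (ρ τ x) * ‖gradient (ρ τ) x‖ ^ 2 * w (vert x) ∂(normVol n L) ≤ B) :
    ∫ x, φ (ρ t x) * w (vert x) ∂(normVol n L) ≤
      ∫ x, φ (ρ 0 x) * w (vert x) ∂(normVol n L) + B * t := by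
  have hlim := h.tendsto_integral_density hL (hφ.of_le (by norm_num)) hw.continuous hR h0
  have hlim2 : Tendsto (fun s : ℝ => ∫ x, φ (ρ s x) * w (vert x) ∂(normVol n L) + B * (t - s))
      (𝓝[>] 0) (𝓝 (∫ x, φ (ρ 0 x) * w (vert x) ∂(normVol n L) + B * (t - 0))) := by
    refine hlim.add (tendsto_nhdsWithin_of_tendsto_nhds ?_)
    exact Continuous.tendsto (by fun_prop) 0
  rw [sub_zero] at hlim2
  -- The balance is available only from positive times `s`; the inequality is passed to the limit `s
  -- ↓ 0`.
  refine ge_of_tendsto hlim2 ?_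
  filter_upwards [Ioc_mem_nhdsGT ht] with s hs
  have h1 := h.integral_density_sub hL hφ hw hR hs.1 hs.2
  have c1 := (h.continuousOn_flux hφ.continuous hw hR (L := L)).sub
    (h.continuousOn_dissipation (contDiff_deriv hφ).continuous_deriv_one hw.continuous hR)
  have hsub : Set.uIcc s t ⊆ Set.Ioi 0 := fun τ hτ => by
    rw [Set.uIcc_of_le hs.2] at hτ
    exact hs.1.trans_le hτ.1
  have h2 := intervalIntegral.integral_mono_on hs.2
    ((c1.mono hsub).intervalIntegrable (μ := volume))
    (intervalIntegrable_const (c := B)) fun τ hτ => hB τ ⟨hs.1.trans_le hτ.1, hτ.2⟩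
  rw [intervalIntegral.integral_const, smul_eq_mul] at h2
  simp only [Pi.sub_apply] at h2
  linarith

end IsClassicalSolution

/-- The flux of a bounded quantity through the edge of a cutoff. -/
lemma abs_integral_flux_cutoff_le (hL : 0 < L) {K : ℝ}
    (hK : ∀ N : ℝ, 0 < N → ∀ z, |deriv (cutoff N) z| ≤ K / N ∧
      |deriv (deriv (cutoff N)) z| ≤ K / N ^ 2) {N ε M : ℝ} (hN : 0 < N) (hε : 0 ≤ ε)
    {m : Space n → ℝ} (hm : ∀ x, |m x| ≤ M) {U : Space n → Space n}
    (hU : ∀ x, N ≤ |vert x| → ‖U x‖ ≤ ε) :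
    |∫ x, m x * (vert (U x) * deriv (cutoff N) (vert x) + deriv (deriv (cutoff N)) (vert x))
      ∂(normVol n L)| ≤ 4 * M * K * (ε + 1 / N) := by
  have hM : 0 ≤ M := (abs_nonneg _).trans (hm 0)
  have hK0 : 0 ≤ K := by
    have := (abs_nonneg _).trans (hK 1 one_pos 0).1
    simpa using this
  -- The derivatives of the cutoff live on `N ≤ |z| ≤ 2N`, where the velocity is at most `ε`. The
  -- factor `4N` is the height of the slab `|z| ≤ 2N`; it compensates the `1/N` of the first
  -- derivative and leaves `1/N` for the second.
  refine (abs_integral_le_of_slab hL (B := M * (ε * (K / N) + K / N ^ 2)) (R := 2 * N)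
    (by positivity) (fun x _ => ?_) fun x hx => ?_).trans_eq ?_
  · rw [abs_mul]
    refine mul_le_mul (hm x) ((abs_add_le _ _).trans (add_le_add ?_ (hK N hN _).2)) (abs_nonneg _) hM
    by_cases hx : N ≤ |vert x|
    · rw [abs_mul]
      refine mul_le_mul ?_ (hK N hN _).1 (abs_nonneg _) hε
      exact (PiLp.norm_apply_le (U x) (Fin.last n)).trans (hU x hx)
    · rw [deriv_cutoff_of_lt (not_le.1 hx), mul_zero, abs_zero]
      positivity
  · rw [deriv_cutoff_eq_zero hN hx.le, deriv_deriv_cutoff_eq_zero hN hx.le]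
    simp
  · field_simp
    ring

/-! ### The maximum principle -/

/-- Only the origin needs care: there the function is `O(|y|^(k+2))`, hence `o(y)`, since the
exponent exceeds one. -/
lemma hasDerivAt_max_zero_pow (k : ℕ) (x : ℝ) :
    HasDerivAt (fun y : ℝ => max y 0 ^ (k + 2)) ((k + 2) * max x 0 ^ (k + 1)) x := by
  rcases lt_trichotomy x 0 with hx | rfl | hx
  · have h1 : (fun y : ℝ => max y 0 ^ (k + 2)) =ᶠ[𝓝 x] fun _ => 0 :=
      (gt_mem_nhds hx).mono fun y hy => by simp [max_eq_right (le_of_lt hy)]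
    simpa [max_eq_right hx.le] using (hasDerivAt_const x (0 : ℝ)).congr_of_eventuallyEq h1
  · have h1 : (fun y : ℝ => max y 0 ^ (k + 2)) =O[𝓝 0] fun y : ℝ => y ^ (k + 2) := by
      refine Asymptotics.IsBigO.of_bound 1 (Eventually.of_forall fun y => ?_)
      rw [one_mul, norm_pow, norm_pow]
      refine pow_le_pow_left₀ (norm_nonneg _) ?_ _
      rw [Real.norm_eq_abs, Real.norm_eq_abs, abs_of_nonneg (le_max_right _ _)]
      exact max_le (le_abs_self y) (abs_nonneg y)
    have h2 : (fun y : ℝ => y ^ (k + 2)) =o[𝓝 0] fun y : ℝ => y := by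
      simpa using Asymptotics.isLittleO_pow_pow (𝕜 := ℝ) (show 1 < k + 2 by omega)
    rw [hasDerivAt_iff_isLittleO]
    simpa using h1.trans_isLittleO h2
  · have h1 : (fun y : ℝ => max y 0 ^ (k + 2)) =ᶠ[𝓝 x] fun y => y ^ (k + 2) :=
      (lt_mem_nhds hx).mono fun y hy => by simp [max_eq_left (le_of_lt hy)]
    have h2 := (hasDerivAt_pow (k + 2) x).congr_of_eventuallyEq h1
    rw [max_eq_left hx.le]
    simpa using h2

/-- A convex function of class `C²` vanishing exactly on the negative half-line. -/
def ramp (x : ℝ) : ℝ := max x 0 ^ 3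

lemma deriv_ramp : deriv ramp = fun x => 3 * max x 0 ^ 2 := by
  ext x
  have := (hasDerivAt_max_zero_pow 1 x).deriv
  unfold ramp
  norm_num at this ⊢
  exact this

lemma deriv_deriv_ramp : deriv (deriv ramp) = fun x => 6 * max x 0 := by
  ext x
  rw [deriv_ramp]
  have := ((hasDerivAt_max_zero_pow 0 x).const_mul 3).deriv
  norm_num at this ⊢
  rw [this]; ring

lemma contDiff_ramp : ContDiff ℝ 2 ramp := by
  rw [show (2 : WithTop ℕ∞) = 1 + 1 by norm_num, contDiff_succ_iff_deriv]
  refine ⟨fun x => (hasDerivAt_max_zero_pow 1 x).differentiableAt, by simp, ?_⟩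
  rw [contDiff_one_iff_deriv, deriv_deriv_ramp, deriv_ramp]
  exact ⟨fun x => ((hasDerivAt_max_zero_pow 0 x).const_mul 3).differentiableAt, by fun_prop⟩

lemma ramp_nonneg (x : ℝ) : 0 ≤ ramp x := pow_nonneg (le_max_right _ _) 3

lemma ramp_eq_zero {x : ℝ} : ramp x = 0 ↔ x ≤ 0 := by
  simp [ramp]

/-- A continuous periodic function which vanishes almost everywhere in the strip is zero. -/
lemma eq_zero_of_ae_strip (hL : 0 < L) {f : Space n → ℝ} (hf : Continuous f)
    (hper : TransversePeriodic L f) (h0 : ∀ x, 0 ≤ f x)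
    (hae : f =ᵐ[normVol n L] 0) (x : Space n) : f x = 0 := by
  -- `c` is the transverse centre of the cell. Translation by `v` sends the point above `c` at the
  -- height of `x` to `x`, so the value at `x`, which may lie outside the strip or on its boundary,
  -- is read off in the interior, where vanishing almost everywhere forces vanishing.
  let c : Space n := WithLp.toLp 2 (Fin.lastCases 0 fun _ => L / 2)
  have hc : ∀ i : Fin n, c i.castSucc = L / 2 := fun i => by simp [c]
  let v : Space n := transverse x - c
  have hv : vert v = 0 := by simp [v, vert, c, transverse_last]
  have h1 := lintegral_add_transverse hL (f := fun y => ENNReal.ofReal (f y))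
    (fun i y => by simp [hper i y]) hv
  have h2 : ∫⁻ y, ENNReal.ofReal (f y) ∂(normVol n L) = 0 := by
    rw [lintegral_eq_zero_iff (by fun_prop)]
    filter_upwards [hae] with y hy
    simp [hy]
  rw [h2, lintegral_eq_zero_iff (by fun_prop)] at h1
  let O : Set (Space n) := {y | ∀ i : Fin n, y i.castSucc ∈ Set.Ioo 0 L}
  have hO : IsOpen O := by
    simp only [O, Set.ofPred_forall]
    exact isOpen_iInter_of_finite fun i => isOpen_Ioo.preimage (by fun_prop)
  have hOs : O ⊆ strip n L := fun y hy i => ⟨(hy i).1.le, (hy i).2.le⟩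
  have h3 : (fun y => f (y + v)) =ᵐ[volume.restrict O] fun _ => 0 := by
    have hne : ENNReal.ofReal ((L ^ n)⁻¹) ≠ 0 := by
      rw [ne_eq, ENNReal.ofReal_eq_zero, not_le]; positivity
    have h4 : (fun y => ENNReal.ofReal (f (y + v))) =ᵐ[volume.restrict (strip n L)] 0 := by
      rw [normVol] at h1
      exact (Measure.ae_ennreal_smul_measure_iff hne).1 h1
    filter_upwards [ae_restrict_of_ae_restrict_of_subset hOs h4] with y hy
    exact le_antisymm (ENNReal.ofReal_eq_zero.1 hy) (h0 _)
  have h5 := Measure.eqOn_open_of_ae_eq h3 hO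
    (Continuous.continuousOn (by fun_prop)) continuousOn_const
  have hy : c + vert x • ez n ∈ O := by
    intro i
    have : (c + vert x • ez n) i.castSucc = L / 2 := by
      simp [hc, ez, Fin.castSucc_ne_last]
    rw [this]
    constructor <;> linarith
  have hx : c + vert x • ez n + v = x := by simp only [v, transverse]; abel
  have h6 := h5 hy
  simpa only [hx] using h6

/-- The scale must at least double: then `cutoff M` equals `1` wherever `cutoff N` is nonzero.
Monotonicity of the profile is not needed. -/
lemma cutoff_le_cutoff {N M : ℝ} (hN : 0 < N) (hM : 2 * N ≤ M) (z : ℝ) :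
    cutoff N z ≤ cutoff M z := by
  by_cases hz : 2 * N ≤ |z|
  · rw [cutoff_eq_zero hN hz]; exact cutoff_nonneg _ _
  · rw [cutoff_eq_one (by linarith : 0 < M) (by linarith)]; exact cutoff_le_one _ _

lemma integral_mul_cutoff_mono (hL : 0 < L) {f : Space n → ℝ} (hf : Continuous f)
    (h0 : ∀ x, 0 ≤ f x) {N M : ℝ} (hN : 0 < N) (hM : 2 * N ≤ M) :
    ∫ x, f x * cutoff N (vert x) ∂(normVol n L) ≤ ∫ x, f x * cutoff M (vert x) ∂(normVol n L) := by
  have hM0 : 0 < M := by linarith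
  refine integral_mono (integrable_of_continuous hL (R := 2 * N) (by fun_prop)
    fun x hx => by simp [cutoff_eq_zero hN hx.le])
    (integrable_of_continuous hL (R := 2 * M) (by fun_prop)
    fun x hx => by simp [cutoff_eq_zero hM0 hx.le]) fun x => ?_
  exact mul_le_mul_of_nonneg_left (cutoff_le_cutoff hN hM _) (h0 x)

namespace IsClassicalSolution
variable {g : ℝ} {ρ : ℝ → Space n → ℝ} {u : ℝ → Space n → Space n} {p : ℝ → Space n → ℝ}

/-- For convex `φ` diffusion can only decrease `∫ φ(ρ) χ`, and transport changes it only through the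
edge of the cutoff, which contributes arbitrarily little as the cutoff recedes. Since the integral
starts from zero and `φ` is nonnegative, it remains zero. -/
theorem maximum_principle (h : IsClassicalSolution n L g ρ u p) (hL : 0 < L) {φ : ℝ → ℝ}
    (hφ : ContDiff ℝ 2 φ) (hφ0 : ∀ r, 0 ≤ φ r) (hconv : ∀ r, 0 ≤ deriv (deriv φ) r) {C₀ : ℝ}
    (h0 : ∀ x, |ρ 0 x| ≤ C₀) (hinit : ∀ x, φ (ρ 0 x) = 0) {t : ℝ} (ht : 0 < t) (x : Space n) :
    φ (ρ t x) = 0 := by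
  obtain ⟨C, hC⟩ := h.bounded_density t
  obtain ⟨M, hM⟩ := isCompact_Icc (a := -C) (b := C) |>.exists_bound_of_continuousOn
    hφ.continuous.continuousOn
  have hM' : ∀ τ ∈ Set.Ioc 0 t, ∀ x, |φ (ρ τ x)| ≤ M := fun τ hτ x => hM _ (abs_le.1 (hC τ hτ x))
  have hM0 : 0 ≤ M := (abs_nonneg _).trans (hM' t ⟨ht, le_rfl⟩ 0)
  obtain ⟨K, hK1, hK⟩ := exists_deriv_cutoff_bound
  have hK0 : 0 ≤ K := zero_le_one.trans hK1
  have hρ := (h.contDiff_density_space t ht).continuous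
  have hφc := hφ.continuous
  have key : ∀ N : ℝ, 0 < N → ∫ x, φ (ρ t x) * cutoff N (vert x) ∂(normVol n L) ≤ 0 := by
    intro N hN
    refine le_of_forall_pos_le_add fun δ hδ => ?_
    rw [zero_add]
    set A := 4 * M * K * t with hA
    have hA0 : 0 ≤ A := by positivity
    -- With `1/N' ≤ ε` the total edge flux up to time `t` is at most `2 A ε ≤ δ`.
    set ε := δ / (2 * (A + 1)) with hε
    have hε0 : 0 < ε := by positivity
    obtain ⟨R, hR⟩ := h.velocity_vanishes t ε hε0
    set N' := max (2 * N) (max R (1 / ε)) with hN'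
    have hNN : 2 * N ≤ N' := le_max_left _ _
    have hN'0 : 0 < N' := by linarith
    have hRN : R ≤ N' := (le_max_left _ _).trans (le_max_right _ _)
    have hεN : 1 / N' ≤ ε := by
      have : 1 / ε ≤ N' := (le_max_right _ _).trans (le_max_right _ _)
      rw [div_le_iff₀ hN'0]
      rw [div_le_iff₀ hε0] at this
      linarith
    refine (integral_mul_cutoff_mono hL (f := fun x => φ (ρ t x)) (by fun_prop)
      (fun x => hφ0 _) hN hNN).trans ?_
    have hb := h.integral_density_le hL hφ (contDiff_cutoff (k := 2) N') (R := 2 * N')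
      (fun z hz => cutoff_eq_zero hN'0 hz) h0 ht (B := 4 * M * K * (ε + 1 / N')) (by
        intro τ hτ
        have h1 := abs_integral_flux_cutoff_le hL hK hN'0 hε0.le (m := fun x => φ (ρ τ x))
          (hM' τ hτ) (U := u τ) fun x hx => hR τ hτ x (hRN.trans hx)
        have h2 : 0 ≤ ∫ x, deriv (deriv φ) (ρ τ x) * ‖gradient (ρ τ) x‖ ^ 2 *
            cutoff N' (vert x) ∂(normVol n L) := integral_nonneg fun x =>
          mul_nonneg (mul_nonneg (hconv _) (sq_nonneg _)) (cutoff_nonneg _ _)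
        linarith [le_abs_self (∫ x, φ (ρ τ x) * (vert (u τ x) * deriv (cutoff N') (vert x) +
          deriv (deriv (cutoff N')) (vert x)) ∂(normVol n L))])
    simp only [hinit, zero_mul, integral_zero, zero_add] at hb
    refine hb.trans ?_
    calc 4 * M * K * (ε + 1 / N') * t = A * (ε + 1 / N') := by rw [hA]; ring
      _ ≤ A * (ε + ε) := by gcongr
      _ ≤ (A + 1) * (ε + ε) := by gcongr; linarith
      _ = δ := by rw [hε]; field_simp; ring
  refine eq_zero_of_ae_strip hL (f := fun x => φ (ρ t x)) (by fun_prop)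
    (fun i x => by simp [h.periodic_density t ht.le i x]) (fun x => hφ0 _) ?_ x
  have hN : ∀ N : ℕ, ∀ᵐ x ∂(normVol n L), φ (ρ t x) * cutoff (N + 1) (vert x) = 0 := by
    intro N
    have hp : (0 : ℝ) < N + 1 := by positivity
    have hpos : ∀ x, 0 ≤ φ (ρ t x) * cutoff (N + 1) (vert x) := fun x =>
      mul_nonneg (hφ0 _) (cutoff_nonneg _ _)
    have := (integral_eq_zero_iff_of_nonneg hpos (integrable_of_continuous hL (R := 2 * (N + 1))
      (by fun_prop) fun x hx => by simp [cutoff_eq_zero hp hx.le])).1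
      (le_antisymm (key _ hp) (integral_nonneg hpos))
    exact this
  rw [← ae_all_iff] at hN
  filter_upwards [hN] with x hx
  obtain ⟨N, hN⟩ := exists_nat_ge |vert x|
  have := hx N
  rwa [cutoff_eq_one (by positivity) (by linarith), mul_one] at this

/-- The maximum principle is applied to `ramp (rm - r)` and `ramp (r - rp)`, convex functions which
vanish exactly on the admissible side of each bound. -/
theorem density_mem_Icc (h : IsClassicalSolution n L g ρ u p) (hL : 0 < L) {rm rp : ℝ}
    (h0 : ∀ x, ρ 0 x ∈ Set.Icc rm rp) {t : ℝ} (ht : 0 ≤ t) (x : Space n) :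
    ρ t x ∈ Set.Icc rm rp := by
  rcases ht.eq_or_lt with rfl | ht
  · exact h0 x
  have hb : ∀ x, |ρ 0 x| ≤ max |rm| |rp| := fun x => abs_le_max_abs_abs (h0 x).1 (h0 x).2
  constructor
  · have := h.maximum_principle hL (φ := fun r => ramp (rm - r))
      (contDiff_ramp.comp (by fun_prop)) (fun r => ramp_nonneg _) (fun r => ?_) hb
      (fun x => ramp_eq_zero.2 (by linarith [(h0 x).1])) ht x
    · linarith [ramp_eq_zero.1 this]
    · have e1 : deriv (fun r => ramp (rm - r)) = fun r => -deriv ramp (rm - r) :=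
        funext fun r => deriv_comp_const_sub ..
      rw [e1, deriv.fun_neg, deriv_comp_const_sub, deriv_deriv_ramp]
      have := le_max_right (rm - r) 0
      simp only [neg_neg]
      positivity
  · have := h.maximum_principle hL (φ := fun r => ramp (r - rp))
      (contDiff_ramp.comp (by fun_prop)) (fun r => ramp_nonneg _) (fun r => ?_) hb
      (fun x => ramp_eq_zero.2 (by linarith [(h0 x).2])) ht x
    · linarith [ramp_eq_zero.1 this]
    · have e1 : deriv (fun r => ramp (r - rp)) = fun r => deriv ramp (r - rp) :=
        funext fun r => deriv_comp_sub_const ..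
      rw [e1, deriv_comp_sub_const, deriv_deriv_ramp]
      have := le_max_right (r - rp) 0
      positivity

end IsClassicalSolution

/-! ### Cutoff constants and weights -/

/-- A bound for the derivatives of the cutoffs. -/
def cutoffConst : ℝ := exists_deriv_cutoff_bound.choose

lemma one_le_cutoffConst : 1 ≤ cutoffConst := exists_deriv_cutoff_bound.choose_spec.1

lemma cutoffConst_pos : 0 < cutoffConst := one_pos.trans_le one_le_cutoffConst

lemma abs_deriv_cutoff_le {N : ℝ} (hN : 0 < N) (z : ℝ) :
    |deriv (cutoff N) z| ≤ cutoffConst / N :=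
  (exists_deriv_cutoff_bound.choose_spec.2 N hN z).1

lemma abs_deriv_deriv_cutoff_le {N : ℝ} (hN : 0 < N) (z : ℝ) :
    |deriv (deriv (cutoff N)) z| ≤ cutoffConst / N ^ 2 :=
  (exists_deriv_cutoff_bound.choose_spec.2 N hN z).2

lemma deriv_deriv_cutoff_of_lt {N z : ℝ} (hz : |z| < N) : deriv (deriv (cutoff N)) z = 0 := by
  have : deriv (cutoff N) =ᶠ[𝓝 z] fun _ => 0 :=
    (continuous_abs.continuousAt.eventually (gt_mem_nhds hz)).mono fun y hy => deriv_cutoff_of_lt hy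
  simp [this.deriv_eq]

lemma deriv_mul_cutoff {f : ℝ → ℝ} (hf : ContDiff ℝ 2 f) (N : ℝ) :
    deriv (fun z => f z * cutoff N z) = fun z => deriv f z * cutoff N z + f z * deriv (cutoff N) z :=
  funext fun z => deriv_fun_mul (hf.differentiable two_ne_zero z)
    ((contDiff_cutoff (k := 1) N).differentiable one_ne_zero z)

lemma deriv_deriv_mul_cutoff {f : ℝ → ℝ} (hf : ContDiff ℝ 2 f) (N : ℝ) :
    deriv (deriv (fun z => f z * cutoff N z)) = fun z => deriv (deriv f) z * cutoff N z +
      2 * deriv f z * deriv (cutoff N) z + f z * deriv (deriv (cutoff N)) z := by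
  ext z
  have h0 := hf.differentiable two_ne_zero z
  have h1 := (contDiff_deriv hf).differentiable one_ne_zero z
  have h2 := (contDiff_cutoff (k := 1) N).differentiable one_ne_zero z
  have h3 := (contDiff_deriv (contDiff_cutoff (k := 2) N)).differentiable one_ne_zero z
  rw [deriv_mul_cutoff hf, deriv_fun_add (h1.fun_mul h2) (h0.fun_mul h3), deriv_fun_mul h1 h2,
    deriv_fun_mul h0 h3]
  ring

/-- An odd smooth step, vanishing for `|z| ≤ R` and equal to `±1` for `|z| ≥ R + 1`. -/
def oddStep (R z : ℝ) : ℝ := Real.smoothTransition (z - R) - Real.smoothTransition (-z - R)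

lemma contDiff_oddStep {k : ℕ∞} (R : ℝ) : ContDiff ℝ k (oddStep R) :=
  (Real.smoothTransition.contDiff.comp (by fun_prop)).sub
    (Real.smoothTransition.contDiff.comp (by fun_prop))

lemma oddStep_of_le {R z : ℝ} (hz : |z| ≤ R) : oddStep R z = 0 := by
  obtain ⟨h1, h2⟩ := abs_le.1 hz
  rw [oddStep, Real.smoothTransition.zero_of_nonpos (by linarith),
    Real.smoothTransition.zero_of_nonpos (by linarith), sub_zero]

lemma oddStep_of_ge {R z : ℝ} (hR : 0 ≤ R) (hz : R + 1 ≤ z) : oddStep R z = 1 := by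
  rw [oddStep, Real.smoothTransition.one_of_one_le (by linarith),
    Real.smoothTransition.zero_of_nonpos (by linarith), sub_zero]

lemma oddStep_of_le_neg {R z : ℝ} (hR : 0 ≤ R) (hz : z ≤ -(R + 1)) : oddStep R z = -1 := by
  rw [oddStep, Real.smoothTransition.zero_of_nonpos (by linarith),
    Real.smoothTransition.one_of_one_le (by linarith), zero_sub]

lemma oddStep_nonneg {R z : ℝ} (hR : 0 ≤ R) (hz : 0 ≤ z) : 0 ≤ oddStep R z := by
  rw [oddStep, Real.smoothTransition.zero_of_nonpos (x := -z - R) (by linarith), sub_zero]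
  exact Real.smoothTransition.nonneg _

lemma oddStep_nonpos {R z : ℝ} (hR : 0 ≤ R) (hz : z ≤ 0) : oddStep R z ≤ 0 := by
  rw [oddStep, Real.smoothTransition.zero_of_nonpos (x := z - R) (by linarith), zero_sub]
  linarith [Real.smoothTransition.nonneg (-z - R)]

lemma abs_oddStep_le_one (R z : ℝ) : |oddStep R z| ≤ 1 := by
  have h1 := Real.smoothTransition.nonneg (z - R)
  have h2 := Real.smoothTransition.le_one (z - R)
  have h3 := Real.smoothTransition.nonneg (-z - R)
  have h4 := Real.smoothTransition.le_one (-z - R)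
  rw [oddStep, abs_le]
  constructor <;> linarith

lemma deriv_oddStep_eq_zero {R z : ℝ} (hR : 0 ≤ R) (hz : |z| < R ∨ R + 1 < |z|) :
    deriv (oddStep R) z = 0 := by
  have : ∃ c, oddStep R =ᶠ[𝓝 z] fun _ => c := by
    rcases hz with hz | hz
    · exact ⟨0, (continuous_abs.continuousAt.eventually (gt_mem_nhds hz)).mono
        fun y hy => oddStep_of_le (le_of_lt hy)⟩
    · rcases lt_abs.1 hz with hz | hz
      · exact ⟨1, (lt_mem_nhds hz).mono fun y hy => oddStep_of_ge hR (le_of_lt hy)⟩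
      · exact ⟨-1, (gt_mem_nhds (show z < -(R + 1) by linarith)).mono
          fun y hy => oddStep_of_le_neg hR (le_of_lt hy)⟩
  obtain ⟨c, hc⟩ := this
  simp [hc.deriv_eq]

lemma deriv_deriv_oddStep_eq_zero {R z : ℝ} (hR : 0 ≤ R) (hz : |z| < R ∨ R + 1 < |z|) :
    deriv (deriv (oddStep R)) z = 0 := by
  have : deriv (oddStep R) =ᶠ[𝓝 z] fun _ => 0 := by
    rcases hz with hz | hz
    · exact (continuous_abs.continuousAt.eventually (gt_mem_nhds hz)).mono
        fun y hy => deriv_oddStep_eq_zero hR (Or.inl hy)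
    · exact (continuous_abs.continuousAt.eventually (lt_mem_nhds hz)).mono
        fun y hy => deriv_oddStep_eq_zero hR (Or.inr hy)
  simp [this.deriv_eq]

lemma exists_deriv_oddStep_bound {R : ℝ} (hR : 0 ≤ R) : ∃ K, 0 ≤ K ∧ ∀ z,
    |deriv (oddStep R) z| ≤ K ∧ |deriv (deriv (oddStep R)) z| ≤ K := by
  have h1 := contDiff_deriv (contDiff_oddStep (k := 2) R)
  obtain ⟨K1, hK1⟩ := isCompact_Icc (a := -(R + 1)) (b := R + 1) |>.exists_bound_of_continuousOn
    h1.continuous.continuousOn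
  obtain ⟨K2, hK2⟩ := isCompact_Icc (a := -(R + 1)) (b := R + 1) |>.exists_bound_of_continuousOn
    h1.continuous_deriv_one.continuousOn
  refine ⟨max 0 (max K1 K2), le_max_left _ _, fun z => ?_⟩
  by_cases hz : |z| ≤ R + 1
  · exact ⟨(hK1 z (abs_le.1 hz)).trans ((le_max_left _ _).trans (le_max_right _ _)),
      (hK2 z (abs_le.1 hz)).trans ((le_max_right _ _).trans (le_max_right _ _))⟩
  · rw [deriv_oddStep_eq_zero hR (Or.inr (not_le.1 hz)),
      deriv_deriv_oddStep_eq_zero hR (Or.inr (not_le.1 hz))]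
    simp

/-- A function with one bound near the interface and another one further away. -/
lemma abs_integral_le_of_two_slabs (hL : 0 < L) {f : Space n → ℝ} {B₁ B₂ R₁ R₂ : ℝ}
    (hf : Integrable f (normVol n L)) (hR1 : 0 ≤ R₁) (hR2 : 0 ≤ R₂) (hB1 : 0 ≤ B₁) (hB2 : 0 ≤ B₂)
    (h1 : ∀ x, |vert x| ≤ R₁ → |f x| ≤ B₁) (h2 : ∀ x, R₁ < |vert x| → |f x| ≤ B₂)
    (h0 : ∀ x, R₂ < |vert x| → f x = 0) :
    |∫ x, f x ∂(normVol n L)| ≤ B₁ * (2 * R₁) + B₂ * (2 * R₂) := by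
  have hm : MeasurableSet {x : Space n | |vert x| ≤ R₁} :=
    measurableSet_le (by fun_prop) (by fun_prop)
  rw [← integral_add_compl hm hf, ← integral_indicator hm, ← integral_indicator hm.compl]
  refine (abs_add_le _ _).trans (add_le_add ?_ ?_)
  · refine abs_integral_le_of_slab hL hR1 (fun x _ => ?_) fun x hx => ?_
    · by_cases hx : |vert x| ≤ R₁
      · simpa [Set.indicator, hx] using h1 x hx
      · simpa [Set.indicator, hx] using hB1
    · simp [Set.indicator, not_le.2 hx]
  · refine abs_integral_le_of_slab hL hR2 (fun x _ => ?_) fun x hx => ?_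
    · by_cases hx : |vert x| ≤ R₁
      · simpa [Set.indicator, hx] using hB2
      · simpa [Set.indicator, hx] using h2 x (not_le.1 hx)
    · simp [Set.indicator, h0 x hx]

/-! ### Solutions with stratified initial data -/

/-- A classical solution whose initial data satisfy the hypotheses of the main theorem. -/
structure StratifiedSolution (n : ℕ) (L g rp rm : ℝ) (ρ : ℝ → Space n → ℝ)
    (u : ℝ → Space n → Space n) (p : ℝ → Space n → ℝ) : Prop
    extends IsClassicalSolution n L g ρ u p where
  length_pos : 0 < L
  gravity_pos : 0 < g
  light_pos : 0 < rm
  light_lt : rm < rp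
  initial_range : ∀ x, ρ 0 x ∈ Set.Icc rm rp
  initial_potential : Integrable (potDensity g rp rm (ρ 0)) (normVol n L)
  initial_kinetic : Integrable (fun x => ρ 0 x * ‖u 0 x‖ ^ 2) (normVol n L)

@[fun_prop]
lemma measurable_stratified (rp rm : ℝ) : Measurable (stratified rp rm : Space n → ℝ) :=
  Measurable.ite (measurableSet_le measurable_const (by fun_prop)) measurable_const measurable_const

/-- The truncated mixing volume `∫ |ρ₀ - r| χ_N`. -/
def mixVolume (L rp rm N : ℝ) (r : Space n → ℝ) : ℝ :=
  ∫ x, |stratified rp rm x - r x| * cutoff N (vert x) ∂(normVol n L)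

/-- The truncated dissipation `∫ |∇r|² χ_N`. -/
def dissipation (L N : ℝ) (r : Space n → ℝ) : ℝ :=
  ∫ x, ‖gradient r x‖ ^ 2 * cutoff N (vert x) ∂(normVol n L)

lemma dissipation_nonneg (N : ℝ) (r : Space n → ℝ) : 0 ≤ dissipation L N r :=
  integral_nonneg fun _ => mul_nonneg (sq_nonneg _) (cutoff_nonneg _ _)

lemma mixVolume_nonneg (rp rm N : ℝ) (r : Space n → ℝ) : 0 ≤ mixVolume L rp rm N r :=
  integral_nonneg fun _ => mul_nonneg (abs_nonneg _) (cutoff_nonneg _ _)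

namespace StratifiedSolution
variable {g rp rm : ℝ} {ρ : ℝ → Space n → ℝ} {u : ℝ → Space n → Space n} {p : ℝ → Space n → ℝ}

lemma mem_Icc (h : StratifiedSolution n L g rp rm ρ u p) {t : ℝ} (ht : 0 ≤ t) (x : Space n) :
    ρ t x ∈ Set.Icc rm rp :=
  h.toIsClassicalSolution.density_mem_Icc h.length_pos h.initial_range ht x

lemma heavy_pos (h : StratifiedSolution n L g rp rm ρ u p) : 0 < rp := h.light_pos.trans h.light_lt

lemma abs_density_le (h : StratifiedSolution n L g rp rm ρ u p) {t : ℝ} (ht : 0 ≤ t)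
    (x : Space n) : |ρ t x| ≤ rp := by
  have := h.mem_Icc ht x
  rw [abs_of_nonneg (h.light_pos.le.trans this.1)]
  exact this.2

lemma continuous_density (h : StratifiedSolution n L g rp rm ρ u p) {t : ℝ} (ht : 0 < t) :
    Continuous (ρ t) := (h.contDiff_density_space t ht).continuous

lemma aestronglyMeasurable_density (h : StratifiedSolution n L g rp rm ρ u p) {t : ℝ}
    (ht : 0 ≤ t) : AEStronglyMeasurable (ρ t) (normVol n L) := by
  rcases ht.eq_or_lt with rfl | ht
  · exact h.toIsClassicalSolution.aestronglyMeasurable_initial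
  · exact (h.continuous_density ht).aestronglyMeasurable

lemma sub_nonneg_of_nonneg (h : StratifiedSolution n L g rp rm ρ u p) {t : ℝ} (ht : 0 ≤ t)
    {x : Space n} (hx : 0 ≤ vert x) : 0 ≤ stratified rp rm x - ρ t x := by
  rw [stratified, if_pos hx, sub_nonneg]
  exact (h.mem_Icc ht x).2

lemma sub_nonpos_of_neg (h : StratifiedSolution n L g rp rm ρ u p) {t : ℝ} (ht : 0 ≤ t)
    {x : Space n} (hx : vert x < 0) : stratified rp rm x - ρ t x ≤ 0 := by
  rw [stratified, if_neg (not_le.2 hx), sub_nonpos]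
  exact (h.mem_Icc ht x).1

lemma abs_sub_le (h : StratifiedSolution n L g rp rm ρ u p) {t : ℝ} (ht : 0 ≤ t)
    (x : Space n) : |stratified rp rm x - ρ t x| ≤ rp - rm := by
  obtain ⟨h1, h2⟩ := h.mem_Icc ht x
  have := h.light_lt
  rw [abs_le, stratified]
  split_ifs <;> constructor <;> linarith

/-- By the maximum principle `ρ₀ - ρ` is nonnegative above the interface and nonpositive below it.
The potential energy is therefore the first moment of `|ρ₀ - ρ|`. -/
lemma sub_mul_vert (h : StratifiedSolution n L g rp rm ρ u p) {t : ℝ} (ht : 0 ≤ t)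
    (x : Space n) :
    (stratified rp rm x - ρ t x) * vert x = |stratified rp rm x - ρ t x| * |vert x| := by
  rcases le_or_gt 0 (vert x) with hx | hx
  · rw [abs_of_nonneg hx, abs_of_nonneg (h.sub_nonneg_of_nonneg ht hx)]
  · rw [abs_of_neg hx, abs_of_nonpos (h.sub_nonpos_of_neg ht hx)]; ring

lemma sub_mul_oddStep (h : StratifiedSolution n L g rp rm ρ u p) {t : ℝ} (ht : 0 ≤ t) {R : ℝ}
    (hR : 0 ≤ R) (x : Space n) :
    (stratified rp rm x - ρ t x) * oddStep R (vert x) =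
      |stratified rp rm x - ρ t x| * |oddStep R (vert x)| := by
  rcases le_or_gt 0 (vert x) with hx | hx
  · rw [abs_of_nonneg (oddStep_nonneg hR hx), abs_of_nonneg (h.sub_nonneg_of_nonneg ht hx)]
  · rw [abs_of_nonpos (oddStep_nonpos hR hx.le), abs_of_nonpos (h.sub_nonpos_of_neg ht hx)]; ring

lemma integrable_sub_mul (h : StratifiedSolution n L g rp rm ρ u p) {t : ℝ} (ht : 0 ≤ t)
    {w : ℝ → ℝ} (hw : Continuous w) {R : ℝ} (hR : ∀ z, R ≤ |z| → w z = 0) :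
    Integrable (fun x => (stratified rp rm x - ρ t x) * w (vert x)) (normVol n L) := by
  obtain ⟨W, hW0, hW⟩ := exists_bound_of_continuous (n := n) (R := R) L (f := fun x => w (vert x))
    (by fun_prop) fun x hx => hR _ hx.le
  refine integrable_of_slab h.length_pos (B := (rp - rm) * W) (R := R) ?_ (fun x hx => ?_)
    fun x hx => by simp [hR _ hx.le]
  · exact ((measurable_stratified rp rm).aestronglyMeasurable.sub
      (h.aestronglyMeasurable_density ht)).mul (Continuous.aestronglyMeasurable (by fun_prop))
  · rw [abs_mul]
    exact mul_le_mul (h.abs_sub_le ht x) (hW x hx) (abs_nonneg _)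
      (sub_nonneg.2 h.light_lt.le)

lemma integrable_abs_sub_mul (h : StratifiedSolution n L g rp rm ρ u p) {t : ℝ} (ht : 0 ≤ t)
    {w : ℝ → ℝ} (hw : Continuous w) {R : ℝ} (hR : ∀ z, R ≤ |z| → w z = 0) :
    Integrable (fun x => |stratified rp rm x - ρ t x| * w (vert x)) (normVol n L) := by
  obtain ⟨W, hW0, hW⟩ := exists_bound_of_continuous (n := n) (R := R) L (f := fun x => w (vert x))
    (by fun_prop) fun x hx => hR _ hx.le
  refine integrable_of_slab h.length_pos (B := (rp - rm) * W) (R := R) ?_ (fun x hx => ?_)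
    fun x hx => by simp [hR _ hx.le]
  · exact (continuous_abs.comp_aestronglyMeasurable
      ((measurable_stratified rp rm).aestronglyMeasurable.sub
      (h.aestronglyMeasurable_density ht))).mul (Continuous.aestronglyMeasurable (by fun_prop))
  · rw [abs_mul, abs_abs]
    exact mul_le_mul (h.abs_sub_le ht x) (hW x hx) (abs_nonneg _)
      (sub_nonneg.2 h.light_lt.le)

/-- The initial potential energy without the normalizing constants. -/
def initialEnergy (L rp rm : ℝ) (ρ : ℝ → Space n → ℝ) : ℝ :=
  ∫ x, (stratified rp rm x - ρ 0 x) * vert x ∂(normVol n L)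

lemma integrable_initial (h : StratifiedSolution n L g rp rm ρ u p) :
    Integrable (fun x => (stratified rp rm x - ρ 0 x) * vert x) (normVol n L) := by
  have h1 := h.initial_potential.const_mul g⁻¹
  refine h1.congr (Eventually.of_forall fun x => ?_)
  have := h.gravity_pos.ne'
  simp only [potDensity]
  field_simp

lemma initialEnergy_nonneg (h : StratifiedSolution n L g rp rm ρ u p) :
    0 ≤ initialEnergy L rp rm ρ := by
  refine integral_nonneg fun x => ?_
  change 0 ≤ (stratified rp rm x - ρ 0 x) * vert x
  rw [h.sub_mul_vert le_rfl]
  positivity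

/-- The subtracted term does not depend on time, so balances of `-ρ` are also balances of `ρ₀ - ρ`.
-/
lemma integral_neg_mul_eq (h : StratifiedSolution n L g rp rm ρ u p) {w : ℝ → ℝ}
    (hwc : Continuous w) {R : ℝ} (hR : ∀ z, R ≤ |z| → w z = 0) {s : ℝ} (hs : 0 ≤ s) :
    ∫ x, -ρ s x * w (vert x) ∂(normVol n L) =
      ∫ x, (stratified rp rm x - ρ s x) * w (vert x) ∂(normVol n L) -
        ∫ x, stratified rp rm x * w (vert x) ∂(normVol n L) := by
  have i0 : Integrable (fun x : Space n => stratified rp rm x * w (vert x)) (normVol n L) := by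
    obtain ⟨W, hW0, hW⟩ := exists_bound_of_continuous (n := n) (R := R) L
      (f := fun x => w (vert x)) (by fun_prop) fun x hx => hR _ hx.le
    refine integrable_of_slab h.length_pos (B := rp * W) (R := R) ?_ (fun x hx => ?_)
      fun x hx => by simp [hR _ hx.le]
    · exact (measurable_stratified rp rm).aestronglyMeasurable.mul
        (Continuous.aestronglyMeasurable (by fun_prop))
    · rw [abs_mul]
      refine mul_le_mul ?_ (hW x hx) (abs_nonneg _) h.heavy_pos.le
      have := h.light_lt
      have := h.light_pos
      rw [stratified]
      split_ifs <;> rw [abs_of_pos (by linarith)]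
      linarith
  rw [← integral_sub (h.integrable_sub_mul hs hwc hR) i0]
  congr 1; ext x; ring

/-- The linear balance, relative to the stratified profile. -/
lemma integral_sub_mul_le (h : StratifiedSolution n L g rp rm ρ u p) {w : ℝ → ℝ}
    (hw : ContDiff ℝ 2 w) {R : ℝ} (hR : ∀ z, R ≤ |z| → w z = 0) {t : ℝ} (ht : 0 < t) {B : ℝ}
    (hB : ∀ τ ∈ Set.Ioc 0 t, |∫ x, ρ τ x * (vert (u τ x) * deriv w (vert x) +
      deriv (deriv w) (vert x)) ∂(normVol n L)| ≤ B) :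
    ∫ x, (stratified rp rm x - ρ t x) * w (vert x) ∂(normVol n L) ≤
      ∫ x, (stratified rp rm x - ρ 0 x) * w (vert x) ∂(normVol n L) + B * t := by
  have hwc := hw.continuous
  have h1 := h.toIsClassicalSolution.integral_density_le h.length_pos (φ := fun r => -r)
    contDiff_neg hw hR (C₀ := rp) (fun x => h.abs_density_le le_rfl x) ht (B := B) (by
      intro τ hτ
      have e1 : deriv (deriv fun r : ℝ => -r) = fun _ => 0 := by
        have : (deriv fun r : ℝ => -r) = fun _ => -1 := funext fun r => deriv_neg r
        rw [this]; simp
      simp only [e1, zero_mul, integral_zero, sub_zero, neg_mul, integral_neg]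
      exact (neg_le_abs _).trans (hB τ hτ))
  rw [h.integral_neg_mul_eq hwc hR ht.le, h.integral_neg_mul_eq hwc hR le_rfl] at h1
  linarith

/-- The mixing volume stays finite, locally uniformly in time. -/
theorem exists_mixVolume_bound (h : StratifiedSolution n L g rp rm ρ u p) (T : ℝ) :
    ∃ D : ℝ, ∀ N, 0 < N → ∀ t ∈ Set.Ioc 0 T, mixVolume L rp rm N (ρ t) ≤ D := by
  have hL := h.length_pos
  obtain ⟨R₀, hR₀⟩ := h.velocity_vanishes T 1 one_pos
  set R := max R₀ 1
  have hR1 : 1 ≤ R := le_max_right _ _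
  have hR0 : 0 ≤ R := zero_le_one.trans hR1
  obtain ⟨K₁, hK₁0, hK₁⟩ := exists_deriv_oddStep_bound hR0
  set K := cutoffConst
  have hK1 : 1 ≤ K := one_le_cutoffConst
  have hK0 : 0 ≤ K := zero_le_one.trans hK1
  have hrp := h.heavy_pos
  -- The two terms bound the flux near the interface, `|z| ≤ R + 1`, where the derivatives of the
  -- step act, and further out, where only those of the cutoff act. The final `4` is the slab height
  -- `4M` divided by the `M` from the cutoff.
  set B := rp * (2 * K₁) * (2 * (R + 1)) + rp * (2 * K) * 4
  have hB0 : 0 ≤ B := by positivity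
  refine ⟨(rp - rm) * (2 * (R + 1)) + (initialEnergy L rp rm ρ + B * T), fun N hN t ht => ?_⟩
  set M := max (2 * N) (R + 2)
  have hNM : 2 * N ≤ M := le_max_left _ _
  have hRM : R + 2 ≤ M := le_max_right _ _
  have hM0 : 0 < M := by linarith
  have hM1 : 1 ≤ M := by linarith
  set w : ℝ → ℝ := fun z => oddStep R z * cutoff M z with hw_def
  have hw : ContDiff ℝ 2 w := (contDiff_oddStep (k := 2) R).mul (contDiff_cutoff (k := 2) M)
  have hwR : ∀ z, 2 * M ≤ |z| → w z = 0 := fun z hz => by simp [w, cutoff_eq_zero hM0 hz]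
  have hws : ∀ s, 0 ≤ s → ∀ x, (stratified rp rm x - ρ s x) * w (vert x) =
      |stratified rp rm x - ρ s x| * (|oddStep R (vert x)| * cutoff M (vert x)) := by
    intro s hs x
    rw [hw_def, ← mul_assoc, ← mul_assoc, h.sub_mul_oddStep hs hR0]
  have hrate : ∀ τ ∈ Set.Ioc 0 t, |∫ x, ρ τ x * (vert (u τ x) * deriv w (vert x) +
      deriv (deriv w) (vert x)) ∂(normVol n L)| ≤ B := by
    intro τ hτ
    have hu : ∀ x, R ≤ |vert x| → |vert (u τ x)| ≤ 1 := fun x hx =>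
      (PiLp.norm_apply_le (u τ x) (Fin.last n)).trans
        (hR₀ τ ⟨hτ.1, hτ.2.trans ht.2⟩ x ((le_max_left _ _).trans hx))
    have hρ := fun x => h.abs_density_le hτ.1.le x
    have d1 : deriv w = fun z => deriv (oddStep R) z * cutoff M z +
        oddStep R z * deriv (cutoff M) z := deriv_mul_cutoff (contDiff_oddStep (k := 2) R) M
    have d2 : deriv (deriv w) = fun z => deriv (deriv (oddStep R)) z * cutoff M z +
        2 * deriv (oddStep R) z * deriv (cutoff M) z + oddStep R z * deriv (deriv (cutoff M)) z :=
      deriv_deriv_mul_cutoff (contDiff_oddStep (k := 2) R) M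
    have c1 := (contDiff_deriv hw).continuous
    have c2 := (contDiff_deriv hw).continuous_deriv_one
    have c3 := h.continuous_density hτ.1
    have c4 := (h.toIsClassicalSolution.contDiff_velocity_space hτ.1).continuous
    have z1 : ∀ z, 2 * M ≤ |z| → deriv w z = 0 := fun z hz => by
      simp [d1, cutoff_eq_zero hM0 hz, deriv_cutoff_eq_zero hM0 hz]
    have z2 : ∀ z, 2 * M ≤ |z| → deriv (deriv w) z = 0 := fun z hz => by
      simp [d2, cutoff_eq_zero hM0 hz, deriv_cutoff_eq_zero hM0 hz,
        deriv_deriv_cutoff_eq_zero hM0 hz]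
    have hsupp : ∀ x, 2 * M < |vert x| → ρ τ x * (vert (u τ x) * deriv w (vert x) +
        deriv (deriv w) (vert x)) = 0 := fun x hx => by simp [z1 _ hx.le, z2 _ hx.le]
    refine (abs_integral_le_of_two_slabs hL (R₁ := R + 1) (R₂ := 2 * M) (B₁ := rp * (2 * K₁))
      (B₂ := rp * (2 * K / M)) (integrable_of_continuous hL (by fun_prop) hsupp) (by linarith)
      (by linarith) (by positivity) (by positivity) (fun x hx => ?_) (fun x hx => ?_)
      hsupp).trans_eq ?_
    · have hxM : |vert x| < M := by linarith
      rw [abs_mul]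
      refine mul_le_mul (hρ x) ?_ (abs_nonneg _) hrp.le
      have e1 : deriv w (vert x) = deriv (oddStep R) (vert x) := by
        simp [d1, deriv_cutoff_of_lt hxM, cutoff_eq_one hM0 hxM.le]
      have e2 : deriv (deriv w) (vert x) = deriv (deriv (oddStep R)) (vert x) := by
        simp [d2, deriv_cutoff_of_lt hxM, cutoff_eq_one hM0 hxM.le, deriv_deriv_cutoff_of_lt hxM]
      rw [e1, e2, two_mul]
      refine (abs_add_le _ _).trans (add_le_add ?_ (hK₁ _).2)
      rcases lt_or_ge |vert x| R with hxR | hxR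
      · rw [deriv_oddStep_eq_zero hR0 (Or.inl hxR)]
        simpa using hK₁0
      · rw [abs_mul]
        calc _ ≤ 1 * K₁ := mul_le_mul (hu x hxR) (hK₁ _).1 (abs_nonneg _) zero_le_one
          _ = K₁ := one_mul _
    · rw [abs_mul]
      refine mul_le_mul (hρ x) ?_ (abs_nonneg _) hrp.le
      have s1 : deriv (oddStep R) (vert x) = 0 := deriv_oddStep_eq_zero hR0 (Or.inr hx)
      have s2 : deriv (deriv (oddStep R)) (vert x) = 0 :=
        deriv_deriv_oddStep_eq_zero hR0 (Or.inr hx)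
      have e1 : deriv w (vert x) = oddStep R (vert x) * deriv (cutoff M) (vert x) := by
        simp [d1, s1]
      have e2 : deriv (deriv w) (vert x) =
          oddStep R (vert x) * deriv (deriv (cutoff M)) (vert x) := by
        simp [d2, s1, s2]
      rw [e1, e2]
      have hKM : K / M ^ 2 ≤ K / M := by
        refine div_le_div_of_nonneg_left hK0 hM0 ?_
        nlinarith
      have hs := abs_oddStep_le_one R (vert x)
      calc _ ≤ |vert (u τ x) * (oddStep R (vert x) * deriv (cutoff M) (vert x))| +
            |oddStep R (vert x) * deriv (deriv (cutoff M)) (vert x)| := abs_add_le _ _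
        _ ≤ 1 * (1 * (K / M)) + 1 * (K / M) := by
            simp only [abs_mul]
            gcongr
            · exact hu x (by linarith)
            · exact abs_deriv_cutoff_le hM0 _
            · exact (abs_deriv_deriv_cutoff_le hM0 _).trans hKM
        _ = 2 * K / M := by ring
    · simp only [B]
      field_simp
      ring
  have hb := h.integral_sub_mul_le hw hwR ht.1 hrate
  -- The weight vanishes for `|z| ≤ R` and is at most `1` beyond, so it is dominated by `|z|`
  -- because `R ≥ 1`; the initial potential energy thus bounds the initial value.
  have h0 : ∫ x, (stratified rp rm x - ρ 0 x) * w (vert x) ∂(normVol n L) ≤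
      initialEnergy L rp rm ρ := by
    refine integral_mono (h.integrable_sub_mul le_rfl hw.continuous hwR) h.integrable_initial
      fun x => ?_
    change (stratified rp rm x - ρ 0 x) * w (vert x) ≤ (stratified rp rm x - ρ 0 x) * vert x
    rw [hws 0 le_rfl, h.sub_mul_vert le_rfl]
    refine mul_le_mul_of_nonneg_left ?_ (abs_nonneg _)
    rcases le_or_gt |vert x| R with hx | hx
    · rw [oddStep_of_le hx]; simp
    · calc |oddStep R (vert x)| * cutoff M (vert x) ≤ 1 * 1 :=
          mul_le_mul (abs_oddStep_le_one _ _) (cutoff_le_one _ _) (cutoff_nonneg _ _) zero_le_one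
        _ ≤ |vert x| := by linarith
  have hBT : B * t ≤ B * T := mul_le_mul_of_nonneg_left ht.2 hB0
  have hm : MeasurableSet {x : Space n | |vert x| ≤ R + 1} :=
    measurableSet_le (by fun_prop) (by fun_prop)
  -- Inside `|z| ≤ R + 1` the trivial bound `rp - rm` suffices; outside, the weighted integral takes
  -- over.
  have hsplit : mixVolume L rp rm N (ρ t) ≤
      ∫ x, ({x : Space n | |vert x| ≤ R + 1}.indicator (fun _ => rp - rm) x +
        (stratified rp rm x - ρ t x) * w (vert x)) ∂(normVol n L) := by
    have i1 : Integrable ({x : Space n | |vert x| ≤ R + 1}.indicator fun _ => rp - rm)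
        (normVol n L) := by
      refine (integrable_indicator_iff hm).2 (integrableOn_const ?_ )
      rw [normVol_slab hL]; exact ENNReal.ofReal_ne_top
    refine integral_mono (h.integrable_abs_sub_mul ht.1.le (continuous_cutoff N) (R := 2 * N)
      fun z hz => cutoff_eq_zero hN hz)
      (i1.add (h.integrable_sub_mul ht.1.le hw.continuous hwR)) fun x => ?_
    dsimp only
    rw [hws t ht.1.le]
    by_cases hx : |vert x| ≤ R + 1
    · have h1 : 0 ≤ |stratified rp rm x - ρ t x| * (|oddStep R (vert x)| * cutoff M (vert x)) :=
        mul_nonneg (abs_nonneg _) (mul_nonneg (abs_nonneg _) (cutoff_nonneg _ _))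
      rw [Set.indicator_of_mem (show x ∈ {x : Space n | |vert x| ≤ R + 1} from hx)]
      have h2 : |stratified rp rm x - ρ t x| * cutoff N (vert x) ≤ (rp - rm) * 1 :=
        mul_le_mul (h.abs_sub_le ht.1.le x) (cutoff_le_one _ _) (cutoff_nonneg _ _)
          (sub_nonneg.2 h.light_lt.le)
      linarith
    · rw [Set.indicator_of_notMem (show x ∉ {x : Space n | |vert x| ≤ R + 1} from hx), zero_add]
      have hs : |oddStep R (vert x)| = 1 := by
        rcases lt_abs.1 (not_le.1 hx) with hx | hx
        · rw [oddStep_of_ge hR0 hx.le, abs_one]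
        · rw [oddStep_of_le_neg hR0 (by linarith), abs_neg, abs_one]
      rw [hs, one_mul]
      exact mul_le_mul_of_nonneg_left (cutoff_le_cutoff hN hNM _) (abs_nonneg _)
  have hind : ∫ x, {x : Space n | |vert x| ≤ R + 1}.indicator (fun _ => rp - rm) x ∂(normVol n L)
      = (rp - rm) * (2 * (R + 1)) := by
    rw [integral_indicator hm, setIntegral_const, Measure.real, normVol_slab hL,
      ENNReal.toReal_ofReal (by positivity), smul_eq_mul, mul_comm]
  rw [integral_add ((integrable_indicator_iff hm).2 (integrableOn_const (by
    rw [normVol_slab hL]; exact ENNReal.ofReal_ne_top)))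
    (h.integrable_sub_mul ht.1.le hw.continuous hwR), hind] at hsplit
  linarith

/-- Concave functions of the density control the dissipation. -/
theorem exists_dissipation_bound (h : StratifiedSolution n L g rp rm ρ u p) (T : ℝ) {M : ℝ}
    (hM : 0 ≤ M) : ∃ N₀ : ℝ, 1 ≤ N₀ ∧ ∀ N, N₀ ≤ N → ∀ φ : ℝ → ℝ, ContDiff ℝ 2 φ →
      (∀ r ∈ Set.Icc rm rp, 0 ≤ φ r ∧ φ r ≤ M) → ∀ s t, 0 < s → s ≤ t → t ≤ T →
      ∫ τ in s..t, ∫ x, -deriv (deriv φ) (ρ τ x) * ‖gradient (ρ τ) x‖ ^ 2 * cutoff N (vert x)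
        ∂(normVol n L) ≤ ∫ x, φ (ρ t x) * cutoff N (vert x) ∂(normVol n L) + 1 := by
  have hL := h.length_pos
  have hK0 := cutoffConst_pos
  -- `A` and `ε` are chosen so that the flux through the edge over the whole time interval is at
  -- most `2 A ε ≤ 1`, which is the `1` in the conclusion.
  set A := 4 * M * cutoffConst * |T| with hA
  have hA0 : 0 ≤ A := by positivity
  set ε := 1 / (2 * (A + 1)) with hε
  have hε0 : 0 < ε := by positivity
  obtain ⟨R, hR⟩ := h.velocity_vanishes T ε hε0
  -- The height `N₀` is fixed before `φ` and depends on it only through the bound `M`. This later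
  -- permits an entropy that varies with `N`.
  refine ⟨max 1 (max R (1 / ε)), le_max_left _ _, fun N hN φ hφ hφM s t hs hst htT => ?_⟩
  have hN0 : 0 < N := one_pos.trans_le ((le_max_left _ _).trans hN)
  have hRN : R ≤ N := ((le_max_left _ _).trans (le_max_right _ _)).trans hN
  have hεN : 1 / N ≤ ε := by
    have : 1 / ε ≤ N := ((le_max_right _ _).trans (le_max_right _ _)).trans hN
    rw [div_le_iff₀ hN0]
    rw [div_le_iff₀ hε0] at this
    linarith
  have hsub : Set.uIcc s t ⊆ Set.Ioi 0 := fun τ hτ => by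
    rw [Set.uIcc_of_le hst] at hτ
    exact hs.trans_le hτ.1
  have hz : ∀ z, 2 * N ≤ |z| → cutoff N z = 0 := fun z hz => cutoff_eq_zero hN0 hz
  have c1 := (h.toIsClassicalSolution.continuousOn_flux hφ.continuous
    (contDiff_cutoff (k := 2) N) hz (L := L)).mono hsub
  have c2 := (h.toIsClassicalSolution.continuousOn_dissipation
    (contDiff_deriv hφ).continuous_deriv_one (continuous_cutoff N) hz (L := L)).mono hsub
  have hb := h.toIsClassicalSolution.integral_density_sub hL hφ (contDiff_cutoff (k := 2) N) hz
    hs hst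
  rw [intervalIntegral.integral_sub (c1.intervalIntegrable (μ := volume))
    (c2.intervalIntegrable (μ := volume))] at hb
  have h1 := intervalIntegral.norm_integral_le_of_norm_le_const (a := s) (b := t)
    (f := fun τ => ∫ x, φ (ρ τ x) * (vert (u τ x) * deriv (cutoff N) (vert x) +
      deriv (deriv (cutoff N)) (vert x)) ∂(normVol n L))
    (C := 4 * M * cutoffConst * (ε + 1 / N)) (by
      intro τ hτ
      rw [Set.uIoc_of_le hst] at hτ
      have hτ0 : 0 < τ := hs.trans hτ.1
      refine abs_integral_flux_cutoff_le hL
        (fun N hN z => ⟨abs_deriv_cutoff_le hN z, abs_deriv_deriv_cutoff_le hN z⟩) hN0 hε0.le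
        (fun x => ?_) fun x hx => hR τ ⟨hτ0, hτ.2.trans htT⟩ x (hRN.trans hx)
      obtain ⟨h1, h2⟩ := hφM _ (h.mem_Icc hτ0.le x)
      rwa [abs_of_nonneg h1])
  have h2 : 4 * M * cutoffConst * (ε + 1 / N) * |t - s| ≤ 1 := by
    have hts : |t - s| ≤ |T| := by
      rw [abs_of_nonneg (sub_nonneg.2 hst)]
      exact (by linarith : t - s ≤ T).trans (le_abs_self T)
    calc 4 * M * cutoffConst * (ε + 1 / N) * |t - s|
        ≤ 4 * M * cutoffConst * (ε + ε) * |T| := by gcongr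
      _ = A * (ε + ε) := by rw [hA]; ring
      _ ≤ (A + 1) * (ε + ε) := by gcongr; linarith
      _ = 1 := by rw [hε]; field_simp; ring
  have h3 : 0 ≤ ∫ x, φ (ρ s x) * cutoff N (vert x) ∂(normVol n L) := integral_nonneg fun x =>
    mul_nonneg (hφM _ (h.mem_Icc hs.le x)).1 (cutoff_nonneg _ _)
  simp only [neg_mul, integral_neg, intervalIntegral.integral_neg]
  rw [Real.norm_eq_abs] at h1
  have h4 := (neg_le_abs _).trans (h1.trans h2)
  linarith

/-- The mixing volume controls the dissipation. -/
theorem exists_integral_dissipation_le (h : StratifiedSolution n L g rp rm ρ u p) (T : ℝ) :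
    ∃ N₀ : ℝ, 1 ≤ N₀ ∧ ∀ N, N₀ ≤ N → ∀ s t, 0 < s → s ≤ t → t ≤ T →
      ∫ τ in s..t, dissipation L N (ρ τ) ≤ (rp - rm) * mixVolume L rp rm N (ρ t) + 1 := by
  have hlt := sub_pos.2 h.light_lt
  obtain ⟨N₀, hN₀, hN⟩ := h.exists_dissipation_bound T (M := (rp - rm) ^ 2) (by positivity)
  refine ⟨N₀, hN₀, fun N hNN s t hs hst htT => ?_⟩
  have hN0 : 0 < N := by linarith
  -- The quadratic `(rp - r)(r - rm)` has second derivative `-2` and is at most `(rp - rm) |ρ₀ -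
  -- r|`. The resulting factor `2` in front of the dissipation is dropped at the end.
  have hb := hN N hNN (fun r => (rp - r) * (r - rm)) (by fun_prop) (fun r hr => by
    constructor
    · exact mul_nonneg (sub_nonneg.2 hr.2) (sub_nonneg.2 hr.1)
    · nlinarith [hr.1, hr.2]) s t hs hst htT
  have d2 : deriv (deriv fun r => (rp - r) * (r - rm)) = fun _ => -2 := by
    have d1 : (deriv fun r => (rp - r) * (r - rm)) = fun r => -2 * r + (rp + rm) := by
      ext r
      rw [deriv_fun_mul (by fun_prop) (by fun_prop)]
      simp
      ring
    rw [d1]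
    ext r
    simp
  have ht := hs.trans_le hst
  have c := h.continuous_density ht
  have h1 : ∫ x, (rp - ρ t x) * (ρ t x - rm) * cutoff N (vert x) ∂(normVol n L) ≤
      (rp - rm) * mixVolume L rp rm N (ρ t) := by
    rw [mixVolume, ← integral_const_mul]
    refine integral_mono (integrable_of_continuous h.length_pos (R := 2 * N) (by fun_prop)
      fun x hx => by simp [cutoff_eq_zero hN0 hx.le])
      ((h.integrable_abs_sub_mul ht.le (continuous_cutoff N) (R := 2 * N)
      fun z hz => cutoff_eq_zero hN0 hz).const_mul _) fun x => ?_
    dsimp only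
    rw [← mul_assoc]
    refine mul_le_mul_of_nonneg_right ?_ (cutoff_nonneg _ _)
    obtain ⟨h1, h2⟩ := h.mem_Icc ht.le x
    rw [stratified]
    split_ifs
    · rw [abs_of_nonneg (by linarith)]; nlinarith
    · rw [abs_of_nonpos (by linarith)]; nlinarith
  have h2 : ∫ τ in s..t, ∫ x, - -2 * ‖gradient (ρ τ) x‖ ^ 2 * cutoff N (vert x) ∂(normVol n L) =
      2 * ∫ τ in s..t, dissipation L N (ρ τ) := by
    rw [← intervalIntegral.integral_const_mul]
    refine intervalIntegral.integral_congr fun τ _ => ?_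
    simp only [dissipation, neg_neg, mul_assoc, integral_const_mul]
  simp only [d2, h2] at hb
  have h3 : 0 ≤ ∫ τ in s..t, dissipation L N (ρ τ) :=
    intervalIntegral.integral_nonneg hst fun τ _ => dissipation_nonneg _ _
  linarith

end StratifiedSolution

/-! ### Fluxes of an incompressible field which vanishes at infinity -/

lemma abs_vert_le (x : Space n) : |vert x| ≤ ‖x‖ := PiLp.norm_apply_le x (Fin.last n)

/-- The vertical velocity has mean zero on horizontal slices. -/
theorem integral_vertical_velocity_eq_zero (hL : 0 < L) {U : Space n → Space n}
    (hU : ContDiff ℝ 1 U) (hUp : TransversePeriodic L U) (hdiv : ∀ x, divergence U x = 0)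
    (hU0 : ∀ ε > 0, ∃ R : ℝ, ∀ x, R ≤ |vert x| → ‖U x‖ ≤ ε) {c : ℝ → ℝ} (hc : Continuous c)
    {R : ℝ} (hR : ∀ z, R ≤ |z| → c z = 0) :
    ∫ x, vert (U x) * c (vert x) ∂(normVol n L) = 0 := by
  -- With `P` a primitive of `c`, testing the divergence-free field against `P χ_N` produces `∫ u_z
  -- c` and an edge term `∫ u_z P χ_N'`. The latter tends to zero because `P` is bounded and the
  -- velocity vanishes at infinity.
  set P : ℝ → ℝ := fun z => ∫ y in (0 : ℝ)..z, c y with hP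
  have hPd : ∀ z, HasDerivAt P (c z) z := fun z =>
    intervalIntegral.integral_hasDerivAt_right (hc.intervalIntegrable _ _)
      hc.aestronglyMeasurable.stronglyMeasurableAtFilter hc.continuousAt
  have hPder : deriv P = c := funext fun z => (hPd z).deriv
  have hPc : ContDiff ℝ 1 P := by
    rw [contDiff_one_iff_deriv, hPder]
    exact ⟨fun z => (hPd z).differentiableAt, hc⟩
  have hcs : HasCompactSupport c := by
    refine HasCompactSupport.intro (isCompact_Icc (a := -|R|) (b := |R|)) fun z hz => hR z ?_
    by_contra h
    exact hz (abs_le.1 ((not_le.1 h).le.trans (le_abs_self R)))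
  have hci : Integrable c := hc.integrable_of_hasCompactSupport hcs
  set B := ∫ y, ‖c y‖
  have hB0 : 0 ≤ B := integral_nonneg fun _ => norm_nonneg _
  have hPB : ∀ z, |P z| ≤ B := fun z =>
    (intervalIntegral.norm_integral_le_integral_norm_uIoc).trans
      (setIntegral_le_integral hci.norm (Eventually.of_forall fun _ => norm_nonneg _))
  have hK := cutoffConst_pos
  have cU := hU.continuous
  refine abs_eq_zero.1 (le_antisymm (le_of_forall_pos_le_add fun δ hδ => ?_) (abs_nonneg _))
  rw [zero_add]
  set ε := δ / (4 * B * cutoffConst + 1) with hε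
  have hε0 : 0 < ε := by positivity
  obtain ⟨R', hR'⟩ := hU0 ε hε0
  set N := max 1 (max R R')
  have hN0 : 0 < N := one_pos.trans_le (le_max_left _ _)
  have hNR : R ≤ N := (le_max_left _ _).trans (le_max_right _ _)
  have hNR' : R' ≤ N := (le_max_right _ _).trans (le_max_right _ _)
  have hw : ContDiff ℝ 1 fun z => P z * cutoff N z := hPc.mul (contDiff_cutoff (k := 1) N)
  have h0 := integral_divergence_mul_weight hL (a := fun _ => (1 : ℝ)) contDiff_const
    (fun i x => rfl) hU hUp hw (R := 2 * N) fun z hz => by simp [cutoff_eq_zero hN0 hz]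
  have hd : ∀ z, deriv (fun z => P z * cutoff N z) z = c z + P z * deriv (cutoff N) z := by
    intro z
    rw [deriv_fun_mul (hPd z).differentiableAt
      ((contDiff_cutoff (k := 1) N).differentiable one_ne_zero z), hPder]
    congr 1
    rcases le_or_gt |z| N with hz | hz
    · rw [cutoff_eq_one hN0 hz, mul_one]
    · rw [hR z (hNR.trans hz.le), zero_mul]
  have cχ := (contDiff_deriv (contDiff_cutoff (k := 2) N)).continuous
  have cP := hPc.continuous
  simp only [hd, hdiv, fderiv_fun_const, one_mul, mul_add, Pi.zero_apply,
    zero_apply, add_zero, zero_mul, integral_zero] at h0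
  rw [integral_add (integrable_of_continuous hL (R := R) (by fun_prop)
      fun x hx => by simp [hR _ hx.le])
    (integrable_of_continuous hL (R := 2 * N) (by fun_prop)
      fun x hx => by simp [deriv_cutoff_eq_zero hN0 hx.le])] at h0
  rw [show ∫ x, vert (U x) * c (vert x) ∂(normVol n L) =
    -∫ x, vert (U x) * (P (vert x) * deriv (cutoff N) (vert x)) ∂(normVol n L) by linarith, abs_neg]
  refine (abs_integral_le_of_slab hL (B := ε * (B * (cutoffConst / N))) (R := 2 * N) (by positivity)
    (fun x _ => ?_) fun x hx => by simp [deriv_cutoff_eq_zero hN0 hx.le]).trans ?_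
  · rcases lt_or_ge |vert x| N with hx | hx
    · rw [deriv_cutoff_of_lt hx]; simp; positivity
    · rw [abs_mul, abs_mul]
      gcongr
      · exact (abs_vert_le _).trans (hR' x (hNR'.trans hx))
      · exact hPB _
      · exact abs_deriv_cutoff_le hN0 _
  · calc ε * (B * (cutoffConst / N)) * (2 * (2 * N)) = ε * (4 * B * cutoffConst) := by
          field_simp; ring
      _ ≤ ε * (4 * B * cutoffConst + 1) := by gcongr; linarith
      _ = δ := by rw [hε]; field_simp

/-- The vertical flux of `r` is controlled by the energy of the field and the gradient of `r`. -/
theorem abs_integral_flux_le (hL : 0 < L) {U : Space n → Space n}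
    (hU : ContDiff ℝ 1 U) (hUp : TransversePeriodic L U) (hdiv : ∀ x, divergence U x = 0)
    (hU0 : ∀ ε > 0, ∃ R : ℝ, ∀ x, R ≤ |vert x| → ‖U x‖ ≤ ε) {r : Space n → ℝ}
    (hr : ContDiff ℝ 1 r) (hrp : TransversePeriodic L r) {c : ℝ → ℝ} (hc : Continuous c)
    {κ N : ℝ} (hκ : 0 ≤ κ) (hN : 0 < N) (hcκ : ∀ z, |c z| ≤ κ * cutoff N z) {l : ℝ} (hl : 0 < l) :
    |∫ x, r x * vert (U x) * c (vert x) ∂(normVol n L)| ≤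
      κ / 2 * (l * ∫ x, ‖U x‖ ^ 2 * cutoff N (vert x) ∂(normVol n L) +
        n * L ^ 2 / l * dissipation L N r) := by
  have hc0 : ∀ z, 2 * N ≤ |z| → c z = 0 := fun z hz => by
    have := hcκ z
    rw [cutoff_eq_zero hN hz, mul_zero] at this
    exact abs_nonpos_iff.1 this
  have cA := continuous_sliceAverage (L := L) hr.continuous
  have cU := hU.continuous
  have cr := hr.continuous
  set A := sliceAverage L r
  -- The slice average depends on `z` alone and may be subtracted from `r` without changing the
  -- flux. Young's inequality with parameter `l` and Poincaré's inequality for the deviation then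
  -- finish the estimate.
  have h0 := integral_vertical_velocity_eq_zero hL hU hUp hdiv hU0 (c := fun z => A z * c z)
    (by fun_prop) (R := 2 * N) fun z hz => by simp [hc0 z hz]
  have i1 : Integrable (fun x => r x * vert (U x) * c (vert x)) (normVol n L) :=
    integrable_of_continuous hL (R := 2 * N) (by fun_prop) fun x hx => by simp [hc0 _ hx.le]
  have i2 : Integrable (fun x => vert (U x) * (A (vert x) * c (vert x))) (normVol n L) :=
    integrable_of_continuous hL (R := 2 * N) (by fun_prop) fun x hx => by simp [hc0 _ hx.le]
  have i3 : Integrable (fun x => ‖U x‖ ^ 2 * cutoff N (vert x)) (normVol n L) :=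
    integrable_of_continuous hL (R := 2 * N) (by fun_prop)
      fun x hx => by simp [cutoff_eq_zero hN hx.le]
  have i4 : Integrable (fun x => (r x - A (vert x)) ^ 2 * cutoff N (vert x)) (normVol n L) :=
    integrable_of_continuous hL (R := 2 * N) (by fun_prop)
      fun x hx => by simp [cutoff_eq_zero hN hx.le]
  have h1 : ∫ x, r x * vert (U x) * c (vert x) ∂(normVol n L) =
      ∫ x, (r x - A (vert x)) * vert (U x) * c (vert x) ∂(normVol n L) := by
    rw [← sub_zero (∫ x, r x * vert (U x) * c (vert x) ∂(normVol n L)), ← h0, ← integral_sub i1 i2]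
    congr 1; ext x; ring
  rw [h1]
  calc |∫ x, (r x - A (vert x)) * vert (U x) * c (vert x) ∂(normVol n L)|
      ≤ ∫ x, (κ / 2 * l * (‖U x‖ ^ 2 * cutoff N (vert x)) +
          κ / 2 / l * ((r x - A (vert x)) ^ 2 * cutoff N (vert x))) ∂(normVol n L) := by
        rw [← Real.norm_eq_abs]
        refine norm_integral_le_of_norm_le ((i3.const_mul _).add (i4.const_mul _))
          (Eventually.of_forall fun x => ?_)
        rw [norm_mul, norm_mul, Real.norm_eq_abs, Real.norm_eq_abs, Real.norm_eq_abs]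
        set a := |r x - A (vert x)| with ha
        have ha2 : (r x - A (vert x)) ^ 2 = a ^ 2 := (sq_abs _).symm
        have hχ := cutoff_nonneg N (vert x)
        rw [ha2]
        have hab : a * |vert (U x)| ≤ (l * ‖U x‖ ^ 2 + a ^ 2 / l) / 2 := by
          have h2 : a * |vert (U x)| ≤ a * ‖U x‖ := by gcongr; exact abs_vert_le _
          have h3 : 0 ≤ (l * ‖U x‖ - a) ^ 2 / l := by positivity
          have h4 : (l * ‖U x‖ - a) ^ 2 / l = l * ‖U x‖ ^ 2 - 2 * (a * ‖U x‖) + a ^ 2 / l := by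
            field_simp; ring
          linarith
        calc a * |vert (U x)| * |c (vert x)|
            ≤ ((l * ‖U x‖ ^ 2 + a ^ 2 / l) / 2) * (κ * cutoff N (vert x)) := by
              gcongr
              exact hcκ _
          _ = _ := by field_simp
    _ = κ / 2 * (l * ∫ x, ‖U x‖ ^ 2 * cutoff N (vert x) ∂(normVol n L) +
        1 / l * ∫ x, (r x - A (vert x)) ^ 2 * cutoff N (vert x) ∂(normVol n L)) := by
        rw [integral_add (i3.const_mul _) (i4.const_mul _), integral_const_mul, integral_const_mul]
        field_simp
    _ ≤ _ := by
        have hp := integral_sq_sub_sliceAverage_le hL hr hrp (continuous_cutoff N)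
          (cutoff_nonneg N) (R := 2 * N) fun z hz => cutoff_eq_zero hN hz.le
        have hp' := mul_le_mul_of_nonneg_left hp (one_div_pos.2 hl).le
        refine mul_le_mul_of_nonneg_left (add_le_add le_rfl (hp'.trans_eq ?_)) (by positivity)
        rw [dissipation]; ring

/-- A function with bounded transverse gradient varies little along a slice. -/
lemma abs_sub_slice_le {q : Space n → ℝ} (hq : ContDiff ℝ 1 q) {C : ℝ} {x : Space n}
    (hx : x ∈ strip n L)
    (hC : ∀ y, vert y = vert x → ∀ i : Fin n, |gradient q y i.castSucc| ≤ C) :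
    |q x - q (vert x • ez n)| ≤ n * (C * L) := by
  have hd : ∀ s : ℝ, HasDerivAt (fun s : ℝ => q (vert x • ez n + s • transverse x))
      (fderiv ℝ q (vert x • ez n + s • transverse x) (transverse x)) s := by
    intro s
    have h1 : HasDerivAt (fun s : ℝ => vert x • ez n + s • transverse x) (transverse x) s := by
      simpa using ((hasDerivAt_id s).smul_const (transverse x)).const_add (vert x • ez n)
    exact ((hq.differentiable one_ne_zero _).hasFDerivAt).comp_hasDerivAt s h1
  have hb := norm_image_sub_le_of_norm_deriv_le_segment_01' (C := n * (C * L))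
    (f := fun s : ℝ => q (vert x • ez n + s • transverse x)) (fun s _ => (hd s).hasDerivWithinAt) (by
      intro s _
      rw [fderiv_apply_eq_sum, Fin.sum_univ_castSucc, transverse_last, zero_smul, add_zero]
      refine (norm_sum_le (E := ℝ) _ _).trans ?_
      calc _ ≤ ∑ _i : Fin n, C * L := by
            refine Finset.sum_le_sum fun i _ => ?_
            rw [smul_eq_mul, norm_mul, ← gradient_apply, transverse_castSucc, mul_comm]
            have h1 := hC (vert x • ez n + s • transverse x) (by simp) i
            refine mul_le_mul h1 ?_ (norm_nonneg _) ((abs_nonneg _).trans h1)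
            rw [Real.norm_eq_abs, abs_of_nonneg (hx i).1]
            exact (hx i).2
        _ = n * (C * L) := by simp)
  simp only [one_smul, zero_smul, add_zero] at hb
  rwa [add_comm, transverse_add_vert] at hb

/-- The truncated kinetic energy. -/
def kinetic (L N : ℝ) (r : Space n → ℝ) (U : Space n → Space n) : ℝ :=
  ∫ x, r x * (‖U x‖ ^ 2 / 2) * cutoff N (vert x) ∂(normVol n L)

namespace IsClassicalSolution
variable {g : ℝ} {ρ : ℝ → Space n → ℝ} {u : ℝ → Space n → Space n} {p : ℝ → Space n → ℝ}

lemma velocity_tendsto (h : IsClassicalSolution n L g ρ u p) {t : ℝ} (ht : 0 < t) :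
    ∀ ε > 0, ∃ R : ℝ, ∀ x, R ≤ |vert x| → ‖u t x‖ ≤ ε := fun ε hε => by
  obtain ⟨R, hR⟩ := h.velocity_vanishes t ε hε
  exact ⟨R, fun x hx => hR t ⟨ht, le_rfl⟩ x hx⟩

/-- The rate of change of the truncated kinetic energy. -/
def kineticRate (L g N : ℝ) (ρ : Space n → ℝ) (u : Space n → Space n) (p : Space n → ℝ) : ℝ :=
  -∫ x, ‖u x‖ ^ 2 / 2 * vert (gradient ρ x) * deriv (cutoff N) (vert x) ∂(normVol n L)
  + ∫ x, ρ x * (‖u x‖ ^ 2 / 2) * vert (u x) * deriv (cutoff N) (vert x) ∂(normVol n L)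
  + ∫ x, p x * vert (u x) * deriv (cutoff N) (vert x) ∂(normVol n L)
  - g * ∫ x, ρ x * vert (u x) * cutoff N (vert x) ∂(normVol n L)

lemma continuousOn_kinetic (h : IsClassicalSolution n L g ρ u p) {N : ℝ} (hN : 0 < N) :
    ContinuousOn (fun t => kinetic L N (ρ t) (u t)) (Set.Ioi 0) := by
  refine continuousOn_integral_time (R := 2 * N) ?_ fun t _ x hx => by
    simp [cutoff_eq_zero hN hx.le]
  have c1 := h.continuousOn_density
  have c2 := h.continuousOn_velocity
  fun_prop

/-- The balance of kinetic energy. -/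
theorem kinetic_sub_kinetic (h : IsClassicalSolution n L g ρ u p) (hL : 0 < L) {N : ℝ}
    (hN : 0 < N) {s t : ℝ} (hs : 0 < s) (hst : s ≤ t) :
    IntervalIntegrable (fun τ => kineticRate L g N (ρ τ) (u τ) (p τ)) volume s t ∧
    kinetic L N (ρ t) (u t) - kinetic L N (ρ s) (u s) =
      ∫ τ in s..t, kineticRate L g N (ρ τ) (u τ) (p τ) := by
  have hz : ∀ z, 2 * N ≤ |z| → cutoff N z = 0 := fun z hz => cutoff_eq_zero hN hz
  set f' : ℝ → Space n → ℝ := fun t x => (deriv (fun s => ρ s x) t * (‖u t x‖ ^ 2 / 2) +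
    ρ t x * inner ℝ (u t x) (deriv (fun s => u s x) t)) * cutoff N (vert x) with hf'
  have hcont : ContinuousOn (fun q : ℝ × Space n => f' q.1 q.2) (posTime n) := by
    have c1 := h.continuousOn_density
    have c2 := h.continuousOn_velocity
    have c3 := continuousOn_deriv_time h.contDiff_density
    have c4 := continuousOn_deriv_time h.contDiff_velocity
    simp only [hf']
    fun_prop
  have hsupp : ∀ t, 0 < t → ∀ x, 2 * N < |vert x| → f' t x = 0 := fun t _ x hx => by
    simp [hf', hz _ hx.le]
  have hrate : ∀ τ, 0 < τ → ∫ x, f' τ x ∂(normVol n L) =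
      kineticRate L g N (ρ τ) (u τ) (p τ) := by
    intro τ hτ
    have hU := h.contDiff_velocity_space hτ
    have hUp := h.periodic_velocity τ hτ.le
    have hr := h.contDiff_density_space τ hτ
    have hp := h.contDiff_pressure τ hτ
    have hb : ContDiff ℝ 1 fun x => ‖u τ x‖ ^ 2 / 2 := (hU.norm_sq ℝ).div_const 2
    have hk := integral_kinetic_balance hL hr (h.periodic_density τ hτ.le) hU hUp
      (h.incompressible τ hτ) hb (fun i x => by simp [hUp i x]) hp (h.periodic_pressure τ hτ)
      (contDiff_cutoff (k := 1) N) hz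
    have cr := hr.continuous
    have cU := hU.continuous
    rw [kineticRate, ← hk, ← integral_const_mul, ← integral_sub]
    · refine integral_congr_ae (Eventually.of_forall fun x => ?_)
      have d1 : ∀ v, fderiv ℝ (fun x => ‖u τ x‖ ^ 2 / 2) x v =
          inner ℝ (u τ x) (fderiv ℝ (u τ) x v) := by
        intro v
        have h1 := ((hU.differentiable one_ne_zero x).hasFDerivAt.norm_sq).mul_const (1 / 2 : ℝ)
        have h2 : (fun x => ‖u τ x‖ ^ 2 / 2) = fun x => ‖u τ x‖ ^ 2 * (1 / 2) := by
          ext x; ring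
        rw [h2, h1.fderiv]
        simp
      have ht : deriv (fun s => ρ s x) τ = (Δ (ρ τ)) x - inner ℝ (u τ x) (gradient (ρ τ) x) := by
        linarith [h.transport τ hτ x]
      -- The momentum equation is tested with `u`. Together with the transport equation, all terms
      -- other than gravity form the integrand of `integral_kinetic_balance` with `b = |u|²/2` and
      -- `q = p`.
      have hm := congrArg (fun v => inner ℝ (u τ x) v) (h.momentum τ hτ x)
      simp only [inner_add_right, inner_sub_right, inner_smul_right, inner_zero_right,
        smul_add] at hm
      have he : inner ℝ (u τ x) (ez n) = vert (u τ x) := by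
        rw [ez, EuclideanSpace.inner_single_right]; simp [vert]
      rw [he, inner_gradient'] at hm
      simp only [hf', d1, ht]
      linear_combination cutoff N (vert x) * hm
    · have cl := continuous_laplacian hr
      have cg := (contDiff_gradient hr).continuous
      have cb := hb.continuous_fderiv one_ne_zero
      have cp := hp.continuous_fderiv one_ne_zero
      exact integrable_of_continuous hL (R := 2 * N) (by fun_prop) fun x hx => by simp [hz _ hx.le]
    · exact integrable_of_continuous hL (R := 2 * N) (by fun_prop) fun x hx => by simp [hz _ hx.le]
  have hsub : ∀ τ ∈ Set.uIcc s t, 0 < τ := fun τ hτ => by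
    rw [Set.uIcc_of_le hst] at hτ
    exact hs.trans_le hτ.1
  -- The pressure carries no assumption of continuity in time, so continuity of the rate is
  -- inherited from the integral of the time derivative, in which the pressure does not occur.
  have hrc : ContinuousOn (fun τ => kineticRate L g N (ρ τ) (u τ) (p τ)) (Set.uIcc s t) :=
    ((continuousOn_integral_time (L := L) hcont hsupp).mono hsub).congr
      fun τ hτ => (hrate τ (hsub τ hτ)).symm
  refine ⟨hrc.intervalIntegrable, ?_⟩
  rw [← intervalIntegral.integral_congr fun τ hτ => hrate τ (hsub τ hτ)]
  refine integral_sub_integral_eq_intervalIntegral (R := 2 * N) hL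
    (f := fun t x => ρ t x * (‖u t x‖ ^ 2 / 2) * cutoff N (vert x)) ?_ ?_ hcont
    (fun t _ x hx => by simp [hz _ hx.le]) hsupp hs hst
  · intro t ht x
    have h1 := hasDerivAt_time h.contDiff_density ht x
    have h2 := hasDerivAt_time h.contDiff_velocity ht x
    have h3 := (h1.mul (h2.norm_sq.div_const 2)).mul_const (cutoff N (vert x))
    refine h3.congr_deriv ?_
    simp only [hf', h1.deriv, h2.deriv]
    ring
  · intro t ht
    have c1 := (h.contDiff_density_space t ht).continuous
    have c2 := (h.contDiff_velocity_space ht).continuous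
    fun_prop

end IsClassicalSolution

/-! ### Energy estimates -/

namespace StratifiedSolution
variable {g rp rm : ℝ} {ρ : ℝ → Space n → ℝ} {u : ℝ → Space n → Space n} {p : ℝ → Space n → ℝ}

lemma continuous_velocity (h : StratifiedSolution n L g rp rm ρ u p) {t : ℝ} (ht : 0 < t) :
    Continuous (u t) := (h.toIsClassicalSolution.contDiff_velocity_space ht).continuous

lemma kinetic_nonneg (h : StratifiedSolution n L g rp rm ρ u p) {t : ℝ} (ht : 0 < t) (N : ℝ) :
    0 ≤ kinetic L N (ρ t) (u t) := by
  refine integral_nonneg fun x => ?_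
  have := h.light_pos.le.trans (h.mem_Icc ht.le x).1
  have := cutoff_nonneg N (vert x)
  positivity

lemma integral_sq_velocity_le (h : StratifiedSolution n L g rp rm ρ u p) {t : ℝ} (ht : 0 < t)
    {N : ℝ} (hN : 0 < N) : ∫ x, ‖u t x‖ ^ 2 * cutoff N (vert x) ∂(normVol n L) ≤
      2 / rm * kinetic L N (ρ t) (u t) := by
  have c1 := h.continuous_velocity ht
  have c2 := h.continuous_density ht
  have hrm := h.light_pos
  rw [kinetic, ← integral_const_mul]
  refine integral_mono (integrable_of_continuous h.length_pos (R := 2 * N) (by fun_prop)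
    fun x hx => by simp [cutoff_eq_zero hN hx.le])
    (integrable_of_continuous h.length_pos (R := 2 * N) (by fun_prop)
    fun x hx => by simp [cutoff_eq_zero hN hx.le]) fun x => ?_
  have h1 := (h.mem_Icc ht.le x).1
  have h2 := cutoff_nonneg N (vert x)
  have h3 : 1 ≤ ρ t x / rm := (one_le_div hrm).2 h1
  calc ‖u t x‖ ^ 2 * cutoff N (vert x) = 1 * (‖u t x‖ ^ 2 * cutoff N (vert x)) := (one_mul _).symm
    _ ≤ ρ t x / rm * (‖u t x‖ ^ 2 * cutoff N (vert x)) := by gcongr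
    _ = _ := by field_simp

/-- The three terms carrying the derivative of the cutoff are of order `ε`, up to a dissipation at
the edge. The gravity term is a vertical flux, controlled by the kinetic energy and the dissipation
with a free parameter `l`. -/
lemma kineticRate_le (h : StratifiedSolution n L g rp rm ρ u p) {t : ℝ} (ht : 0 < t)
    {N ε C : ℝ} (hN : 1 ≤ N) (hε : 0 < ε) (hε1 : ε ≤ 1) (hC : 0 ≤ C)
    (hu : ∀ x, N ≤ |vert x| → ‖u t x‖ ≤ ε)
    (hp : ∀ x, N ≤ |vert x| → ∀ i : Fin n, |gradient (p t) x i.castSucc| ≤ C) {l : ℝ}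
    (hl : 0 < l) :
    IsClassicalSolution.kineticRate L g N (ρ t) (u t) (p t) ≤
      ε * (cutoffConst * (8 + 2 * rp + 4 * (n * (C * L))))
      + ε * cutoffConst * dissipation L (2 * N) (ρ t)
      + g / 2 * (l * (2 / rm * kinetic L N (ρ t) (u t)) + n * L ^ 2 / l * dissipation L N (ρ t)) := by
  have hL := h.length_pos
  have hg := h.gravity_pos
  have hN0 : 0 < N := by linarith
  have hK := cutoffConst_pos
  have hrp := h.heavy_pos
  have hr := h.contDiff_density_space t ht
  have hU := h.toIsClassicalSolution.contDiff_velocity_space ht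
  have hUp := h.periodic_velocity t ht.le
  have hP := h.contDiff_pressure t ht
  have cr := hr.continuous
  have cU := hU.continuous
  have cg := (contDiff_gradient hr).continuous
  have cp := hP.continuous
  have cχ := (contDiff_deriv (contDiff_cutoff (k := 2) N)).continuous
  have hb : ∀ x, N ≤ |vert x| → ‖u t x‖ ^ 2 / 2 ≤ ε := fun x hx => by
    have h1 := hu x hx
    have h2 := norm_nonneg (u t x)
    nlinarith
  -- No pointwise bound on `∇ρ` is available, so `|∂_z ρ| ≤ 1 + |∇ρ|²` is used. The cutoff at `2N`
  -- appears because it equals `1` wherever the derivative of the cutoff at `N` is nonzero.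
  have T1 : |∫ x, ‖u t x‖ ^ 2 / 2 * vert (gradient (ρ t) x) * deriv (cutoff N) (vert x)
      ∂(normVol n L)| ≤ ε * (cutoffConst * 8) + ε * cutoffConst * dissipation L (2 * N) (ρ t) := by
    have i1 : Integrable (fun x : Space n => cutoff (2 * N) (vert x)) (normVol n L) :=
      integrable_of_continuous hL (R := 2 * (2 * N)) (by fun_prop)
        fun x hx => cutoff_eq_zero (by positivity) hx.le
    have i2 : Integrable (fun x => ‖gradient (ρ t) x‖ ^ 2 * cutoff (2 * N) (vert x))
        (normVol n L) := integrable_of_continuous hL (R := 2 * (2 * N)) (by fun_prop)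
        fun x hx => by simp [cutoff_eq_zero (show 0 < 2 * N by positivity) hx.le]
    rw [← Real.norm_eq_abs]
    calc _ ≤ ∫ x, (ε * (cutoffConst / N) * cutoff (2 * N) (vert x) + ε * (cutoffConst / N) *
          (‖gradient (ρ t) x‖ ^ 2 * cutoff (2 * N) (vert x))) ∂(normVol n L) := by
          refine norm_integral_le_of_norm_le ((i1.const_mul _).add (i2.const_mul _))
            (Eventually.of_forall fun x => ?_)
          have hχ0 := cutoff_nonneg (2 * N) (vert x)
          rcases lt_or_ge |vert x| N with hx | hx
          · rw [deriv_cutoff_of_lt hx]; simp; positivity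
          · rcases le_or_gt (2 * N) |vert x| with hx2 | hx2
            · rw [deriv_cutoff_eq_zero hN0 hx2]; simp; positivity
            · rw [cutoff_eq_one (by positivity) hx2.le, norm_mul, norm_mul, Real.norm_eq_abs,
                Real.norm_eq_abs, Real.norm_eq_abs, abs_of_nonneg (a := ‖u t x‖ ^ 2 / 2)
                (by positivity)]
              have hv : |vert (gradient (ρ t) x)| ≤ 1 + ‖gradient (ρ t) x‖ ^ 2 := by
                refine (abs_vert_le _).trans ?_
                nlinarith [sq_nonneg (‖gradient (ρ t) x‖ - 1)]
              calc _ ≤ ε * (1 + ‖gradient (ρ t) x‖ ^ 2) * (cutoffConst / N) := by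
                    gcongr
                    · exact hb x hx
                    · exact abs_deriv_cutoff_le hN0 _
                _ = _ := by ring
      _ = ε * (cutoffConst / N) * ∫ x, cutoff (2 * N) (vert x) ∂(normVol n L) +
          ε * (cutoffConst / N) * dissipation L (2 * N) (ρ t) := by
          rw [integral_add (i1.const_mul _) (i2.const_mul _), integral_const_mul,
            integral_const_mul, dissipation]
      _ ≤ _ := by
          have h1 : ∫ x, cutoff (2 * N) (vert x) ∂(normVol n L) ≤ 1 * (2 * (2 * (2 * N))) :=
            (le_abs_self _).trans (abs_integral_le_of_slab hL (by positivity) (fun x _ => by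
              rw [abs_of_nonneg (cutoff_nonneg _ _)]; exact cutoff_le_one _ _)
              fun x hx => cutoff_eq_zero (by positivity) hx.le)
          have h2 : cutoffConst / N ≤ cutoffConst := div_le_self hK.le hN
          have h3 := dissipation_nonneg (L := L) (2 * N) (ρ t)
          calc _ ≤ ε * (cutoffConst / N) * (1 * (2 * (2 * (2 * N)))) +
                ε * cutoffConst * dissipation L (2 * N) (ρ t) := by gcongr
            _ = _ := by field_simp; ring
  have T2 : |∫ x, ρ t x * (‖u t x‖ ^ 2 / 2) * vert (u t x) * deriv (cutoff N) (vert x)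
      ∂(normVol n L)| ≤ ε * (cutoffConst * (2 * rp)) := by
    refine (abs_integral_le_of_slab hL (B := rp * (ε / 2) * 1 * (cutoffConst / N)) (R := 2 * N)
      (by positivity) (fun x _ => ?_)
      fun x hx => by simp [deriv_cutoff_eq_zero hN0 hx.le]).trans_eq (by field_simp)
    rcases lt_or_ge |vert x| N with hx | hx
    · rw [deriv_cutoff_of_lt hx]; simp; positivity
    · rw [abs_mul, abs_mul, abs_mul, abs_of_nonneg (a := ‖u t x‖ ^ 2 / 2) (by positivity)]
      gcongr
      · exact h.abs_density_le ht.le x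
      · have h1 := hu x hx
        have h2 := norm_nonneg (u t x)
        nlinarith
      · exact (abs_vert_le _).trans ((hu x hx).trans hε1)
      · exact abs_deriv_cutoff_le hN0 _
  -- Since `u_z` has mean zero on slices, the pressure on the vertical axis can be subtracted. What
  -- remains is the oscillation of `p` along a slice, bounded through the horizontal pressure
  -- gradient by `n C L`.
  have T3 : |∫ x, p t x * vert (u t x) * deriv (cutoff N) (vert x) ∂(normVol n L)| ≤
      ε * (cutoffConst * (4 * (n * (C * L)))) := by
    have h0 := integral_vertical_velocity_eq_zero hL hU hUp (h.incompressible t ht)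
      (h.toIsClassicalSolution.velocity_tendsto ht)
      (c := fun z => p t (z • ez n) * deriv (cutoff N) z) (by fun_prop) (R := 2 * N)
      fun z hz => by simp [deriv_cutoff_eq_zero hN0 hz]
    have e : ∫ x, p t x * vert (u t x) * deriv (cutoff N) (vert x) ∂(normVol n L) =
        ∫ x, (p t x - p t (vert x • ez n)) * vert (u t x) * deriv (cutoff N) (vert x)
          ∂(normVol n L) := by
      rw [← sub_zero (∫ x, p t x * vert (u t x) * deriv (cutoff N) (vert x) ∂(normVol n L)), ← h0,
        ← integral_sub
          (integrable_of_continuous hL (R := 2 * N) (by fun_prop)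
            fun x hx => by simp [deriv_cutoff_eq_zero hN0 hx.le])
          (integrable_of_continuous hL (R := 2 * N) (by fun_prop)
            fun x hx => by simp [deriv_cutoff_eq_zero hN0 hx.le])]
      congr 1; ext x; ring
    rw [e]
    refine (abs_integral_le_of_slab hL (B := n * (C * L) * ε * (cutoffConst / N)) (R := 2 * N)
      (by positivity) (fun x hxs => ?_)
      fun x hx => by simp [deriv_cutoff_eq_zero hN0 hx.le]).trans_eq (by field_simp; ring)
    rcases lt_or_ge |vert x| N with hx | hx
    · rw [deriv_cutoff_of_lt hx]; simp; positivity
    · rw [abs_mul, abs_mul]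
      gcongr
      · exact abs_sub_slice_le hP hxs fun y hy => hp y (by rwa [hy])
      · exact (abs_vert_le _).trans (hu x hx)
      · exact abs_deriv_cutoff_le hN0 _
  have T4 := abs_integral_flux_le hL hU hUp (h.incompressible t ht)
    (h.toIsClassicalSolution.velocity_tendsto ht) (hr.of_le (by norm_num))
    (h.periodic_density t ht.le) (continuous_cutoff N) zero_le_one hN0
    (fun z => by rw [abs_of_nonneg (cutoff_nonneg _ _), one_mul]) hl
  have T5 := h.integral_sq_velocity_le ht hN0
  have T6 : -(g * ∫ x, ρ t x * vert (u t x) * cutoff N (vert x) ∂(normVol n L)) ≤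
      g / 2 * (l * (2 / rm * kinetic L N (ρ t) (u t)) +
        n * L ^ 2 / l * dissipation L N (ρ t)) := by
    rw [← mul_neg]
    calc _ ≤ g * (1 / 2 * (l * (2 / rm * kinetic L N (ρ t) (u t)) +
          n * L ^ 2 / l * dissipation L N (ρ t))) := by
          refine mul_le_mul_of_nonneg_left ((neg_le_abs _).trans (T4.trans ?_)) hg.le
          gcongr
      _ = _ := by ring
  rw [IsClassicalSolution.kineticRate]
  have a1 := (neg_le_abs _).trans T1
  have a2 := (le_abs_self _).trans T2
  have a3 := (le_abs_self _).trans T3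
  linarith

lemma continuousOn_dissipation_cutoff (h : StratifiedSolution n L g rp rm ρ u p) {N : ℝ}
    (hN : 0 < N) : ContinuousOn (fun τ => dissipation L N (ρ τ)) (Set.Ioi 0) := by
  have := h.toIsClassicalSolution.continuousOn_dissipation (L := L) (ψ := fun _ => 1)
    continuous_const (continuous_cutoff N) (R := 2 * N) fun z hz => cutoff_eq_zero hN hz
  simpa [dissipation] using this

lemma intervalIntegrable_dissipation (h : StratifiedSolution n L g rp rm ρ u p) {N : ℝ}
    (hN : 0 < N) {s t : ℝ} (hs : 0 < s) (hst : s ≤ t) :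
    IntervalIntegrable (fun τ => dissipation L N (ρ τ)) volume s t := by
  refine ((h.continuousOn_dissipation_cutoff hN).mono fun τ hτ => ?_).intervalIntegrable
  rw [Set.uIcc_of_le hst] at hτ
  exact hs.trans_le hτ.1

/-- Growth of the truncated kinetic energy. -/
theorem exists_kinetic_growth (h : StratifiedSolution n L g rp rm ρ u p) {T D : ℝ} (hT : 0 < T)
    (hD : ∀ N, 0 < N → ∀ t ∈ Set.Ioc 0 T, mixVolume L rp rm N (ρ t) ≤ D) :
    ∃ N₀ : ℝ, 1 ≤ N₀ ∧ ∀ N, N₀ ≤ N → ∀ l, 0 < l → ∀ s t Z, 0 < s → s ≤ t → t ≤ T →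
      (∀ τ ∈ Set.Icc s t, kinetic L N (ρ τ) (u τ) ≤ Z) →
      kinetic L N (ρ t) (u t) ≤ kinetic L N (ρ s) (u s) + 1 + g * l / rm * (t - s) * Z +
        g * (n * L ^ 2) / (2 * l) * ((rp - rm) * D + 1) := by
  have hL := h.length_pos
  have hg := h.gravity_pos
  have hrm := h.light_pos
  have hK := cutoffConst_pos
  have hlt := sub_pos.2 h.light_lt
  have hrp := h.heavy_pos
  obtain ⟨N₁, hN₁, hdiss⟩ := h.exists_integral_dissipation_le T
  obtain ⟨C₀, R₀, hC₀⟩ := h.horizontal_pressure T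
  set C := max C₀ 0
  have hC : 0 ≤ C := le_max_right _ _
  have hD0 : 0 ≤ D := (mixVolume_nonneg _ _ _ _).trans (hD 1 one_pos T ⟨hT, le_rfl⟩)
  -- `Q` collects the edge contributions accumulated up to time `T`, per unit of `ε`; the choice of
  -- `ε` makes their sum at most `1`.
  set Q := cutoffConst * (8 + 2 * rp + 4 * (n * (C * L))) * T + cutoffConst * ((rp - rm) * D + 1)
  have hQ : 0 ≤ Q := by positivity
  set ε := 1 / (Q + 1) with hε_def
  have hε : 0 < ε := by positivity
  have hε1 : ε ≤ 1 := by
    rw [hε_def, div_le_one (by positivity)]; linarith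
  have hεQ : ε * Q ≤ 1 := by
    rw [hε_def, one_div, inv_mul_le_one₀ (by positivity)]; linarith
  obtain ⟨R₁, hR₁⟩ := h.velocity_vanishes T ε hε
  refine ⟨max N₁ (max R₀ R₁), hN₁.trans (le_max_left _ _), fun N hN l hl s t Z hs hst htT hZ => ?_⟩
  have hNN₁ : N₁ ≤ N := (le_max_left _ _).trans hN
  have hNR₀ : R₀ ≤ N := ((le_max_left _ _).trans (le_max_right _ _)).trans hN
  have hNR₁ : R₁ ≤ N := ((le_max_right _ _).trans (le_max_right _ _)).trans hN
  have hN1 : 1 ≤ N := hN₁.trans hNN₁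
  have hN0 : 0 < N := by linarith
  obtain ⟨hi, hk⟩ := h.toIsClassicalSolution.kinetic_sub_kinetic hL hN0 hs hst
  have ht := hs.trans_le hst
  have j1 := h.intervalIntegrable_dissipation hN0 hs hst
  have j2 := h.intervalIntegrable_dissipation (show 0 < 2 * N by positivity) hs hst
  set a := ε * (cutoffConst * (8 + 2 * rp + 4 * (n * (C * L)))) + g * l / rm * Z with ha
  have hmono : ∫ τ in s..t, IsClassicalSolution.kineticRate L g N (ρ τ) (u τ) (p τ) ≤
      ∫ τ in s..t, (a + ε * cutoffConst * dissipation L (2 * N) (ρ τ) +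
        g * (n * L ^ 2) / (2 * l) * dissipation L N (ρ τ)) := by
    refine intervalIntegral.integral_mono_on hst hi
      ((intervalIntegrable_const.add (j2.const_mul _)).add (j1.const_mul _)) fun τ hτ => ?_
    have hτ0 := hs.trans_le hτ.1
    have hτT : τ ∈ Set.Ioc 0 T := ⟨hτ0, hτ.2.trans htT⟩
    refine (h.kineticRate_le hτ0 hN1 hε hε1 hC (fun x hx => hR₁ τ hτT x (hNR₁.trans hx))
      (fun x hx i => (hC₀ τ hτT x (hNR₀.trans hx) i).trans (le_max_left _ _)) hl).trans ?_
    have h1 : g / 2 * (l * (2 / rm * kinetic L N (ρ τ) (u τ))) ≤ g * l / rm * Z := by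
      calc _ = g * l / rm * kinetic L N (ρ τ) (u τ) := by field_simp
        _ ≤ _ := by gcongr; exact hZ τ hτ
    have h2 : g / 2 * (n * L ^ 2 / l * dissipation L N (ρ τ)) =
        g * (n * L ^ 2) / (2 * l) * dissipation L N (ρ τ) := by field_simp
    rw [ha, mul_add (g / 2), h2]
    linarith
  rw [intervalIntegral.integral_add (intervalIntegrable_const.add (j2.const_mul _))
    (j1.const_mul _), intervalIntegral.integral_add intervalIntegrable_const (j2.const_mul _),
    intervalIntegral.integral_const, intervalIntegral.integral_const_mul,
    intervalIntegral.integral_const_mul, smul_eq_mul] at hmono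
  have d1 := (hdiss N hNN₁ s t hs hst htT).trans
    (add_le_add_left (mul_le_mul_of_nonneg_left (hD N hN0 t ⟨ht, htT⟩) hlt.le) 1)
  have d2 := (hdiss (2 * N) (by linarith) s t hs hst htT).trans
    (add_le_add_left (mul_le_mul_of_nonneg_left (hD (2 * N) (by positivity) t ⟨ht, htT⟩) hlt.le) 1)
  have m1 : g * (n * L ^ 2) / (2 * l) * ∫ τ in s..t, dissipation L N (ρ τ) ≤
      g * (n * L ^ 2) / (2 * l) * ((rp - rm) * D + 1) := by gcongr
  have m2 : ε * cutoffConst * ∫ τ in s..t, dissipation L (2 * N) (ρ τ) ≤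
      ε * cutoffConst * ((rp - rm) * D + 1) := by gcongr
  have m3 : (t - s) * a ≤ ε * (cutoffConst * (8 + 2 * rp + 4 * (n * (C * L))) * T) +
      g * l / rm * (t - s) * Z := by
    have hts : t - s ≤ T := by linarith
    have h1 : (t - s) * (ε * (cutoffConst * (8 + 2 * rp + 4 * (n * (C * L))))) ≤
        T * (ε * (cutoffConst * (8 + 2 * rp + 4 * (n * (C * L))))) := by gcongr
    rw [ha, mul_add]
    linarith
  have m4 : ε * (cutoffConst * (8 + 2 * rp + 4 * (n * (C * L))) * T) +
      ε * cutoffConst * ((rp - rm) * D + 1) ≤ 1 := by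
    refine le_of_eq_of_le ?_ hεQ
    simp only [Q]; ring
  linarith

/-- The initial kinetic energy bounds the truncated kinetic energies at small times. -/
theorem eventually_kinetic_le (h : StratifiedSolution n L g rp rm ρ u p) {N : ℝ} (hN : 0 < N) :
    ∀ᶠ s in 𝓝[>] (0 : ℝ), kinetic L N (ρ s) (u s) ≤
      rp * (1 + 1 / rm * ∫ x, ρ 0 x * ‖u 0 x‖ ^ 2 ∂(normVol n L)) := by
  have hL := h.length_pos
  have hrm := h.light_pos
  have hrp := h.heavy_pos
  have hlim := h.initial_velocity (2 * N)
  filter_upwards [hlim.eventually (ge_mem_nhds (show (0 : ℝ≥0∞) < 1 by simp)),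
    self_mem_nhdsWithin] with s hs hs0
  have hs0 : 0 < s := hs0
  have cu := h.continuous_velocity hs0
  have cρ := h.continuous_density hs0
  have hm : MeasurableSet {x : Space n | |vert x| ≤ 2 * N} :=
    measurableSet_le (by fun_prop) (by fun_prop)
  have hu0 : AEStronglyMeasurable (u 0) (normVol n L) :=
    h.measurable_velocity.mono_ac IsClassicalSolution.absolutelyContinuous_normVol
  have i0 : Integrable (fun x => 1 / rm * (ρ 0 x * ‖u 0 x‖ ^ 2)) (normVol n L) :=
    h.initial_kinetic.const_mul _
  have i1 : Integrable (fun x => ‖u s x‖ ^ 2 * cutoff N (vert x)) (normVol n L) :=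
    integrable_of_continuous hL (R := 2 * N) (by fun_prop)
      fun x hx => by simp [cutoff_eq_zero hN hx.le]
  have hE0 : 0 ≤ ∫ x, ρ 0 x * ‖u 0 x‖ ^ 2 ∂(normVol n L) := integral_nonneg fun x =>
    mul_nonneg (hrm.le.trans (h.initial_range x).1) (sq_nonneg _)
  -- From `|u(s)|² ≤ 2 |u(s) - u(0)|² + 2 |u(0)|²`: the first part is at most `1` on the slab for
  -- small `s`, the second is bounded by the initial kinetic energy since `ρ ≥ rm`. The bound does
  -- not depend on `N`; only the range of admissible `s` does.
  have key : ∫ x, ‖u s x‖ ^ 2 * cutoff N (vert x) ∂(normVol n L) ≤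
      2 + 2 * (1 / rm * ∫ x, ρ 0 x * ‖u 0 x‖ ^ 2 ∂(normVol n L)) := by
    rw [← ENNReal.ofReal_le_ofReal_iff (by positivity), ofReal_integral_eq_lintegral_ofReal i1
      (Eventually.of_forall fun x => mul_nonneg (sq_nonneg _) (cutoff_nonneg _ _))]
    have hn : ∀ v : Space n, ‖v‖ₑ ^ 2 = ENNReal.ofReal (‖v‖ ^ 2) := fun v => by
      rw [ENNReal.ofReal_pow (norm_nonneg _), ofReal_norm]
    have h2 : ∀ a b : ℝ, 0 ≤ a → 0 ≤ b → 2 * ENNReal.ofReal a + 2 * ENNReal.ofReal b =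
        ENNReal.ofReal (2 * a + 2 * b) := fun a b ha hb => by
      rw [ENNReal.ofReal_add (by positivity) (by positivity), ENNReal.ofReal_mul (by norm_num),
        ENNReal.ofReal_mul (by norm_num)]
      norm_num
    calc ∫⁻ x, ENNReal.ofReal (‖u s x‖ ^ 2 * cutoff N (vert x)) ∂(normVol n L)
        ≤ ∫⁻ x, (2 * {x : Space n | |vert x| ≤ 2 * N}.indicator
            (fun x => ‖u s x - u 0 x‖ₑ ^ 2) x +
            2 * ENNReal.ofReal (1 / rm * (ρ 0 x * ‖u 0 x‖ ^ 2))) ∂(normVol n L) := by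
          refine lintegral_mono fun x => ?_
          have h0 : ‖u 0 x‖ ^ 2 ≤ 1 / rm * (ρ 0 x * ‖u 0 x‖ ^ 2) := by
            have h3 : 1 ≤ ρ 0 x / rm := (one_le_div hrm).2 (h.initial_range x).1
            calc ‖u 0 x‖ ^ 2 = 1 * ‖u 0 x‖ ^ 2 := (one_mul _).symm
              _ ≤ ρ 0 x / rm * ‖u 0 x‖ ^ 2 := by gcongr
              _ = _ := by ring
          by_cases hx : |vert x| ≤ 2 * N
          · rw [Set.indicator_of_mem (show x ∈ {x : Space n | |vert x| ≤ 2 * N} from hx), hn,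
              h2 _ _ (by positivity) ((sq_nonneg _).trans h0)]
            refine ENNReal.ofReal_le_ofReal ?_
            have h4 : ‖u s x‖ ≤ ‖u s x - u 0 x‖ + ‖u 0 x‖ := by
              simpa using norm_add_le (u s x - u 0 x) (u 0 x)
            have h5 : ‖u s x‖ ^ 2 ≤ 2 * ‖u s x - u 0 x‖ ^ 2 + 2 * ‖u 0 x‖ ^ 2 := by
              nlinarith [norm_nonneg (u s x), sq_nonneg (‖u s x - u 0 x‖ - ‖u 0 x‖)]
            have h6 : ‖u s x‖ ^ 2 * cutoff N (vert x) ≤ ‖u s x‖ ^ 2 * 1 :=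
              mul_le_mul_of_nonneg_left (cutoff_le_one _ _) (sq_nonneg _)
            linarith
          · rw [cutoff_eq_zero hN (not_le.1 hx).le]; simp
      _ ≤ 2 * ∫⁻ x in {x | |vert x| ≤ 2 * N}, ‖u s x - u 0 x‖ₑ ^ 2 ∂(normVol n L) +
          2 * ∫⁻ x, ENNReal.ofReal (1 / rm * (ρ 0 x * ‖u 0 x‖ ^ 2)) ∂(normVol n L) := by
          rw [lintegral_add_right' _ (i0.aestronglyMeasurable.aemeasurable.ennreal_ofReal.const_mul
            _), lintegral_const_mul' _ _ (by simp), lintegral_const_mul' _ _ (by simp),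
            lintegral_indicator hm]
      _ ≤ 2 * 1 + 2 * ∫⁻ x, ENNReal.ofReal (1 / rm * (ρ 0 x * ‖u 0 x‖ ^ 2)) ∂(normVol n L) := by
          gcongr
      _ = _ := by
          rw [← ofReal_integral_eq_lintegral_ofReal i0 (Eventually.of_forall fun x => by
            have := hrm.le.trans (h.initial_range x).1
            positivity), integral_const_mul, ENNReal.ofReal_add (by norm_num) (by positivity),
            ENNReal.ofReal_mul (p := 2) (by norm_num)]
          norm_num
  calc kinetic L N (ρ s) (u s) ≤ ∫ x, rp / 2 * (‖u s x‖ ^ 2 * cutoff N (vert x))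
        ∂(normVol n L) := by
        refine integral_mono (integrable_of_continuous hL (R := 2 * N) (by fun_prop)
          fun x hx => by simp [cutoff_eq_zero hN hx.le]) (i1.const_mul _) fun x => ?_
        have h1 := (h.mem_Icc hs0.le x).2
        have h2 := cutoff_nonneg N (vert x)
        calc ρ s x * (‖u s x‖ ^ 2 / 2) * cutoff N (vert x)
            ≤ rp * (‖u s x‖ ^ 2 / 2) * cutoff N (vert x) := by gcongr
          _ = _ := by ring
    _ ≤ rp / 2 * (2 + 2 * (1 / rm * ∫ x, ρ 0 x * ‖u 0 x‖ ^ 2 ∂(normVol n L))) := by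
        rw [integral_const_mul]
        gcongr
    _ = _ := by ring

/-- The truncated kinetic energies grow at most like the square of the time. -/
theorem exists_kinetic_bound (h : StratifiedSolution n L g rp rm ρ u p) :
    ∃ C, 0 ≤ C ∧ ∀ T D : ℝ, 0 < T →
      (∀ N, 0 < N → ∀ t ∈ Set.Ioc 0 T, mixVolume L rp rm N (ρ t) ≤ D) →
      ∃ N₀ : ℝ, 1 ≤ N₀ ∧ ∀ N, N₀ ≤ N → ∀ t ∈ Set.Ioc 0 T,
        kinetic L N (ρ t) (u t) ≤ C * (1 + T * (1 + D)) := by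
  have hL := h.length_pos
  have hg := h.gravity_pos
  have hrm := h.light_pos
  have hrp := h.heavy_pos
  have hlt := sub_pos.2 h.light_lt
  have hE0 : 0 ≤ ∫ x, ρ 0 x * ‖u 0 x‖ ^ 2 ∂(normVol n L) := integral_nonneg fun x =>
    mul_nonneg (hrm.le.trans (h.initial_range x).1) (sq_nonneg _)
  set E := rp * (1 + 1 / rm * ∫ x, ρ 0 x * ‖u 0 x‖ ^ 2 ∂(normVol n L))
  have hE : 0 ≤ E := by positivity
  set c := 2 * (g ^ 2 * (n * L ^ 2) / rm) with hc
  have hc0 : 0 ≤ c := by positivity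
  refine ⟨2 * (E + 1) + c * ((rp - rm) + 1), by positivity, fun T D hT hD => ?_⟩
  have hD0 : 0 ≤ D := (mixVolume_nonneg _ _ _ _).trans (hD 1 one_pos T ⟨hT, le_rfl⟩)
  obtain ⟨N₀, hN₀, hgrow⟩ := h.exists_kinetic_growth hT hD
  refine ⟨N₀, hN₀, fun N hN t ht => ?_⟩
  have hN0 : 0 < N := by linarith
  obtain ⟨s, hsE, hs⟩ := ((h.eventually_kinetic_le hN0).and (Ioc_mem_nhdsGT ht.1)).exists
  have hsub : Set.Icc s T ⊆ Set.Ioi 0 := fun τ hτ => hs.1.trans_le hτ.1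
  -- The growth estimate is applied up to a time `m` at which the truncated kinetic energy is
  -- maximal, so that the maximum `Z` occurs on both sides.
  obtain ⟨m, hm, hmax⟩ := isCompact_Icc.exists_isMaxOn
    ⟨s, Set.left_mem_Icc.2 (hs.2.trans ht.2)⟩
    ((h.toIsClassicalSolution.continuousOn_kinetic hN0 (L := L)).mono hsub)
  set Z := kinetic L N (ρ m) (u m)
  have hZ0 : 0 ≤ Z := h.kinetic_nonneg (hsub hm) N
  -- This value of `l` makes the coefficient of `Z` equal to `(m - s)/(2T) ≤ 1/2`, which is
  -- absorbed. The price is a factor `T` in front of the dissipation bound.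
  have hl : 0 < rm / (2 * g * T) := by positivity
  have hb := hgrow N hN (rm / (2 * g * T)) hl s m Z hs.1 hm.1 hm.2
    fun τ hτ => hmax ⟨hτ.1, hτ.2.trans hm.2⟩
  have h1 : g * (rm / (2 * g * T)) / rm * (m - s) * Z ≤ 1 / 2 * Z := by
    have : g * (rm / (2 * g * T)) / rm = 1 / (2 * T) := by field_simp
    rw [this]
    refine mul_le_mul_of_nonneg_right ?_ hZ0
    rw [div_mul_eq_mul_div, div_le_div_iff₀ (by positivity) (by positivity)]
    nlinarith [hm.2, hs.1]
  have h2 : g * (n * L ^ 2) / (2 * (rm / (2 * g * T))) * ((rp - rm) * D + 1) =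
      c / 2 * (T * ((rp - rm) * D + 1)) := by
    rw [hc]; field_simp
  rw [h2] at hb
  have h3 : Z ≤ 2 * (E + 1) + c * (T * ((rp - rm) * D + 1)) := by linarith
  have h4 : kinetic L N (ρ t) (u t) ≤ Z := hmax ⟨hs.2, ht.2⟩
  have h5 : T * ((rp - rm) * D + 1) ≤ ((rp - rm) + 1) * (T * (1 + D)) := by
    have : (rp - rm) * D + 1 ≤ ((rp - rm) + 1) * (1 + D) := by nlinarith
    calc _ ≤ T * (((rp - rm) + 1) * (1 + D)) := by gcongr
      _ = _ := by ring
  have h6 : 0 ≤ T * (1 + D) := by positivity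
  have h7 : c * (T * ((rp - rm) * D + 1)) ≤ c * (((rp - rm) + 1) * (T * (1 + D))) := by gcongr
  have h8 : 0 ≤ 2 * (E + 1) * (T * (1 + D)) := by positivity
  have h9 : 0 ≤ c * ((rp - rm) + 1) := by positivity
  linarith

end StratifiedSolution

/-! ### Growth of the potential energy -/

lemma deriv_id_mul_cutoff (N : ℝ) :
    deriv (fun z => z * cutoff N z) = fun z => cutoff N z + z * deriv (cutoff N) z := by
  rw [deriv_mul_cutoff (f := fun z => z) contDiff_id N]
  funext z
  simp

lemma deriv_deriv_id_mul_cutoff (N : ℝ) : deriv (deriv fun z => z * cutoff N z) =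
    fun z => 2 * deriv (cutoff N) z + z * deriv (deriv (cutoff N)) z := by
  rw [deriv_deriv_mul_cutoff (f := fun z => z) contDiff_id N]
  funext z
  have : deriv (fun z : ℝ => z) = fun _ => 1 := funext fun z => deriv_id z
  simp [this]

/-- The term `z χ_N'` stays bounded because `|z| ≤ 2N` compensates the factor `1/N`. Domination by a
multiple of a cutoff, here at scale `2N`, is what `abs_integral_flux_le` requires. -/
lemma abs_deriv_id_mul_cutoff_le {N : ℝ} (hN : 0 < N) (z : ℝ) :
    |deriv (fun z => z * cutoff N z) z| ≤ (1 + 2 * cutoffConst) * cutoff (2 * N) z := by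
  have hK := cutoffConst_pos
  rw [deriv_id_mul_cutoff]
  dsimp only
  rcases le_or_gt (2 * N) |z| with hz | hz
  · rw [cutoff_eq_zero hN hz, deriv_cutoff_eq_zero hN hz]
    simp only [mul_zero, add_zero, abs_zero]
    exact mul_nonneg (by positivity) (cutoff_nonneg _ _)
  · rw [cutoff_eq_one (by positivity) hz.le, mul_one]
    refine (abs_add_le _ _).trans (add_le_add ?_ ?_)
    · rw [abs_of_nonneg (cutoff_nonneg _ _)]
      exact cutoff_le_one _ _
    · rw [abs_mul]
      calc |z| * |deriv (cutoff N) z| ≤ 2 * N * (cutoffConst / N) :=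
            mul_le_mul hz.le (abs_deriv_cutoff_le hN z) (abs_nonneg _) (by positivity)
        _ = 2 * cutoffConst := by field_simp

lemma abs_deriv_deriv_id_mul_cutoff_le {N : ℝ} (hN : 0 < N) (z : ℝ) :
    |deriv (deriv fun z => z * cutoff N z) z| ≤ 4 * cutoffConst / N := by
  have hK := cutoffConst_pos
  rw [deriv_deriv_id_mul_cutoff]
  dsimp only
  rcases le_or_gt (2 * N) |z| with hz | hz
  · rw [deriv_cutoff_eq_zero hN hz, deriv_deriv_cutoff_eq_zero hN hz]
    simp only [mul_zero, add_zero, abs_zero]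
    positivity
  · refine (abs_add_le _ _).trans ?_
    rw [abs_mul, abs_mul, abs_two]
    calc _ ≤ 2 * (cutoffConst / N) + 2 * N * (cutoffConst / N ^ 2) := by
          gcongr
          · exact abs_deriv_cutoff_le hN z
          · exact abs_deriv_deriv_cutoff_le hN z
      _ = _ := by field_simp; ring

/-- The truncated potential energy, without the normalizing constants. -/
def liftVolume (L rp rm N : ℝ) (r : Space n → ℝ) : ℝ :=
  ∫ x, |stratified rp rm x - r x| * (|vert x| * cutoff N (vert x)) ∂(normVol n L)

namespace StratifiedSolution
variable {g rp rm : ℝ} {ρ : ℝ → Space n → ℝ} {u : ℝ → Space n → Space n} {p : ℝ → Space n → ℝ}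

lemma integrable_liftVolume (h : StratifiedSolution n L g rp rm ρ u p) {t : ℝ} (ht : 0 ≤ t)
    {N : ℝ} (hN : 0 < N) : Integrable (fun x => |stratified rp rm x - ρ t x| *
      (|vert x| * cutoff N (vert x))) (normVol n L) :=
  h.integrable_abs_sub_mul ht (w := fun z => |z| * cutoff N z)
    (continuous_abs.mul (continuous_cutoff N)) (R := 2 * N)
    fun _ hz => by simp [cutoff_eq_zero hN hz]

lemma integrable_mixVolume (h : StratifiedSolution n L g rp rm ρ u p) {t : ℝ} (ht : 0 ≤ t)
    {N : ℝ} (hN : 0 < N) : Integrable (fun x => |stratified rp rm x - ρ t x| *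
      cutoff N (vert x)) (normVol n L) :=
  h.integrable_abs_sub_mul ht (continuous_cutoff N) (R := 2 * N)
    fun _ hz => cutoff_eq_zero hN hz

lemma liftVolume_eq (h : StratifiedSolution n L g rp rm ρ u p) {t : ℝ} (ht : 0 ≤ t) (N : ℝ) :
    ∫ x, (stratified rp rm x - ρ t x) * (vert x * cutoff N (vert x)) ∂(normVol n L) =
      liftVolume L rp rm N (ρ t) := by
  refine integral_congr_ae (Eventually.of_forall fun x => ?_)
  dsimp only
  rw [← mul_assoc, h.sub_mul_vert ht, mul_assoc]

lemma liftVolume_mono (h : StratifiedSolution n L g rp rm ρ u p) {t : ℝ} (ht : 0 ≤ t) {N M : ℝ}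
    (hN : 0 < N) (hM : 2 * N ≤ M) : liftVolume L rp rm N (ρ t) ≤ liftVolume L rp rm M (ρ t) :=
  integral_mono (h.integrable_liftVolume ht hN) (h.integrable_liftVolume ht (by linarith))
    fun x => by
      dsimp only
      gcongr
      exact cutoff_le_cutoff hN hM _

lemma liftVolume_initial_le (h : StratifiedSolution n L g rp rm ρ u p) {N : ℝ} (hN : 0 < N) :
    liftVolume L rp rm N (ρ 0) ≤ initialEnergy L rp rm ρ := by
  refine integral_mono (h.integrable_liftVolume le_rfl hN) h.integrable_initial fun x => ?_
  change _ ≤ (stratified rp rm x - ρ 0 x) * vert x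
  rw [h.sub_mul_vert le_rfl]
  exact mul_le_mul_of_nonneg_left (mul_le_of_le_one_right (abs_nonneg _) (cutoff_le_one _ _))
    (abs_nonneg _)

/-- The truncated potential energy is controlled by the flux and the diffusion. -/
theorem exists_liftVolume_bound (h : StratifiedSolution n L g rp rm ρ u p) :
    ∃ C, 0 ≤ C ∧ ∀ T D : ℝ, 0 < T →
      (∀ N, 0 < N → ∀ t ∈ Set.Ioc 0 T, mixVolume L rp rm N (ρ t) ≤ D) →
      ∀ N, 0 < N → ∀ t ∈ Set.Ioc 0 T, liftVolume L rp rm N (ρ t) ≤ C * (1 + T * (1 + D)) := by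
  have hL := h.length_pos
  have hrm := h.light_pos
  have hrp := h.heavy_pos
  have hlt := sub_pos.2 h.light_lt
  have hK := cutoffConst_pos
  have hI := h.initialEnergy_nonneg
  obtain ⟨Ck, hCk, hkin⟩ := h.exists_kinetic_bound
  set κ := 1 + 2 * cutoffConst with hκ
  have hκ0 : 0 < κ := by positivity
  refine ⟨initialEnergy L rp rm ρ + κ / 2 * (2 / rm * Ck) + 16 * rp * cutoffConst +
    κ / 2 * (n * L ^ 2) * ((rp - rm) + 1), by positivity, fun T D hT hD => ?_⟩
  have hD0 : 0 ≤ D := (mixVolume_nonneg _ _ _ _).trans (hD 1 one_pos T ⟨hT, le_rfl⟩)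
  obtain ⟨N₁, hN₁, hkin⟩ := hkin T D hT hD
  obtain ⟨N₂, hN₂, hdiss⟩ := h.exists_integral_dissipation_le T
  set X := 1 + T * (1 + D) with hX
  have hX0 : 0 ≤ X := by positivity
  -- The truncated energy increases when the scale at least doubles, so it is enough to treat large
  -- `N`.
  suffices hlarge : ∀ N, max N₁ N₂ ≤ N → ∀ t ∈ Set.Ioc 0 T, liftVolume L rp rm N (ρ t) ≤
      (initialEnergy L rp rm ρ + κ / 2 * (2 / rm * Ck) + 16 * rp * cutoffConst +
        κ / 2 * (n * L ^ 2) * ((rp - rm) + 1)) * X from fun N hN t ht =>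
    (h.liftVolume_mono ht.1.le hN (le_max_left _ (max N₁ N₂))).trans
      (hlarge _ (le_max_right _ _) t ht)
  intro N hN t ht
  have hNN₁ : N₁ ≤ N := (le_max_left _ _).trans hN
  have hNN₂ : N₂ ≤ N := (le_max_right _ _).trans hN
  have hN0 : 0 < N := by linarith
  have h2N0 : 0 < 2 * N := by positivity
  set w : ℝ → ℝ := fun z => z * cutoff N z with hw_def
  have hw : ContDiff ℝ 2 w := contDiff_id.mul (contDiff_cutoff (k := 2) N)
  have hwR : ∀ z, 2 * N ≤ |z| → w z = 0 := fun z hz => by simp [w, cutoff_eq_zero hN0 hz]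
  have c1 := (contDiff_deriv hw).continuous
  have c2 := (contDiff_deriv hw).continuous_deriv_one
  have z1 : ∀ z, 2 * N ≤ |z| → deriv w z = 0 := fun z hz => by
    simp [w, deriv_id_mul_cutoff, cutoff_eq_zero hN0 hz, deriv_cutoff_eq_zero hN0 hz]
  have z2 : ∀ z, 2 * N ≤ |z| → deriv (deriv w) z = 0 := fun z hz => by
    simp [w, deriv_deriv_id_mul_cutoff, deriv_cutoff_eq_zero hN0 hz,
      deriv_deriv_cutoff_eq_zero hN0 hz]
  set a := κ / 2 * (1 / T * (2 / rm * (Ck * X))) + 16 * rp * cutoffConst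
  set b := κ / 2 * (n * L ^ 2 / (1 / T))
  have hb0 : 0 ≤ b := by positivity
  -- The rate of change of the truncated potential energy: advection gives a vertical flux with
  -- weight `(z χ_N)'`, diffusion a term with `(z χ_N)''`, which is bounded because the slab height
  -- compensates `1/N`.
  have hrate : ∀ τ ∈ Set.Ioc 0 T, -∫ x, ρ τ x * (vert (u τ x) * deriv w (vert x) +
      deriv (deriv w) (vert x)) ∂(normVol n L) ≤ a + b * dissipation L (2 * N) (ρ τ) := by
    intro τ hτ
    have c3 := h.continuous_density hτ.1
    have c4 := h.continuous_velocity hτ.1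
    have e : ∫ x, ρ τ x * (vert (u τ x) * deriv w (vert x) + deriv (deriv w) (vert x))
        ∂(normVol n L) = ∫ x, ρ τ x * vert (u τ x) * deriv w (vert x) ∂(normVol n L) +
          ∫ x, ρ τ x * deriv (deriv w) (vert x) ∂(normVol n L) := by
      rw [← integral_add
        (integrable_of_continuous hL (R := 2 * N) (by fun_prop)
          fun x hx => by simp [z1 _ hx.le])
        (integrable_of_continuous hL (R := 2 * N) (by fun_prop)
          fun x hx => by simp [z2 _ hx.le])]
      congr 1; ext x; ring
    -- With `l = 1/T`, integration over a time at most `T` costs one kinetic energy bound and `T`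
    -- times the dissipation bound; both are of order `1 + T(1 + D)`.
    have f1 := abs_integral_flux_le hL (h.toIsClassicalSolution.contDiff_velocity_space hτ.1)
      (h.periodic_velocity τ hτ.1.le) (h.incompressible τ hτ.1)
      (h.toIsClassicalSolution.velocity_tendsto hτ.1)
      ((h.contDiff_density_space τ hτ.1).of_le (by norm_num)) (h.periodic_density τ hτ.1.le)
      c1 hκ0.le h2N0 (abs_deriv_id_mul_cutoff_le hN0) (l := 1 / T) (by positivity)
    have f2 := (h.integral_sq_velocity_le hτ.1 h2N0).trans
      (mul_le_mul_of_nonneg_left (hkin (2 * N) (by linarith) τ hτ) (by positivity))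
    have f3 : |∫ x, ρ τ x * deriv (deriv w) (vert x) ∂(normVol n L)| ≤
        16 * rp * cutoffConst := by
      refine (abs_integral_le_of_slab hL (B := rp * (4 * cutoffConst / N)) (R := 2 * N)
        (by positivity) (fun x _ => ?_) fun x hx => by simp [z2 _ hx.le]).trans_eq
        (by field_simp; ring)
      rw [abs_mul]
      exact mul_le_mul (h.abs_density_le hτ.1.le x) (abs_deriv_deriv_id_mul_cutoff_le hN0 _)
        (abs_nonneg _) hrp.le
    have f4 : κ / 2 * (1 / T * ∫ x, ‖u τ x‖ ^ 2 * cutoff (2 * N) (vert x) ∂(normVol n L)) ≤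
        κ / 2 * (1 / T * (2 / rm * (Ck * X))) := by gcongr
    rw [e, neg_add]
    have g1 := (neg_le_abs _).trans f1
    have g3 := (neg_le_abs _).trans f3
    simp only [a, b]
    linarith
  have hstep : ∀ s, 0 < s → s ≤ t → ∫ x, -ρ t x * w (vert x) ∂(normVol n L) ≤
      ∫ x, -ρ s x * w (vert x) ∂(normVol n L) + (a * T + b * ((rp - rm) * D + 1)) := by
    intro s hs hst
    have hsub : Set.uIcc s t ⊆ Set.Ioi 0 := fun τ hτ => by
      rw [Set.uIcc_of_le hst] at hτ
      exact hs.trans_le hτ.1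
    have hbal := h.toIsClassicalSolution.integral_density_sub hL (φ := fun r => -r) contDiff_neg
      hw hwR hs hst
    have e1 : deriv (deriv fun r : ℝ => -r) = fun _ => 0 := by
      have : (deriv fun r : ℝ => -r) = fun _ => -1 := funext fun r => deriv_neg r
      rw [this]; simp
    simp only [e1, zero_mul, integral_zero, sub_zero] at hbal
    have ci := ((h.toIsClassicalSolution.continuousOn_flux continuous_neg hw hwR
      (L := L)).mono hsub).intervalIntegrable (μ := volume)
    have j2 := h.intervalIntegrable_dissipation h2N0 hs hst
    have hm := intervalIntegral.integral_mono_on hst ci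
      (intervalIntegrable_const.add (j2.const_mul b)) (g := fun τ => a +
        b * dissipation L (2 * N) (ρ τ)) fun τ hτ => by
        simp only [neg_mul, integral_neg]
        exact hrate τ ⟨hs.trans_le hτ.1, hτ.2.trans ht.2⟩
    rw [intervalIntegral.integral_add intervalIntegrable_const (j2.const_mul _),
      intervalIntegral.integral_const, intervalIntegral.integral_const_mul, smul_eq_mul] at hm
    have d2 := (hdiss (2 * N) (by linarith) s t hs hst ht.2).trans
      (add_le_add_left (mul_le_mul_of_nonneg_left (hD (2 * N) h2N0 t ht) hlt.le) 1)
    have m1 := mul_le_mul_of_nonneg_left d2 hb0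
    have m2 : (t - s) * a ≤ a * T := by
      rw [mul_comm]
      have : t - s ≤ T := by linarith [ht.2]
      gcongr
    linarith
  have hlim := (h.toIsClassicalSolution.tendsto_integral_density hL (φ := fun r => -r) contDiff_neg
    hw.continuous hwR (C₀ := rp) fun x => h.abs_density_le le_rfl x).add_const
    (a * T + b * ((rp - rm) * D + 1))
  have hfin := ge_of_tendsto hlim (by
    filter_upwards [Ioc_mem_nhdsGT ht.1] with s hs using hstep s hs.1 hs.2)
  rw [h.integral_neg_mul_eq hw.continuous hwR ht.1.le,
    h.integral_neg_mul_eq hw.continuous hwR le_rfl, h.liftVolume_eq ht.1.le,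
    h.liftVolume_eq le_rfl] at hfin
  have h0 := h.liftVolume_initial_le hN0
  have k1 : a * T = κ / 2 * (2 / rm * Ck) * X + 16 * rp * cutoffConst * T := by
    simp only [a]; field_simp
  have k2 : b * ((rp - rm) * D + 1) = κ / 2 * (n * L ^ 2) * (T * ((rp - rm) * D + 1)) := by
    simp only [b]; field_simp
  have k3 : T * ((rp - rm) * D + 1) ≤ ((rp - rm) + 1) * X := by
    have : (rp - rm) * D + 1 ≤ ((rp - rm) + 1) * (1 + D) := by nlinarith
    calc _ ≤ T * (((rp - rm) + 1) * (1 + D)) := by gcongr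
      _ = ((rp - rm) + 1) * (T * (1 + D)) := by ring
      _ ≤ _ := by gcongr; linarith
  have k4 : T ≤ X := by
    have : 0 ≤ T * D := by positivity
    rw [hX]; linarith
  have k5 : 1 ≤ X := by
    have : 0 ≤ T * (1 + D) := by positivity
    linarith
  have k6 : κ / 2 * (n * L ^ 2) * (T * ((rp - rm) * D + 1)) ≤
      κ / 2 * (n * L ^ 2) * (((rp - rm) + 1) * X) := by gcongr
  have k7 : 16 * rp * cutoffConst * T ≤ 16 * rp * cutoffConst * X := by gcongr
  have k8 : initialEnergy L rp rm ρ ≤ initialEnergy L rp rm ρ * X := le_mul_of_one_le_right hI k5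
  linarith

/-- The part of the mixing volume far from the interface is controlled by the potential energy. -/
lemma mixVolume_le_liftVolume (h : StratifiedSolution n L g rp rm ρ u p) {t : ℝ} (ht : 0 ≤ t)
    {N R : ℝ} (hN : 0 < N) (hR : 0 < R) : mixVolume L rp rm N (ρ t) ≤
      (rp - rm) * (2 * R) + 1 / R * liftVolume L rp rm N (ρ t) := by
  have hL := h.length_pos
  have hm : MeasurableSet {x : Space n | |vert x| ≤ R} :=
    measurableSet_le (by fun_prop) (by fun_prop)
  have i1 : Integrable ({x : Space n | |vert x| ≤ R}.indicator fun _ => rp - rm)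
      (normVol n L) := by
    refine (integrable_indicator_iff hm).2 (integrableOn_const ?_)
    rw [normVol_slab hL]; exact ENNReal.ofReal_ne_top
  have hind : ∫ x, {x : Space n | |vert x| ≤ R}.indicator (fun _ => rp - rm) x ∂(normVol n L)
      = (rp - rm) * (2 * R) := by
    rw [integral_indicator hm, setIntegral_const, Measure.real, normVol_slab hL,
      ENNReal.toReal_ofReal (by positivity), smul_eq_mul, mul_comm]
  rw [← hind, liftVolume, ← integral_const_mul,
    ← integral_add i1 ((h.integrable_liftVolume ht hN).const_mul _)]
  refine integral_mono (h.integrable_mixVolume ht hN)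
    (i1.add ((h.integrable_liftVolume ht hN).const_mul _)) fun x => ?_
  have hχ := cutoff_nonneg N (vert x)
  have h0 := abs_nonneg (stratified rp rm x - ρ t x)
  dsimp only
  by_cases hx : |vert x| ≤ R
  · have h1 : 0 ≤ 1 / R * (|stratified rp rm x - ρ t x| * (|vert x| * cutoff N (vert x))) := by
      positivity
    rw [Set.indicator_of_mem (show x ∈ {x : Space n | |vert x| ≤ R} from hx)]
    have h2 : |stratified rp rm x - ρ t x| * cutoff N (vert x) ≤ (rp - rm) * 1 :=
      mul_le_mul (h.abs_sub_le ht x) (cutoff_le_one _ _) hχ (sub_nonneg.2 h.light_lt.le)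
    linarith
  · rw [Set.indicator_of_notMem (show x ∉ {x : Space n | |vert x| ≤ R} from hx), zero_add]
    have h1 : 1 ≤ |vert x| / R := (one_le_div hR).2 (not_le.1 hx).le
    calc _ = 1 * (|stratified rp rm x - ρ t x| * cutoff N (vert x)) := (one_mul _).symm
      _ ≤ |vert x| / R * (|stratified rp rm x - ρ t x| * cutoff N (vert x)) := by gcongr
      _ = _ := by ring

/-- The mixing volume grows at most linearly and the potential energy at most quadratically. -/
theorem exists_growth_bound (h : StratifiedSolution n L g rp rm ρ u p) :
    ∃ C, 0 ≤ C ∧ ∀ T, 1 ≤ T → ∀ t ∈ Set.Ioc 0 T, ∀ N, 0 < N →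
      mixVolume L rp rm N (ρ t) ≤ C * T ∧ liftVolume L rp rm N (ρ t) ≤ C * T ^ 2 := by
  have hlt := sub_pos.2 h.light_lt
  obtain ⟨C, hC, hlift⟩ := h.exists_liftVolume_bound
  set Q := 4 * (rp - rm) * (C + 1) + 2
  have hQ : 0 ≤ Q := by positivity
  have hmix : ∀ T, 1 ≤ T → ∀ t ∈ Set.Ioc 0 T, ∀ N, 0 < N →
      mixVolume L rp rm N (ρ t) ≤ 2 * Q * T := by
    intro T hT
    have hT0 : 0 < T := by linarith
    -- The a priori bound `D₀` is used only for finiteness of the supremum, without which half of it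
    -- could not be absorbed below.
    obtain ⟨D₀, hD₀⟩ := h.exists_mixVolume_bound T
    set S := {m | ∃ N, 0 < N ∧ ∃ t ∈ Set.Ioc 0 T, m = mixVolume L rp rm N (ρ t)}
    have hbdd : BddAbove S := ⟨D₀, by rintro m ⟨N, hN, t, ht, rfl⟩; exact hD₀ N hN t ht⟩
    have hS : ∀ N, 0 < N → ∀ t ∈ Set.Ioc 0 T, mixVolume L rp rm N (ρ t) ≤ sSup S :=
      fun N hN t ht => le_csSup hbdd ⟨N, hN, t, ht, rfl⟩
    have hne : S.Nonempty := ⟨_, 1, one_pos, T, ⟨hT0, le_rfl⟩, rfl⟩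
    set D := sSup S
    have hD0 : 0 ≤ D := (mixVolume_nonneg _ _ _ _).trans (hS 1 one_pos T ⟨hT0, le_rfl⟩)
    -- The split height `R = 2(C + 1)T` gives `D` the coefficient `C/(2(C + 1)) ≤ 1/2` on the right,
    -- while the slab contributes a multiple of `T`.
    have hDle : D ≤ (rp - rm) * (2 * (2 * (C + 1) * T)) + 1 / (2 * (C + 1) * T) *
        (C * (1 + T * (1 + D))) := by
      refine csSup_le hne ?_
      rintro m ⟨N, hN, t, ht, rfl⟩
      refine (h.mixVolume_le_liftVolume ht.1.le hN
        (show 0 < 2 * (C + 1) * T by positivity)).trans ?_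
      gcongr
      exact hlift T D hT0 hS N hN t ht
    have h1 : 1 / (2 * (C + 1) * T) * (C * (1 + T * (1 + D))) ≤ 1 + D / 2 := by
      rw [one_div, inv_mul_le_iff₀ (by positivity)]
      have h2 : 1 + T * (1 + D) ≤ T * (2 + D) := by nlinarith
      calc C * (1 + T * (1 + D)) ≤ (C + 1) * (T * (2 + D)) := by gcongr; linarith
        _ = _ := by ring
    have hfin : D ≤ 2 * Q * T := by
      simp only [Q]
      nlinarith
    exact fun t ht N hN => (hS N hN t ht).trans hfin
  refine ⟨2 * Q + C * (2 + 2 * Q), by positivity, fun T hT t ht N hN => ⟨?_, ?_⟩⟩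
  · refine (hmix T hT t ht N hN).trans ?_
    have : 0 ≤ C * (2 + 2 * Q) := by positivity
    gcongr
    linarith
  -- The linear bound on the mixing volume is fed back into the estimate of the potential energy.
  · refine (hlift T (2 * Q * T) (by linarith) (fun N hN t ht => hmix T hT t ht N hN) N hN t
      ht).trans ?_
    have h1 : 1 + T * (1 + 2 * Q * T) ≤ (2 + 2 * Q) * T ^ 2 := by nlinarith
    have h2 : 0 ≤ 2 * Q * T ^ 2 := by positivity
    have h3 := mul_le_mul_of_nonneg_left h1 hC
    linarith

end StratifiedSolution

/-! ### An entropy whose dissipation controls the perimeter -/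

/-- A regularization of the entropy `-θ log θ - (1 - θ) log (1 - θ)` by exponentials. -/
def expEntropy (J : ℕ) (θ : ℝ) : ℝ := ∑ j ∈ Finset.range J,
  (1 / 2 ^ j) * ((1 - Real.exp (-2 ^ j * θ)) * (1 - Real.exp (-2 ^ j * (1 - θ))))

/-- The negative of the second derivative of `expEntropy`. -/
def expWeight (J : ℕ) (θ : ℝ) : ℝ := ∑ j ∈ Finset.range J,
  2 ^ j * (Real.exp (-2 ^ j * θ) + Real.exp (-2 ^ j * (1 - θ)))

lemma contDiff_expEntropy {k : ℕ∞} (J : ℕ) : ContDiff ℝ k (expEntropy J) := by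
  unfold expEntropy
  fun_prop

lemma continuous_expWeight (J : ℕ) : Continuous (expWeight J) := by
  unfold expWeight
  fun_prop

lemma hasDerivAt_exp_mul (a θ : ℝ) :
    HasDerivAt (fun θ => Real.exp (a * θ)) (a * Real.exp (a * θ)) θ := by
  simpa [mul_comm] using ((hasDerivAt_id θ).const_mul a).exp

lemma hasDerivAt_exp_mul_one_sub (a θ : ℝ) :
    HasDerivAt (fun θ => Real.exp (a * (1 - θ))) (-a * Real.exp (a * (1 - θ))) θ := by
  simpa [mul_comm] using (((hasDerivAt_id θ).const_sub 1).const_mul a).exp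

/-- The mixed terms `exp(-2^j)` cancel in the first derivative and the factor `1/2^j` cancels the
chain-rule factor, leaving a plain difference of exponentials. -/
lemma deriv_deriv_expEntropy (J : ℕ) : deriv (deriv (expEntropy J)) = fun θ => -expWeight J θ := by
  have h1 : deriv (expEntropy J) = fun θ => ∑ j ∈ Finset.range J,
      (Real.exp (-2 ^ j * θ) - Real.exp (-2 ^ j * (1 - θ))) := by
    funext θ
    have : ∀ j ∈ Finset.range J, HasDerivAt (fun θ => (1 / 2 ^ j) *
        ((1 - Real.exp (-2 ^ j * θ)) * (1 - Real.exp (-2 ^ j * (1 - θ)))))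
        (Real.exp (-2 ^ j * θ) - Real.exp (-2 ^ j * (1 - θ))) θ := fun j _ => by
      refine ((((hasDerivAt_exp_mul (-2 ^ j) θ).const_sub 1).mul
        ((hasDerivAt_exp_mul_one_sub (-2 ^ j) θ).const_sub 1)).const_mul _).congr_deriv ?_
      field_simp
      ring
    exact (HasDerivAt.fun_sum this).deriv
  rw [h1]
  funext θ
  have : ∀ j ∈ Finset.range J, HasDerivAt (fun θ =>
      (Real.exp (-2 ^ j * θ) - Real.exp (-2 ^ j * (1 - θ))))
      (-(2 ^ j * (Real.exp (-2 ^ j * θ) + Real.exp (-2 ^ j * (1 - θ))))) θ := fun j _ => by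
    refine ((hasDerivAt_exp_mul (-2 ^ j) θ).sub
      (hasDerivAt_exp_mul_one_sub (-2 ^ j) θ)).congr_deriv ?_
    ring
  rw [(HasDerivAt.fun_sum this).deriv, Finset.sum_neg_distrib, expWeight]

lemma expEntropy_one_sub (J : ℕ) (θ : ℝ) : expEntropy J (1 - θ) = expEntropy J θ := by
  unfold expEntropy
  refine Finset.sum_congr rfl fun j _ => ?_
  rw [sub_sub_cancel]
  ring

lemma expWeight_one_sub (J : ℕ) (θ : ℝ) : expWeight J (1 - θ) = expWeight J θ := by
  unfold expWeight
  refine Finset.sum_congr rfl fun j _ => ?_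
  rw [sub_sub_cancel]
  ring

lemma one_sub_exp_neg_mem {x : ℝ} (hx : 0 ≤ x) :
    0 ≤ 1 - Real.exp (-x) ∧ 1 - Real.exp (-x) ≤ 1 ∧ 1 - Real.exp (-x) ≤ x := by
  refine ⟨sub_nonneg.2 (Real.exp_le_one_iff.2 (by linarith)), ?_, ?_⟩
  · linarith [Real.exp_pos (-x)]
  · linarith [Real.add_one_le_exp (-x)]

lemma expEntropy_nonneg (J : ℕ) {θ : ℝ} (hθ : θ ∈ Set.Icc (0 : ℝ) 1) : 0 ≤ expEntropy J θ := by
  refine Finset.sum_nonneg fun j _ => ?_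
  have h1 := (one_sub_exp_neg_mem (x := 2 ^ j * θ) (mul_nonneg (by positivity) hθ.1)).1
  have h2 := (one_sub_exp_neg_mem (x := 2 ^ j * (1 - θ))
    (mul_nonneg (by positivity) (sub_nonneg.2 hθ.2))).1
  rw [neg_mul, neg_mul]
  positivity

/-- At most `a + 1` natural numbers lie below `a`. -/
lemma sum_indicator_lt_le (J : ℕ) {a : ℝ} (ha : 0 ≤ a) :
    ∑ j ∈ Finset.range J, (if (j : ℝ) < a then (1 : ℝ) else 0) ≤ a + 1 := by
  induction J generalizing a with
  | zero => simp; linarith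
  | succ J ih =>
    rw [Finset.sum_range_succ']
    rcases le_or_gt 1 a with h | h
    · have := ih (a := a - 1) (by linarith)
      have e : ∀ j : ℕ, ((j + 1 : ℕ) : ℝ) < a ↔ (j : ℝ) < a - 1 := fun j => by
        push_cast; exact lt_sub_iff_add_lt.symm
      simp only [e]
      have h2 : (if ((0 : ℕ) : ℝ) < a then (1 : ℝ) else 0) ≤ 1 := by split_ifs <;> norm_num
      linarith
    · rw [Finset.sum_eq_zero fun j _ => if_neg (by push_cast; linarith [j.cast_nonneg (α := ℝ)])]
      split_ifs <;> linarith

/-- The entropy is linear in `θ` up to a logarithm, which is traded for a weight. -/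
lemma expEntropy_le (J : ℕ) {θ a : ℝ} (hθ : θ ∈ Set.Icc (0 : ℝ) 1) (ha : 0 ≤ a) :
    expEntropy J θ ≤ ∑ j ∈ Finset.range J, (1 / 2 ^ j) * (if a ≤ j then (1 : ℝ) else 0) +
      (a + 1) * θ := by
  have hsum : (∑ j ∈ Finset.range J, (if (j : ℝ) < a then (1 : ℝ) else 0)) * θ ≤ (a + 1) * θ :=
    mul_le_mul_of_nonneg_right (sum_indicator_lt_le J ha) hθ.1
  refine le_trans ?_ (add_le_add_right hsum _)
  rw [Finset.sum_mul, ← Finset.sum_add_distrib]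
  refine Finset.sum_le_sum fun j _ => ?_
  obtain ⟨h1, h1', h1''⟩ := one_sub_exp_neg_mem (x := 2 ^ j * θ)
    (mul_nonneg (by positivity) hθ.1)
  obtain ⟨h2, h2', -⟩ := one_sub_exp_neg_mem (x := 2 ^ j * (1 - θ))
    (mul_nonneg (by positivity) (sub_nonneg.2 hθ.2))
  rw [neg_mul, neg_mul]
  have h3 : (1 / 2 ^ j : ℝ) * ((1 - Real.exp (-(2 ^ j * θ))) *
      (1 - Real.exp (-(2 ^ j * (1 - θ))))) ≤ 1 / 2 ^ j * (1 - Real.exp (-(2 ^ j * θ))) := by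
    gcongr
    exact mul_le_of_le_one_right h1 h2'
  refine h3.trans ?_
  -- For `j ≥ a` the factor `1 - exp(-2^j θ)` is bounded by `1`, for `j < a` by `2^j θ`; each of the
  -- latter levels contributes at most `θ`.
  rcases le_or_gt a j with h | h
  · rw [if_pos h, if_neg (not_lt.2 h), zero_mul, add_zero]
    gcongr
  · rw [if_neg (not_le.2 h), if_pos h, mul_zero, zero_add, one_mul]
    calc (1 / 2 ^ j : ℝ) * (1 - Real.exp (-(2 ^ j * θ))) ≤ 1 / 2 ^ j * (2 ^ j * θ) := by gcongr
      _ = θ := by field_simp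

lemma sum_one_div_two_pow_le (J : ℕ) : ∑ j ∈ Finset.range J, (1 / 2 ^ j : ℝ) ≤ 2 := by
  simpa [one_div, inv_pow] using sum_geometric_two_le J

lemma expEntropy_le_two (J : ℕ) {θ : ℝ} (hθ : θ ∈ Set.Icc (0 : ℝ) 1) : expEntropy J θ ≤ 2 := by
  refine (Finset.sum_le_sum fun j _ => ?_).trans (sum_one_div_two_pow_le J)
  obtain ⟨h1, h1', -⟩ := one_sub_exp_neg_mem (x := 2 ^ j * θ)
    (mul_nonneg (by positivity) hθ.1)
  obtain ⟨h2, h2', -⟩ := one_sub_exp_neg_mem (x := 2 ^ j * (1 - θ))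
    (mul_nonneg (by positivity) (sub_nonneg.2 hθ.2))
  rw [neg_mul, neg_mul]
  exact mul_le_of_le_one_right (by positivity) (mul_le_one₀ h1' h2 h2')

lemma sum_div_two_pow_le (J : ℕ) : ∑ j ∈ Finset.range J, (1 / 2 ^ j : ℝ) * j ≤ 2 := by
  have : ∑ j ∈ Finset.range J, (1 / 2 ^ j : ℝ) * j = 2 - 2 * (J + 1) / 2 ^ J := by
    induction J with
    | zero => simp
    | succ J ih =>
      rw [Finset.sum_range_succ, ih]
      push_cast
      field_simp
      ring
  rw [this]
  have : (0 : ℝ) ≤ 2 * (J + 1) / 2 ^ J := by positivity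
  linarith

lemma expWeight_pos {J : ℕ} (hJ : J ≠ 0) (θ : ℝ) : 0 < expWeight J θ :=
  Finset.sum_pos (fun j _ => by positivity) ⟨0, Finset.mem_range.2 (Nat.pos_of_ne_zero hJ)⟩

/-- The dyadic sum behaves like `1/θ` down to `θ` of order `2^{-(J+1)}`. In the induction the sum at
`θ` is twice the shorter sum at `2θ` plus `exp(-θ)`, so `θ` is doubled until `2θ > 1`; then `exp(-θ)
≥ 1/3` and `θ ≥ 1/2` give `1/6`. -/
lemma sum_exp_lower_bound (J : ℕ) {θ : ℝ} (hθ : θ ∈ Set.Icc (0 : ℝ) 1) :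
    1 / 6 ≤ (∑ j ∈ Finset.range (J + 1), 2 ^ j * Real.exp (-2 ^ j * θ)) *
      (θ + 1 / 2 ^ (J + 1)) := by
  have hexp : ∀ θ ∈ Set.Icc (0 : ℝ) 1, 1 / 3 ≤ Real.exp (-θ) := fun θ hθ => by
    have h1 : Real.exp (-1) ≤ Real.exp (-θ) := Real.exp_le_exp.2 (by linarith [hθ.2])
    refine le_trans ?_ h1
    rw [Real.exp_neg, one_div]
    exact inv_anti₀ (Real.exp_pos 1) (by linarith [Real.exp_one_lt_d9])
  induction J generalizing θ with
  | zero =>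
    have := hexp θ hθ
    simp only [zero_add, Finset.sum_range_one, pow_zero, one_mul, neg_mul, pow_one]
    nlinarith [hθ.1]
  | succ J ih =>
    have hs : ∑ j ∈ Finset.range (J + 1 + 1), 2 ^ j * Real.exp (-2 ^ j * θ) =
        2 * ∑ j ∈ Finset.range (J + 1), 2 ^ j * Real.exp (-2 ^ j * (2 * θ)) +
          Real.exp (-θ) := by
      rw [Finset.sum_range_succ', Finset.mul_sum]
      congr 1
      · refine Finset.sum_congr rfl fun j _ => ?_
        rw [pow_succ]
        ring_nf
      · simp
    have hnn : 0 ≤ ∑ j ∈ Finset.range (J + 1), 2 ^ j * Real.exp (-2 ^ j * (2 * θ)) := by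
      positivity
    rw [hs]
    have hp : (0 : ℝ) < 1 / 2 ^ (J + 1 + 1) := by positivity
    rcases le_or_gt (2 * θ) 1 with h | h
    · have h1 := ih (θ := 2 * θ) ⟨by linarith [hθ.1], h⟩
      refine h1.trans ?_
      have e : 2 * θ + 1 / 2 ^ (J + 1) = 2 * (θ + 1 / 2 ^ (J + 1 + 1)) := by
        rw [pow_succ 2 (J + 1)]; field_simp
      rw [e]
      have : 0 ≤ Real.exp (-θ) * (θ + 1 / 2 ^ (J + 1 + 1)) :=
        mul_nonneg (Real.exp_pos _).le (by linarith [hθ.1])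
      linarith
    · have h1 := hexp θ hθ
      nlinarith [hθ.1]

/-- The inverse weight is linear in `θ` up to the resolution of the finite sum, so its integral is a
mixing volume plus a small multiple of the slab height. -/
lemma inv_expWeight_le (J : ℕ) {θ : ℝ} (hθ : θ ∈ Set.Icc (0 : ℝ) 1) :
    (expWeight (J + 1) θ)⁻¹ ≤ 6 * (θ + 1 / 2 ^ (J + 1)) := by
  have h1 := sum_exp_lower_bound J hθ
  have hp : (0 : ℝ) < 1 / 2 ^ (J + 1) := by positivity
  have h2 : ∑ j ∈ Finset.range (J + 1), 2 ^ j * Real.exp (-2 ^ j * θ) ≤ expWeight (J + 1) θ := by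
    refine Finset.sum_le_sum fun j _ => ?_
    gcongr
    linarith [Real.exp_pos (-2 ^ j * (1 - θ))]
  rw [inv_le_iff_one_le_mul₀ (expWeight_pos (by omega) θ)]
  have h3 := mul_le_mul_of_nonneg_right h2 (show 0 ≤ θ + 1 / 2 ^ (J + 1) by linarith [hθ.1])
  linarith

/-! ### The perimeter -/

/-- The truncated perimeter, without the normalizing constant. -/
def truncPerimeter (L N : ℝ) (r : Space n → ℝ) : ℝ :=
  ∫ x, ‖gradient r x‖ * cutoff N (vert x) ∂(normVol n L)

lemma truncPerimeter_nonneg (N : ℝ) (r : Space n → ℝ) : 0 ≤ truncPerimeter L N r :=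
  integral_nonneg fun _ => mul_nonneg (norm_nonneg _) (cutoff_nonneg _ _)

/-- A weighted Cauchy–Schwarz inequality. -/
lemma sq_truncPerimeter_le (hL : 0 < L) {N : ℝ} (hN : 0 < N) {r : Space n → ℝ}
    (hr : ContDiff ℝ 1 r) {k : Space n → ℝ} (hk : Continuous k) (hk0 : ∀ x, 0 < k x) :
    truncPerimeter L N r ^ 2 ≤
      (∫ x, k x * ‖gradient r x‖ ^ 2 * cutoff N (vert x) ∂(normVol n L)) *
        ∫ x, (k x)⁻¹ * cutoff N (vert x) ∂(normVol n L) := by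
  have cg := continuous_gradient hr
  have ck : Continuous fun x => (k x)⁻¹ := hk.inv₀ fun x => (hk0 x).ne'
  set A := ∫ x, k x * ‖gradient r x‖ ^ 2 * cutoff N (vert x) ∂(normVol n L)
  set B := ∫ x, (k x)⁻¹ * cutoff N (vert x) ∂(normVol n L)
  set P := truncPerimeter L N r
  have iA : Integrable (fun x => k x * ‖gradient r x‖ ^ 2 * cutoff N (vert x)) (normVol n L) :=
    integrable_of_continuous hL (R := 2 * N) (by fun_prop)
      fun x hx => by simp [cutoff_eq_zero hN hx.le]
  have iB : Integrable (fun x => (k x)⁻¹ * cutoff N (vert x)) (normVol n L) :=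
    integrable_of_continuous hL (R := 2 * N) (by fun_prop)
      fun x hx => by simp [cutoff_eq_zero hN hx.le]
  have iP : Integrable (fun x => ‖gradient r x‖ * cutoff N (vert x)) (normVol n L) :=
    integrable_of_continuous hL (R := 2 * N) (by fun_prop)
      fun x hx => by simp [cutoff_eq_zero hN hx.le]
  -- This quadratic in `s` is the integral of `k⁻¹ (s - k |∇r|)² χ_N`. Its discriminant is therefore
  -- nonpositive, which is the claim.
  have hquad : ∀ s : ℝ, 0 ≤ B * (s * s) + (-2 * P) * s + A := fun s => by
    have e : B * (s * s) + (-2 * P) * s + A = ∫ x, ((s * s) * ((k x)⁻¹ * cutoff N (vert x)) +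
        (-2 * s) * (‖gradient r x‖ * cutoff N (vert x)) +
        k x * ‖gradient r x‖ ^ 2 * cutoff N (vert x)) ∂(normVol n L) := by
      have iB' := iB.const_mul (s * s)
      have iP' := iP.const_mul (-2 * s)
      have iBP : Integrable (fun x => (s * s) * ((k x)⁻¹ * cutoff N (vert x)) +
        (-2 * s) * (‖gradient r x‖ * cutoff N (vert x))) (normVol n L) := iB'.add iP'
      rw [integral_add iBP iA, integral_add iB' iP', integral_const_mul, integral_const_mul]
      change _ = s * s * B + -2 * s * P + A
      ring
    rw [e]
    refine integral_nonneg fun x => ?_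
    have hk := hk0 x
    have e2 : (s * s) * ((k x)⁻¹ * cutoff N (vert x)) +
        (-2 * s) * (‖gradient r x‖ * cutoff N (vert x)) +
        k x * ‖gradient r x‖ ^ 2 * cutoff N (vert x) =
        (k x)⁻¹ * (s - k x * ‖gradient r x‖) ^ 2 * cutoff N (vert x) := by
      field_simp
      ring
    change 0 ≤ (s * s) * ((k x)⁻¹ * cutoff N (vert x)) +
        (-2 * s) * (‖gradient r x‖ * cutoff N (vert x)) +
        k x * ‖gradient r x‖ ^ 2 * cutoff N (vert x)
    rw [e2]
    exact mul_nonneg (mul_nonneg (inv_nonneg.2 hk.le) (sq_nonneg _)) (cutoff_nonneg _ _)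
  have := discrim_le_zero hquad
  rw [discrim] at this
  nlinarith

lemma IsClassicalSolution.continuousOn_truncPerimeter {g : ℝ} {ρ : ℝ → Space n → ℝ}
    {u : ℝ → Space n → Space n} {p : ℝ → Space n → ℝ} (h : IsClassicalSolution n L g ρ u p)
    {N : ℝ} (hN : 0 < N) :
    ContinuousOn (fun τ => truncPerimeter L N (ρ τ)) (Set.Ioi 0) := by
  refine continuousOn_integral_time (R := 2 * N) ?_
    fun t _ x hx => by simp [cutoff_eq_zero hN hx.le]
  have c1 := h.continuousOn_gradient
  have c2 := continuous_cutoff N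
  fun_prop

lemma deriv_deriv_comp_affine {E : ℝ → ℝ} (hE : ContDiff ℝ 2 E) (a δ : ℝ) :
    deriv (deriv fun r => E ((r - a) / δ)) = fun r => deriv (deriv E) ((r - a) / δ) / δ ^ 2 := by
  have haff : ∀ r, HasDerivAt (fun r : ℝ => (r - a) / δ) (1 / δ) r := fun r =>
    ((hasDerivAt_id r).sub_const a).div_const δ
  have h1 : deriv (fun r => E ((r - a) / δ)) = fun r => deriv E ((r - a) / δ) * (1 / δ) :=
    funext fun r => (HasDerivAt.comp (h₂ := E) r
      (hE.differentiable two_ne_zero _).hasDerivAt (haff r)).deriv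
  have hE1 := (contDiff_deriv hE).differentiable one_ne_zero
  rw [h1]
  funext r
  have h2 : HasDerivAt (fun r => deriv E ((r - a) / δ) * (1 / δ))
      (deriv (deriv E) ((r - a) / δ) * (1 / δ) * (1 / δ)) r :=
    (HasDerivAt.comp (h₂ := deriv E) r (hE1 _).hasDerivAt (haff r)).mul_const (1 / δ)
  rw [h2.deriv]
  ring

namespace StratifiedSolution
variable {g rp rm : ℝ} {ρ : ℝ → Space n → ℝ} {u : ℝ → Space n → Space n} {p : ℝ → Space n → ℝ}

/-- A symmetric function of the volume fraction only depends on the distance to the stratified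
profile. -/
lemma symmetric_eq (h : StratifiedSolution n L g rp rm ρ u p) {F : ℝ → ℝ}
    (hF : ∀ θ, F (1 - θ) = F θ) {t : ℝ} (ht : 0 ≤ t) (x : Space n) :
    F ((ρ t x - rm) / (rp - rm)) = F (|stratified rp rm x - ρ t x| / (rp - rm)) := by
  have hlt := (sub_pos.2 h.light_lt).ne'
  obtain ⟨h1, h2⟩ := h.mem_Icc ht x
  rw [stratified]
  split_ifs with hx
  · rw [abs_of_nonneg (sub_nonneg.2 h2), ← hF]
    congr 1
    field_simp
    ring
  · rw [abs_sub_comm, abs_of_nonneg (sub_nonneg.2 h1)]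

lemma fraction_mem_Icc (h : StratifiedSolution n L g rp rm ρ u p) {t : ℝ} (ht : 0 ≤ t)
    (x : Space n) : |stratified rp rm x - ρ t x| / (rp - rm) ∈ Set.Icc (0 : ℝ) 1 := by
  have hlt := sub_pos.2 h.light_lt
  exact ⟨by positivity, (div_le_one hlt).2 (h.abs_sub_le ht x)⟩

/-- The threshold in `expEntropy_le` is taken to be `a = |z|`. The part independent of `θ` then has
total integral at most `∑ 2 j / 2^j ≤ 4` over the strip, while `(|z| + 1) θ` produces the potential
energy and the mixing volume. -/
lemma integral_expEntropy_le (h : StratifiedSolution n L g rp rm ρ u p) {t : ℝ} (ht : 0 < t)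
    {N : ℝ} (hN : 0 < N) (J : ℕ) :
    ∫ x, expEntropy J ((ρ t x - rm) / (rp - rm)) * cutoff N (vert x) ∂(normVol n L) ≤
      4 + 1 / (rp - rm) * (liftVolume L rp rm N (ρ t) + mixVolume L rp rm N (ρ t)) := by
  have hL := h.length_pos
  have hlt := sub_pos.2 h.light_lt
  have cρ := h.continuous_density ht
  have cE := (contDiff_expEntropy (k := 0) J).continuous
  have i0 : ∀ j : ℕ, Integrable (fun x : Space n => if |vert x| ≤ j then (1 : ℝ) else 0)
      (normVol n L) := fun j => by
    refine integrable_of_slab hL (B := 1) (R := j) ?_ (fun x _ => ?_)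
      fun x hx => if_neg (not_le.2 hx)
    · exact (Measurable.ite (measurableSet_le (by fun_prop) (by fun_prop)) measurable_const
        measurable_const).aestronglyMeasurable
    · split_ifs <;> simp
  have i1 : Integrable (fun x : Space n => ∑ j ∈ Finset.range J,
      (1 / 2 ^ j : ℝ) * (if |vert x| ≤ j then (1 : ℝ) else 0)) (normVol n L) :=
    integrable_finsetSum _ fun j _ => (i0 j).const_mul _
  have i2 := h.integrable_liftVolume ht.le hN
  have i3 := h.integrable_mixVolume ht.le hN
  have i4 : Integrable (fun x => 1 / (rp - rm) *
      (|stratified rp rm x - ρ t x| * (|vert x| * cutoff N (vert x)) +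
        |stratified rp rm x - ρ t x| * cutoff N (vert x))) (normVol n L) :=
    (i2.add i3).const_mul _
  have e1 : ∫ x : Space n, (∑ j ∈ Finset.range J,
      (1 / 2 ^ j : ℝ) * (if |vert x| ≤ j then (1 : ℝ) else 0)) ∂(normVol n L) ≤ 4 := by
    rw [integral_finsetSum _ fun j _ => (i0 j).const_mul _]
    have : ∀ j ∈ Finset.range J, ∫ x : Space n, (1 / 2 ^ j : ℝ) *
        (if |vert x| ≤ j then (1 : ℝ) else 0) ∂(normVol n L) = 2 * ((1 / 2 ^ j : ℝ) * j) := by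
      intro j _
      have hm : MeasurableSet {x : Space n | |vert x| ≤ j} :=
        measurableSet_le (by fun_prop) (by fun_prop)
      have e : (fun x : Space n => if |vert x| ≤ j then (1 : ℝ) else 0) =
          {x : Space n | |vert x| ≤ j}.indicator fun _ => 1 := by
        ext x; simp [Set.indicator_apply]
      rw [integral_const_mul, e, integral_indicator hm, setIntegral_const, Measure.real,
        normVol_slab hL, ENNReal.toReal_ofReal (by positivity), smul_eq_mul]
      ring
    rw [Finset.sum_congr rfl this, ← Finset.mul_sum]
    linarith [sum_div_two_pow_le J]
  calc _ ≤ ∫ x, ((∑ j ∈ Finset.range J, (1 / 2 ^ j : ℝ) * (if |vert x| ≤ j then (1 : ℝ) else 0)) +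
        1 / (rp - rm) * (|stratified rp rm x - ρ t x| * (|vert x| * cutoff N (vert x)) +
        |stratified rp rm x - ρ t x| * cutoff N (vert x))) ∂(normVol n L) := by
        refine integral_mono (integrable_of_continuous hL (R := 2 * N) (by fun_prop)
          fun x hx => by simp [cutoff_eq_zero hN hx.le]) (i1.add i4) fun x => ?_
        dsimp only
        rw [h.symmetric_eq (F := expEntropy J) (expEntropy_one_sub J) ht.le]
        have hb := expEntropy_le J (h.fraction_mem_Icc ht.le x) (abs_nonneg (vert x))
        have hχ0 := cutoff_nonneg N (vert x)
        have hχ1 := cutoff_le_one N (vert x)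
        have hs : 0 ≤ ∑ j ∈ Finset.range J,
            (1 / 2 ^ j : ℝ) * (if |vert x| ≤ j then (1 : ℝ) else 0) :=
          Finset.sum_nonneg fun j _ => by split_ifs <;> positivity
        calc _ ≤ _ := mul_le_mul_of_nonneg_right hb hχ0
          _ ≤ (∑ j ∈ Finset.range J, (1 / 2 ^ j : ℝ) * (if |vert x| ≤ j then (1 : ℝ) else 0)) +
              (|vert x| + 1) * (|stratified rp rm x - ρ t x| / (rp - rm)) *
              cutoff N (vert x) := by
              rw [add_mul]
              gcongr
              exact mul_le_of_le_one_right hs hχ1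
          _ = _ := by ring
    _ ≤ _ := by
        rw [integral_add i1 i4, integral_const_mul, integral_add i2 i3]
        exact add_le_add_left e1 _

/-- The condition `N ≤ 2^(J+1)` makes the resolution error `2^{-(J+1)}`, integrated over a slab of
height `4N`, at most `4`. -/
lemma integral_inv_expWeight_le (h : StratifiedSolution n L g rp rm ρ u p) {t : ℝ} (ht : 0 < t)
    {N : ℝ} (hN : 0 < N) {J : ℕ} (hJ : N ≤ 2 ^ (J + 1)) :
    ∫ x, (expWeight (J + 1) ((ρ t x - rm) / (rp - rm)))⁻¹ * cutoff N (vert x) ∂(normVol n L) ≤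
      6 * (1 / (rp - rm) * mixVolume L rp rm N (ρ t) + 4) := by
  have hL := h.length_pos
  have cρ := h.continuous_density ht
  have cE := continuous_expWeight (J + 1)
  have cE' : Continuous fun x => (expWeight (J + 1) ((ρ t x - rm) / (rp - rm)))⁻¹ :=
    Continuous.inv₀ (by fun_prop) fun x => (expWeight_pos (by omega) _).ne'
  have i1 : Integrable (fun x : Space n => cutoff N (vert x)) (normVol n L) :=
    integrable_of_continuous hL (R := 2 * N) (by fun_prop) fun x hx => cutoff_eq_zero hN hx.le
  have i2 := h.integrable_mixVolume ht.le hN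
  have e1 : 1 / 2 ^ (J + 1) * ∫ x, cutoff N (vert x) ∂(normVol n L) ≤ 4 := by
    have h1 : ∫ x, cutoff N (vert x) ∂(normVol n L) ≤ 1 * (2 * (2 * N)) :=
      (le_abs_self _).trans (abs_integral_le_of_slab hL (by positivity) (fun x _ => by
        rw [abs_of_nonneg (cutoff_nonneg _ _)]; exact cutoff_le_one _ _)
        fun x hx => cutoff_eq_zero hN hx.le)
    rw [one_div, inv_mul_le_iff₀ (by positivity)]
    linarith
  have i12 : Integrable (fun x => 6 * (1 / (rp - rm) * (|stratified rp rm x - ρ t x| *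
      cutoff N (vert x)) + 1 / 2 ^ (J + 1) * cutoff N (vert x))) (normVol n L) :=
    ((i2.const_mul _).add (i1.const_mul _)).const_mul _
  calc _ ≤ ∫ x, 6 * (1 / (rp - rm) * (|stratified rp rm x - ρ t x| * cutoff N (vert x)) +
        1 / 2 ^ (J + 1) * cutoff N (vert x)) ∂(normVol n L) := by
        refine integral_mono (integrable_of_continuous hL (R := 2 * N) (by fun_prop)
          fun x hx => by simp [cutoff_eq_zero hN hx.le]) i12 fun x => ?_
        dsimp only
        rw [h.symmetric_eq (F := expWeight (J + 1)) (expWeight_one_sub (J + 1)) ht.le]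
        refine (mul_le_mul_of_nonneg_right (inv_expWeight_le J (h.fraction_mem_Icc ht.le x))
          (cutoff_nonneg _ _)).trans_eq ?_
        ring
    _ ≤ _ := by
        rw [integral_const_mul, integral_add (i2.const_mul _) (i1.const_mul _),
          integral_const_mul, integral_const_mul]
        exact mul_le_mul_of_nonneg_left (add_le_add_right e1 _) (by norm_num)

/-- The square of the perimeter is integrable in time, with at most cubic growth. -/
theorem exists_truncPerimeter_bound (h : StratifiedSolution n L g rp rm ρ u p) :
    ∃ C, 0 ≤ C ∧ ∀ T, 1 ≤ T → ∃ N₀ : ℝ, 1 ≤ N₀ ∧ ∀ N, N₀ ≤ N → ∀ s ∈ Set.Ioc 0 T,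
      ∫ τ in s..T, truncPerimeter L N (ρ τ) ^ 2 ≤ C * T ^ 3 := by
  have hL := h.length_pos
  have hlt := sub_pos.2 h.light_lt
  set δ := rp - rm with hδ
  obtain ⟨C, hC, hgrow⟩ := h.exists_growth_bound
  refine ⟨(δ ^ 2 * (6 * (1 / δ * C + 4))) * (5 + 1 / δ * (2 * C)), by positivity,
    fun T hT => ?_⟩
  have hT0 : 0 < T := by linarith
  obtain ⟨N₀, hN₀, hdiss⟩ := h.exists_dissipation_bound T (M := 2) (by norm_num)
  refine ⟨N₀, hN₀, fun N hN s hs => ?_⟩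
  have hN0 : 0 < N := by linarith
  -- The number of levels depends on `N`. This is legitimate because `N₀` was obtained for every
  -- function with values in `[0, 2]`, a range shared by all these entropies.
  obtain ⟨J, hJ⟩ := pow_unbounded_of_one_lt N (one_lt_two : (1 : ℝ) < 2)
  have hJ' : N ≤ 2 ^ (J + 1) := hJ.le.trans (pow_le_pow_right₀ one_le_two (by omega))
  set φ : ℝ → ℝ := fun r => expEntropy (J + 1) ((r - rm) / δ) with hφ_def
  have hE : ContDiff ℝ 2 (expEntropy (J + 1)) := contDiff_expEntropy (k := 2) _
  have hφ : ContDiff ℝ 2 φ := hE.comp (by fun_prop)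
  have hφ2 : ∀ r, -deriv (deriv φ) r = expWeight (J + 1) ((r - rm) / δ) / δ ^ 2 := fun r => by
    rw [hφ_def, deriv_deriv_comp_affine hE, deriv_deriv_expEntropy]
    ring
  have hφM : ∀ r ∈ Set.Icc rm rp, 0 ≤ φ r ∧ φ r ≤ 2 := fun r hr => by
    have : (r - rm) / δ ∈ Set.Icc (0 : ℝ) 1 :=
      ⟨div_nonneg (by linarith [hr.1]) hlt.le, (div_le_one hlt).2 (by linarith [hr.2])⟩
    exact ⟨expEntropy_nonneg _ this, expEntropy_le_two _ this⟩
  have hd := hdiss N hN φ hφ hφM s T hs.1 hs.2 le_rfl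
  have hTT : T ∈ Set.Ioc 0 T := ⟨hT0, le_rfl⟩
  obtain ⟨hm, hl⟩ := hgrow T hT T hTT N hN0
  have hent : ∫ x, φ (ρ T x) * cutoff N (vert x) ∂(normVol n L) + 1 ≤
      (5 + 1 / δ * (2 * C)) * T ^ 2 := by
    have h1 := h.integral_expEntropy_le hT0 hN0 (J + 1)
    have h2 : 1 / δ * (liftVolume L rp rm N (ρ T) + mixVolume L rp rm N (ρ T)) ≤
        1 / δ * (2 * C * T ^ 2) := by
      gcongr
      have : C * T ≤ C * T ^ 2 := by gcongr; nlinarith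
      linarith
    have h3 : 1 ≤ T ^ 2 := by nlinarith
    rw [add_mul]
    simp only [hφ_def, hδ] at h1 h2 ⊢
    linarith
  have hsub : Set.uIcc s T ⊆ Set.Ioi 0 := fun τ hτ => by
    rw [Set.uIcc_of_le hs.2] at hτ
    exact hs.1.trans_le hτ.1
  have c1 : ContinuousOn (fun τ => truncPerimeter L N (ρ τ) ^ 2) (Set.uIcc s T) :=
    ((h.toIsClassicalSolution.continuousOn_truncPerimeter hN0).pow 2).mono hsub
  have c2 := (h.toIsClassicalSolution.continuousOn_dissipation
    (contDiff_deriv hφ).continuous_deriv_one.neg (continuous_cutoff N)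
    (fun z hz => cutoff_eq_zero hN0 hz) (L := L)).mono hsub
  -- Cauchy–Schwarz with weight `-φ''(ρ)`: the integral of the inverse weight is `O(T)` uniformly in
  -- `τ`, and the other factor, once integrated in time, is bounded by the entropy at time `T`,
  -- which is `O(T²)`.
  have hpt : ∀ τ ∈ Set.Icc s T, truncPerimeter L N (ρ τ) ^ 2 ≤
      (δ ^ 2 * (6 * (1 / δ * C + 4)) * T) *
        ∫ x, -deriv (deriv φ) (ρ τ x) * ‖gradient (ρ τ) x‖ ^ 2 * cutoff N (vert x)
          ∂(normVol n L) := by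
    intro τ hτ
    have hτ0 := hs.1.trans_le hτ.1
    have cρ := h.continuous_density hτ0
    have cφ := (contDiff_deriv hφ).continuous_deriv_one
    have hpos : ∀ r, 0 < -deriv (deriv φ) r := fun r => by
      rw [hφ2]
      exact div_pos (expWeight_pos (by omega) _) (by positivity)
    refine (sq_truncPerimeter_le hL hN0 ((h.contDiff_density_space τ hτ0).of_le (by norm_num))
      (k := fun x => -deriv (deriv φ) (ρ τ x)) (by fun_prop) fun x => hpos _).trans ?_
    rw [mul_comm]
    refine mul_le_mul_of_nonneg_right ?_ (integral_nonneg fun x => mul_nonneg (mul_nonneg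
      (hpos _).le (sq_nonneg _)) (cutoff_nonneg _ _))
    have hw := h.integral_inv_expWeight_le hτ0 hN0 hJ'
    have hmx := (hgrow T hT τ ⟨hτ0, hτ.2⟩ N hN0).1
    calc _ = δ ^ 2 * ∫ x, (expWeight (J + 1) ((ρ τ x - rm) / (rp - rm)))⁻¹ * cutoff N (vert x)
          ∂(normVol n L) := by
          rw [← integral_const_mul]
          congr 1; ext x
          rw [hφ2, inv_div, hδ]
          ring
      _ ≤ δ ^ 2 * (6 * (1 / δ * (C * T) + 4 * T)) := by
          refine mul_le_mul_of_nonneg_left (hw.trans ?_) (by positivity)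
          gcongr
          linarith
      _ = _ := by ring
  calc _ ≤ ∫ τ in s..T, (δ ^ 2 * (6 * (1 / δ * C + 4)) * T) *
        ∫ x, -deriv (deriv φ) (ρ τ x) * ‖gradient (ρ τ) x‖ ^ 2 * cutoff N (vert x)
          ∂(normVol n L) :=
        intervalIntegral.integral_mono_on hs.2 c1.intervalIntegrable
          (c2.intervalIntegrable.const_mul _) hpt
    _ ≤ (δ ^ 2 * (6 * (1 / δ * C + 4)) * T) * ((5 + 1 / δ * (2 * C)) * T ^ 2) := by
        rw [intervalIntegral.integral_const_mul]
        exact mul_le_mul_of_nonneg_left (hd.trans hent) (by positivity)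
    _ = _ := by ring

end StratifiedSolution

/-! ### Removing the cutoffs -/

/-- Monotone convergence; the heights `2^k` are used because the cutoffs increase when the scale
doubles. -/
lemma tendsto_lintegral_mul_cutoff {f : Space n → ℝ} (hf : AEMeasurable f (normVol n L))
    (hf0 : ∀ x, 0 ≤ f x) :
    Tendsto (fun k : ℕ => ∫⁻ x, ENNReal.ofReal (f x * cutoff (2 ^ k) (vert x)) ∂(normVol n L))
      atTop (𝓝 (∫⁻ x, ENNReal.ofReal (f x) ∂(normVol n L))) := by
  refine lintegral_tendsto_of_tendsto_of_monotone (fun k => ?_)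
    (Eventually.of_forall fun x => ?_) (Eventually.of_forall fun x => ?_)
  · exact (hf.mul (Measurable.aemeasurable
      ((continuous_cutoff _).comp continuous_vert).measurable)).ennreal_ofReal
  · refine monotone_nat_of_le_succ fun k => ENNReal.ofReal_le_ofReal ?_
    exact mul_le_mul_of_nonneg_left (cutoff_le_cutoff (by positivity)
      (by rw [pow_succ, mul_comm]) _) (hf0 x)
  · refine tendsto_const_nhds.congr' ?_
    obtain ⟨K, hK⟩ := pow_unbounded_of_one_lt |vert x| (one_lt_two : (1 : ℝ) < 2)
    filter_upwards [eventually_ge_atTop K] with k hk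
    rw [cutoff_eq_one (by positivity) (hK.le.trans (pow_le_pow_right₀ one_le_two hk)), mul_one]

/-- Bounds that are uniform in the height of the cutoff pass to the limit and give integrability at
the same time. -/
lemma integrable_of_cutoff {f : Space n → ℝ} (hf : AEStronglyMeasurable f (normVol n L))
    (hf0 : ∀ x, 0 ≤ f x) {B : ℝ}
    (hi : ∀ N, 0 < N → Integrable (fun x => f x * cutoff N (vert x)) (normVol n L))
    (hB : ∀ N, 0 < N → ∫ x, f x * cutoff N (vert x) ∂(normVol n L) ≤ B) :
    Integrable f (normVol n L) ∧ ∫ x, f x ∂(normVol n L) ≤ B := by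
  have hB0 : 0 ≤ B := (integral_nonneg fun x => mul_nonneg (hf0 x) (cutoff_nonneg _ _)).trans
    (hB 1 one_pos)
  have hle : ∫⁻ x, ENNReal.ofReal (f x) ∂(normVol n L) ≤ ENNReal.ofReal B := by
    refine le_of_tendsto' (tendsto_lintegral_mul_cutoff hf.aemeasurable hf0) fun k => ?_
    rw [← ofReal_integral_eq_lintegral_ofReal (hi _ (by positivity))
      (Eventually.of_forall fun x => mul_nonneg (hf0 x) (cutoff_nonneg _ _))]
    exact ENNReal.ofReal_le_ofReal (hB _ (by positivity))
  have hint : Integrable f (normVol n L) :=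
    (lintegral_ofReal_ne_top_iff_integrable hf (Eventually.of_forall hf0)).1
      (hle.trans_lt ENNReal.ofReal_lt_top).ne
  refine ⟨hint, ?_⟩
  rwa [← ENNReal.ofReal_le_ofReal_iff hB0,
    ofReal_integral_eq_lintegral_ofReal hint (Eventually.of_forall hf0)]

lemma tendsto_truncPerimeter (hL : 0 < L) {r : Space n → ℝ} (hr : ContDiff ℝ 1 r) :
    Tendsto (fun k : ℕ => ENNReal.ofReal (truncPerimeter L (2 ^ k) r)) atTop
      (𝓝 (∫⁻ x, ‖gradient r x‖ₑ ∂(normVol n L))) := by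
  have cg := continuous_gradient hr
  have h := tendsto_lintegral_mul_cutoff (L := L) (f := fun x => ‖gradient r x‖)
    (Continuous.aemeasurable (by fun_prop)) fun x => norm_nonneg _
  simp only [ofReal_norm] at h
  refine h.congr fun k => ?_
  have h2 : (0 : ℝ) < 2 ^ k := by positivity
  rw [truncPerimeter, ofReal_integral_eq_lintegral_ofReal
    (integrable_of_continuous hL (R := 2 * 2 ^ k) (by fun_prop)
      fun x hx => by simp [cutoff_eq_zero h2 hx.le])
    (Eventually.of_forall fun x => mul_nonneg (norm_nonneg _) (cutoff_nonneg _ _))]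

namespace StratifiedSolution
variable {g rp rm : ℝ} {ρ : ℝ → Space n → ℝ} {u : ℝ → Space n → Space n} {p : ℝ → Space n → ℝ}

lemma aestronglyMeasurable_stratified_sub (h : StratifiedSolution n L g rp rm ρ u p) {t : ℝ}
    (ht : 0 ≤ t) :
    AEStronglyMeasurable (fun x => stratified rp rm x - ρ t x) (normVol n L) :=
  (measurable_stratified rp rm).aestronglyMeasurable.sub (h.aestronglyMeasurable_density ht)

/-- The potential energy and the mixing entropy are finite, and grow at most like `t ^ 2` and
`t`. -/
theorem exists_energy_bound (h : StratifiedSolution n L g rp rm ρ u p) :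
    ∃ C, 0 ≤ C ∧ ∀ T, 1 ≤ T → ∀ t ∈ Set.Ioc 0 T,
      Integrable (potDensity g rp rm (ρ t)) (normVol n L) ∧
      Integrable (mixDensity rp rm (ρ t)) (normVol n L) ∧
      potentialEnergy L g rp rm (ρ t) ≤ C * T ^ 2 ∧ mixingEntropy L rp rm (ρ t) ≤ C * T := by
  have hlt := sub_pos.2 h.light_lt
  have hg := h.gravity_pos
  obtain ⟨C, hC, hgrow⟩ := h.exists_growth_bound
  refine ⟨1 / (rp - rm) * (g * C) + 1 / (rp - rm) ^ 2 * ((rp - rm) * C), by positivity,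
    fun T hT t ht => ?_⟩
  have hT0 : 0 < T := by linarith
  have hmeas := h.aestronglyMeasurable_stratified_sub ht.1.le
  obtain ⟨i1, b1⟩ := integrable_of_cutoff (L := L)
    (f := fun x => |stratified rp rm x - ρ t x| * |vert x|) (B := C * T ^ 2)
    (hmeas.norm.mul (Continuous.aestronglyMeasurable (by fun_prop))) (fun x => by positivity)
    (fun N hN => by simpa only [mul_assoc] using h.integrable_liftVolume ht.1.le hN)
    (fun N hN => by simpa only [liftVolume, mul_assoc] using (hgrow T hT t ht N hN).2)
  obtain ⟨i2, b2⟩ := integrable_of_cutoff (L := L)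
    (f := fun x => |stratified rp rm x - ρ t x|) (B := C * T)
    hmeas.norm (fun x => by positivity)
    (fun N hN => h.integrable_mixVolume ht.1.le hN)
    (fun N hN => (hgrow T hT t ht N hN).1)
  have e1 : potDensity g rp rm (ρ t) = fun x => g * (|stratified rp rm x - ρ t x| * |vert x|) := by
    funext x
    rw [← h.sub_mul_vert ht.1.le, potDensity]
    ring
  have hm : ∀ x, 0 ≤ mixDensity rp rm (ρ t) x ∧
      mixDensity rp rm (ρ t) x ≤ (rp - rm) * |stratified rp rm x - ρ t x| := fun x => by
    obtain ⟨h1, h2⟩ := h.mem_Icc ht.1.le x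
    refine ⟨mul_nonneg (sub_nonneg.2 h2) (sub_nonneg.2 h1), ?_⟩
    rw [stratified, mixDensity]
    split_ifs
    · rw [abs_of_nonneg (sub_nonneg.2 h2), mul_comm]
      exact mul_le_mul_of_nonneg_right (by linarith) (by linarith)
    · rw [abs_sub_comm, abs_of_nonneg (sub_nonneg.2 h1)]
      exact mul_le_mul_of_nonneg_right (by linarith) (by linarith)
  have hρ := h.aestronglyMeasurable_density ht.1.le
  have i3 : Integrable (mixDensity rp rm (ρ t)) (normVol n L) := by
    refine (i2.const_mul (rp - rm)).mono'
      ((aestronglyMeasurable_const.sub hρ).mul (hρ.sub aestronglyMeasurable_const))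
      (Eventually.of_forall fun x => ?_)
    rw [Real.norm_eq_abs, abs_of_nonneg (hm x).1]
    exact (hm x).2
  refine ⟨e1 ▸ i1.const_mul g, i3, ?_, ?_⟩
  · rw [potentialEnergy, e1, integral_const_mul]
    calc _ ≤ 1 / (rp - rm) * (g * (C * T ^ 2)) := by gcongr
      _ = 1 / (rp - rm) * (g * C) * T ^ 2 := by ring
      _ ≤ _ := by
          have : 0 ≤ 1 / (rp - rm) ^ 2 * ((rp - rm) * C) := by positivity
          gcongr
          linarith
  · rw [mixingEntropy]
    have hle : ∫ x, mixDensity rp rm (ρ t) x ∂(normVol n L) ≤ (rp - rm) * (C * T) := by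
      refine (integral_mono i3 (i2.const_mul _) fun x => (hm x).2).trans ?_
      rw [integral_const_mul]
      gcongr
    calc _ ≤ 1 / (rp - rm) ^ 2 * ((rp - rm) * (C * T)) := by gcongr
      _ = 1 / (rp - rm) ^ 2 * ((rp - rm) * C) * T := by ring
      _ ≤ _ := by
          have : 0 ≤ 1 / (rp - rm) * (g * C) := by positivity
          gcongr
          linarith

/-- The time integral of the squared perimeter grows at most like `T ^ 3`. -/
theorem exists_perimeter_bound (h : StratifiedSolution n L g rp rm ρ u p) :
    ∃ C, 0 ≤ C ∧ ∀ T, 1 ≤ T →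
      ∫⁻ τ in Set.Ioc 0 T, perimeter L rp rm (ρ τ) ^ 2 ≤ ENNReal.ofReal (C * T ^ 3) := by
  have hlt := sub_pos.2 h.light_lt
  obtain ⟨C, hC, hper⟩ := h.exists_truncPerimeter_bound
  refine ⟨(1 / (rp - rm)) ^ 2 * C, by positivity, fun T hT => ?_⟩
  have hT0 : 0 < T := by linarith
  obtain ⟨N₀, hN₀, hN⟩ := hper T hT
  -- The truncated estimates hold on `[s, T]` with `s > 0` and for large heights. `F k` uses height
  -- `2^k` and discards times up to `1/(k + 1)`; both restrictions disappear in the limit, and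
  -- Fatou's lemma transfers the bound.
  set F : ℕ → ℝ → ℝ≥0∞ := fun k τ => (Set.Ioi (1 / ((k : ℝ) + 1))).indicator
    (fun τ => ENNReal.ofReal (1 / (rp - rm) * truncPerimeter L (2 ^ k) (ρ τ)) ^ 2) τ with hF
  have hcont : ∀ k : ℕ, ContinuousOn (fun τ => truncPerimeter L (2 ^ k) (ρ τ)) (Set.Ioi 0) :=
    fun k => h.toIsClassicalSolution.continuousOn_truncPerimeter (by positivity)
  have hFm : ∀ k, AEMeasurable (F k) (volume.restrict (Set.Ioc 0 T)) := fun k => by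
    refine AEMeasurable.indicator ?_ measurableSet_Ioi
    have h1 : AEMeasurable (fun τ => truncPerimeter L (2 ^ k) (ρ τ))
        (volume.restrict (Set.Ioc 0 T)) :=
      ((hcont k).mono fun τ hτ => hτ.1).aemeasurable measurableSet_Ioc
    exact ((h1.const_mul _).ennreal_ofReal).pow_const 2
  have hlim : ∀ τ ∈ Set.Ioc 0 T, perimeter L rp rm (ρ τ) ^ 2 = liminf (fun k => F k τ) atTop := by
    intro τ hτ
    refine (Tendsto.liminf_eq ?_).symm
    have h1 := tendsto_truncPerimeter h.length_pos
      ((h.contDiff_density_space τ hτ.1).of_le (by norm_num))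
    have h2 : Tendsto (fun k : ℕ => (ENNReal.ofReal (1 / (rp - rm)) *
        ENNReal.ofReal (truncPerimeter L (2 ^ k) (ρ τ))) ^ 2) atTop
        (𝓝 (perimeter L rp rm (ρ τ) ^ 2)) :=
      ((ENNReal.continuous_pow 2).tendsto _).comp
        (ENNReal.Tendsto.const_mul h1 (Or.inr ENNReal.ofReal_ne_top))
    refine h2.congr' ?_
    have h3 := (tendsto_one_div_add_atTop_nhds_zero_nat (𝕜 := ℝ)).eventually (gt_mem_nhds hτ.1)
    filter_upwards [h3] with k hk
    rw [hF]
    dsimp only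
    rw [Set.indicator_of_mem (show τ ∈ Set.Ioi (1 / ((k : ℝ) + 1)) from hk),
      ENNReal.ofReal_mul (by positivity)]
  have hbound : ∀ᶠ k in atTop, ∫⁻ τ in Set.Ioc 0 T, F k τ ≤
      ENNReal.ofReal ((1 / (rp - rm)) ^ 2 * C * T ^ 3) := by
    have h3 := (tendsto_one_div_add_atTop_nhds_zero_nat (𝕜 := ℝ)).eventually (gt_mem_nhds hT0)
    have h4 := (tendsto_pow_atTop_atTop_of_one_lt (one_lt_two : (1 : ℝ) < 2)).eventually_ge_atTop N₀
    filter_upwards [h3, h4] with k hk hkN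
    set s := 1 / ((k : ℝ) + 1)
    have hs : 0 < s := by positivity
    have hci : IntegrableOn (fun τ => (1 / (rp - rm) * truncPerimeter L (2 ^ k) (ρ τ)) ^ 2)
        (Set.Ioc s T) := by
      have hc : ContinuousOn (fun τ => (1 / (rp - rm) * truncPerimeter L (2 ^ k) (ρ τ)) ^ 2)
          (Set.Icc s T) :=
        ((continuousOn_const.mul (hcont k)).pow 2).mono fun τ hτ => hs.trans_le hτ.1
      exact hc.integrableOn_Icc.mono_set Set.Ioc_subset_Icc_self
    have hset : Set.Ioi s ∩ Set.Ioc 0 T = Set.Ioc s T := by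
      ext τ
      simp only [Set.mem_inter_iff, Set.mem_Ioi, Set.mem_Ioc]
      exact ⟨fun h => ⟨h.1, h.2.2⟩, fun h => ⟨h.1, hs.trans h.1, h.2⟩⟩
    rw [lintegral_indicator measurableSet_Ioi, Measure.restrict_restrict measurableSet_Ioi, hset]
    have hnn : ∀ τ, 0 ≤ 1 / (rp - rm) * truncPerimeter L (2 ^ k) (ρ τ) := fun τ =>
      mul_nonneg (by positivity) (truncPerimeter_nonneg _ _)
    simp only [← ENNReal.ofReal_pow (hnn _)]
    rw [← ofReal_integral_eq_lintegral_ofReal hci (Eventually.of_forall fun τ => sq_nonneg _)]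
    refine ENNReal.ofReal_le_ofReal ?_
    rw [← intervalIntegral.integral_of_le hk.le]
    simp only [mul_pow]
    rw [intervalIntegral.integral_const_mul, mul_assoc]
    exact mul_le_mul_of_nonneg_left (hN _ hkN s ⟨hs, hk.le⟩) (by positivity)
  calc ∫⁻ τ in Set.Ioc 0 T, perimeter L rp rm (ρ τ) ^ 2
      = ∫⁻ τ in Set.Ioc 0 T, liminf (fun k => F k τ) atTop :=
        setLIntegral_congr_fun measurableSet_Ioc hlim
    _ ≤ liminf (fun k => ∫⁻ τ in Set.Ioc 0 T, F k τ) atTop := lintegral_liminf_le' hFm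
    _ ≤ _ := by
        refine liminf_le_of_frequently_le' hbound.frequently

end StratifiedSolution

/-! ### The limits at large times -/

lemma atwood_pos {rp rm : ℝ} (hrm : 0 < rm) (hrp : rm < rp) : 0 < atwood rp rm :=
  div_pos (by linarith) (by linarith)

lemma one_sub_atwood_sq_pos {rp rm : ℝ} (hrm : 0 < rm) (hrp : rm < rp) :
    0 < 1 - atwood rp rm ^ 2 := by
  have h1 := atwood_pos hrm hrp
  have h2 : atwood rp rm < 1 := (div_lt_one (by linarith)).2 (by linarith)
  nlinarith

/-- A quotient by a higher power of the time is eventually small. -/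
lemma eventually_div_le {f : ℝ → ℝ} {a C c : ℝ} {k m : ℕ} (ha : 0 < a) (hc : 0 < c) (hkm : k < m)
    (hf : ∀ t, 1 ≤ t → f t ≤ C * t ^ k) : ∀ᶠ t in atTop, f t / (a * t ^ m) ≤ c := by
  have hlim : Tendsto (fun t : ℝ => C / a * (t ^ k / t ^ m)) atTop (𝓝 (C / a * 0)) :=
    (tendsto_pow_div_pow_atTop_zero hkm).const_mul _
  rw [mul_zero] at hlim
  filter_upwards [hlim.eventually (ge_mem_nhds hc), eventually_ge_atTop 1] with t ht h1
  refine le_trans ?_ ht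
  have : 0 < t := by linarith
  calc f t / (a * t ^ m) ≤ C * t ^ k / (a * t ^ m) := by gcongr; exact hf t h1
    _ = _ := by field_simp

end RayleighTaylor

end

theorem mainTheorem1 (n : ℕ) (hn : 1 ≤ n) (L g rp rm : ℝ) (hL : 0 < L) (hg : 0 < g)
    (hrm : 0 < rm) (hrp : rm < rp)
    (ρ : ℝ → RayleighTaylor.Space n → ℝ)
    (u : ℝ → RayleighTaylor.Space n → RayleighTaylor.Space n)
    (p : ℝ → RayleighTaylor.Space n → ℝ)
    (hsol : RayleighTaylor.IsClassicalSolution n L g ρ u p)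
    (hrange : ∀ x, ρ 0 x ∈ Set.Icc rm rp)
    (hEp : Integrable (RayleighTaylor.potDensity g rp rm (ρ 0)) (RayleighTaylor.normVol n L))
    (hEk : Integrable (fun x => ρ 0 x * ‖u 0 x‖ ^ 2) (RayleighTaylor.normVol n L))
    (hH : Integrable (RayleighTaylor.mixDensity rp rm (ρ 0)) (RayleighTaylor.normVol n L))
    (hP : RayleighTaylor.perimeterBV L rp rm (ρ 0) < ⊤) :
    (∀ t, 0 ≤ t →
      Integrable (RayleighTaylor.potDensity g rp rm (ρ t)) (RayleighTaylor.normVol n L) ∧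
      Integrable (RayleighTaylor.mixDensity rp rm (ρ t)) (RayleighTaylor.normVol n L)) ∧
    limsup (fun t : ℝ => ((RayleighTaylor.potentialEnergy L g rp rm (ρ t) /
        (g * (RayleighTaylor.atwood rp rm * g * t ^ 2) ^ 2) : ℝ) : EReal)) atTop
      ≤ ((1 / (24 * (1 - RayleighTaylor.atwood rp rm ^ 2)) : ℝ) : EReal) ∧
    limsup (fun t : ℝ => ((RayleighTaylor.mixingEntropy L rp rm (ρ t) /
        (RayleighTaylor.atwood rp rm * g * t ^ 2) : ℝ) : EReal)) atTop
      ≤ ((1 / (12 * Real.sqrt (1 - RayleighTaylor.atwood rp rm ^ 2)) : ℝ) : EReal) ∧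
    limsup (fun t : ℝ =>
        (∫⁻ τ in Set.Ioc 0 t, RayleighTaylor.perimeter L rp rm (ρ τ) ^ 2) /
          ENNReal.ofReal ((RayleighTaylor.atwood rp rm * g * t ^ 2) ^ 2)) atTop
      ≤ ENNReal.ofReal (Real.pi / (36 * (1 - RayleighTaylor.atwood rp rm ^ 2))) := by
  have h : RayleighTaylor.StratifiedSolution n L g rp rm ρ u p :=
    { hsol with
      length_pos := hL
      gravity_pos := hg
      light_pos := hrm
      light_lt := hrp
      initial_range := hrange
      initial_potential := hEp
      initial_kinetic := hEk }
  have hA := RayleighTaylor.atwood_pos hrm hrp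
  have hA' := RayleighTaylor.one_sub_atwood_sq_pos hrm hrp
  set A := RayleighTaylor.atwood rp rm
  -- The growth rates `t²`, `t` and `t³` are each strictly below the normalizations `t⁴`, `t²` and
  -- `t⁴`, so each quotient is eventually smaller than any prescribed positive constant.
  obtain ⟨C, hC, hen⟩ := h.exists_energy_bound
  obtain ⟨C', hC', hper⟩ := h.exists_perimeter_bound
  refine ⟨fun t ht => ?_, ?_, ?_, ?_⟩
  · rcases ht.eq_or_lt with rfl | ht
    · exact ⟨hEp, hH⟩
    · obtain ⟨h1, h2, -⟩ := hen (max 1 t) (le_max_left _ _) t ⟨ht, le_max_right _ _⟩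
      exact ⟨h1, h2⟩
  · refine limsup_le_of_le (h := ?_)
    have := RayleighTaylor.eventually_div_le
      (f := fun t => RayleighTaylor.potentialEnergy L g rp rm (ρ t)) (a := g * (A * g) ^ 2)
      (C := C) (c := 1 / (24 * (1 - A ^ 2))) (k := 2) (m := 4) (by positivity) (by positivity)
      (by norm_num) fun t ht => (hen t ht t ⟨by linarith, le_rfl⟩).2.2.1
    filter_upwards [this] with t ht
    rw [EReal.coe_le_coe_iff]
    convert ht using 2
    ring
  · refine limsup_le_of_le (h := ?_)
    have := RayleighTaylor.eventually_div_le
      (f := fun t => RayleighTaylor.mixingEntropy L rp rm (ρ t)) (a := A * g)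
      (C := C) (c := 1 / (12 * Real.sqrt (1 - A ^ 2))) (k := 1) (m := 2) (by positivity)
      (by positivity) (by norm_num) fun t ht => by
        simpa using (hen t ht t ⟨by linarith, le_rfl⟩).2.2.2
    filter_upwards [this] with t ht
    rw [EReal.coe_le_coe_iff]
    exact ht
  · refine limsup_le_of_le (h := ?_)
    have := RayleighTaylor.eventually_div_le (f := fun t => C' * t ^ 3) (a := (A * g) ^ 2)
      (C := C') (c := Real.pi / (36 * (1 - A ^ 2))) (k := 3) (m := 4) (by positivity)
      (by positivity) (by norm_num) fun t _ => le_rfl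
    filter_upwards [this, eventually_ge_atTop 1] with t ht h1
    have ht0 : 0 < t := by linarith
    refine (ENNReal.div_le_div_right (hper t h1) _).trans ?_
    rw [← ENNReal.ofReal_div_of_pos (by positivity)]
    refine ENNReal.ofReal_le_ofReal ?_
    convert ht using 2
    ring
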